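/- Let $T$ be a complex algebraic group isomorphic to $\mathbb G_m^r$ for some $r\ge 0$, and let $M$ be a smooth irreducible complex projective variety with an algebraic action of $T$. Suppose that there is a dense $T$-stable Zariski open subset $M^0\subset M$ on which $T$ acts freely and transitively, and that the complement $D=M\setminus M^0$ is a simple normal crossing divisor. Let $H$ be any complex affine algebraic group, and let $p:E_H\to M$ be a $T$-equivariant algebraic principal $H$-bundle, that is, an algebraic principal $H$-bundle together with an algebraic action of $T$ on the total space $E_H$ that lifts the action on $M$ and commutes with the action of $H$. Let $TM(-\log D)\subset TM$ be the subsheaf of vector fields preserving the ideal sheaf $\mathcal O_M(-D)$ of functions vanishing on $D$. Let $\mathrm{At}(E_H)=(p_*TE_H)^H$, let $\phi:\mathrm{At}(E_H)\to TM$ be the map induced by $dp$, and put $\mathrm{At}(E_H)(-\log D)=\phi^{-1}(TM(-\log D))$. A logarithmic connection on $E_H$, singular along $D$, is an $\mathcal O_M$-linear homomorphism of sheaves $\delta: TM(-\log D)\to \mathrm{At}(E_H)(-\log D)$ with $\phi\circ\delta=\mathrm{id}$. It is integrable if $\delta([v,w])=[\delta(v),\delta(w)]$ for all local sections $v,w$.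 For $x_0\in M^0$ and $z_0\in (E_H)_{x_0}$ there is a unique $T$-equivariant isomorphism of principal $H$-bundles $M^0\times H\cong E_H|_{M^0}$ that takes $(x_0,e)$ to $z_0$ (here $T$ acts on $M^0\times H$ through $M^0$). Let $\mathcal D^0$ be the connection on $E_H|_{M^0}$ given, through this isomorphism, by the tautological connection $v\mapsto (v,0)$ of $M^0\times H$; it does not depend on the choice of $x_0$ and $z_0$. Then $E_H$ admits a logarithmic connection $\delta$, singular along $D$, that restricts to $\mathcal D^0$ on $M^0$, and $\delta$ is the only one with this property. Moreover $\delta$ is integrable, and its flat sections over $M^0$ are precisely the $T$-orbits in $E_H|_{M^0}$: each $T$-orbit in $E_H|_{M^0}$ is the image of a section over $M^0$, and an algebraic section of $E_H$ over a non-empty Zariski open subset $U\subset M^0$ is flat for $\delta$ if and only if it is the restriction to $U$ of such an orbit. -/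

import Mathlib

open CategoryTheory MonoidalCategory CartesianMonoidalCategory AlgebraicGeometry Opposite
open scoped MonObj

noncomputable section

namespace LogConn

/-- Schemes over `Spec ℂ`. The monoidal structure `⊗` of this category is the fibre product
over `ℂ` and `𝟙_` is `Spec ℂ`. -/
abbrev CSch : Type 1 := Over (Spec (.of ℂ))

/-- A `ℂ`-point of `X`. -/
abbrev Pt (X : CSch) : Type := 𝟙_ CSch ⟶ X

/-! ### Vector fields -/

/-- A section over `U` of the tangent sheaf of `X` over `ℂ`: a `ℂ`-linear derivation of the
sheaf of rings `𝒪_X` restricted to `U`, i.e. a family of `ℂ`-derivations of the rings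
`Γ(X, V)`, `V ≤ U`, compatible with restriction. -/
@[ext]
structure VF (X : CSch) (U : X.left.Opens) where
  /-- The derivation of `Γ(X, V)`. -/
  app (V : X.left.Opens) (hV : V ≤ U) : Γ(X.left, V) → Γ(X.left, V)
  app_add (V : X.left.Opens) (hV : V ≤ U) (a b : Γ(X.left, V)) :
    app V hV (a + b) = app V hV a + app V hV b
  app_mul (V : X.left.Opens) (hV : V ≤ U) (a b : Γ(X.left, V)) :
    app V hV (a * b) = a * app V hV b + b * app V hV a
  /-- Constants (functions pulled back from `Spec ℂ`) are killed. -/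
  app_const (V : X.left.Opens) (hV : V ≤ U) (c : Γ(Spec (.of ℂ), ⊤)) :
    app V hV (X.hom.appLE ⊤ V le_top c) = 0
  app_res (V V' : X.left.Opens) (hV : V ≤ U) (h : V' ≤ V) (a : Γ(X.left, V)) :
    app V' (h.trans hV) (X.left.presheaf.map (homOfLE h).op a) =
      X.left.presheaf.map (homOfLE h).op (app V hV a)

namespace VF

variable {X Y : CSch} {U : X.left.Opens}

instance : Zero (VF X U) where
  zero :=
    { app _ _ _ := 0
      app_add _ _ _ _ := by simp
      app_mul _ _ _ _ := by simp
      app_const _ _ _ := rfl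
      app_res _ _ _ _ _ := by simp }

instance : Add (VF X U) where
  add v w :=
    { app V hV a := v.app V hV a + w.app V hV a
      app_add V hV a b := by rw [v.app_add, w.app_add]; ring
      app_mul V hV a b := by rw [v.app_mul, w.app_mul]; ring
      app_const V hV c := by rw [v.app_const, w.app_const, add_zero]
      app_res V V' hV h a := by rw [v.app_res, w.app_res, map_add] }

instance : Neg (VF X U) where
  neg v :=
    { app V hV a := - v.app V hV a
      app_add V hV a b := by rw [v.app_add]; ring
      app_mul V hV a b := by rw [v.app_mul]; ring
      app_const V hV c := by rw [v.app_const, neg_zero]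
      app_res V V' hV h a := by rw [v.app_res, map_neg] }

/-- Multiplication of a vector field on `U` by a function on `U`. -/
instance : SMul Γ(X.left, U) (VF X U) where
  smul f v :=
    { app V hV a := X.left.presheaf.map (homOfLE hV).op f * v.app V hV a
      app_add V hV a b := by rw [v.app_add]; ring
      app_mul V hV a b := by rw [v.app_mul]; ring
      app_const V hV c := by rw [v.app_const, mul_zero]
      app_res V V' hV h a := by
        rw [v.app_res, map_mul, ← CommRingCat.comp_apply, ← Functor.map_comp]
        rfl }

@[simp] lemma zero_app (V : X.left.Opens) (hV : V ≤ U) (a : Γ(X.left, V)) :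
    (0 : VF X U).app V hV a = 0 := rfl
@[simp] lemma add_app (v w : VF X U) (V : X.left.Opens) (hV : V ≤ U) (a : Γ(X.left, V)) :
    (v + w).app V hV a = v.app V hV a + w.app V hV a := rfl
@[simp] lemma neg_app (v : VF X U) (V : X.left.Opens) (hV : V ≤ U) (a : Γ(X.left, V)) :
    (-v).app V hV a = -v.app V hV a := rfl
@[simp] lemma smul_app (f : Γ(X.left, U)) (v : VF X U) (V : X.left.Opens) (hV : V ≤ U)
    (a : Γ(X.left, V)) :
    (f • v).app V hV a = X.left.presheaf.map (homOfLE hV).op f * v.app V hV a := rfl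

instance : AddCommGroup (VF X U) where
  add_assoc u v w := by ext V hV a; simp [add_assoc]
  zero_add v := by ext V hV a; simp
  add_zero v := by ext V hV a; simp
  add_comm v w := by ext V hV a; simp [add_comm]
  neg_add_cancel v := by ext V hV a; simp
  nsmul := nsmulRec
  zsmul := zsmulRec

instance : Module Γ(X.left, U) (VF X U) where
  one_smul v := by ext V hV a; simp
  mul_smul f g v := by ext V hV a; simp [mul_assoc]
  smul_zero f := by ext V hV a; simp
  smul_add f v w := by ext V hV a; simp [mul_add]
  add_smul f g v := by ext V hV a; simp [add_mul]
  zero_smul v := by ext V hV a; simp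

/-- The Lie bracket `[v, w] = v ∘ w - w ∘ v` of vector fields. -/
instance : Bracket (VF X U) (VF X U) where
  bracket v w :=
    { app V hV a := v.app V hV (w.app V hV a) - w.app V hV (v.app V hV a)
      app_add V hV a b := by simp only [app_add]; ring
      app_mul V hV a b := by simp only [app_mul, app_add]; ring
      app_const V hV c := by
        have h0 (u : VF X U) : u.app V hV 0 = 0 := by
          have := u.app_add V hV 0 0
          simpa using this
        rw [w.app_const, v.app_const, h0, h0, sub_zero]
      app_res V V' hV h a := by rw [w.app_res, v.app_res, v.app_res, w.app_res, map_sub] }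

@[simp] lemma bracket_app (v w : VF X U) (V : X.left.Opens) (hV : V ≤ U) (a : Γ(X.left, V)) :
    ⁅v, w⁆.app V hV a = v.app V hV (w.app V hV a) - w.app V hV (v.app V hV a) := rfl

/-- Restriction of a vector field to a smaller open set. -/
def res (v : VF X U) {U' : X.left.Opens} (h : U' ≤ U) : VF X U' where
  app V hV := v.app V (hV.trans h)
  app_add V hV := v.app_add V (hV.trans h)
  app_mul V hV := v.app_mul V (hV.trans h)
  app_const V hV := v.app_const V (hV.trans h)
  app_res V V' hV := v.app_res V V' (hV.trans h)

/-- For a morphism `f : X ⟶ Y`, a vector field `w` on an open subset `U` of `X` is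
`f`-related to a vector field `v` on an open subset `U'` of `Y` if `df (w) = v ∘ f` on
`U ∩ f⁻¹ U'`, i.e. `w (f^* s) = f^* (v s)` for all local functions `s` on `Y`. -/
def Related (f : X ⟶ Y) {U' : Y.left.Opens} (w : VF X U) (v : VF Y U') : Prop :=
  ∀ (V : X.left.Opens) (hV : V ≤ U) (V' : Y.left.Opens) (hV' : V' ≤ U')
    (h : V ≤ f.left ⁻¹ᵁ V') (s : Γ(Y.left, V')),
    w.app V hV (f.left.appLE V' V h s) = f.left.appLE V' V h (v.app V' hV' s)

end VF

/-! ### Toric varieties -/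

/-- Projective space `ℙⁿ` over `ℂ`. -/
def projSpace (n : ℕ) : CSch :=
  letI := MvPolynomial.gradedAlgebra (σ := Fin (n + 1)) (R := ℂ)
  Over.mk (Proj.toSpecZero (MvPolynomial.homogeneousSubmodule (Fin (n + 1)) ℂ) ≫
    Spec.map (CommRingCat.ofHom
      (algebraMap ℂ (MvPolynomial.homogeneousSubmodule (Fin (n + 1)) ℂ 0))))

/-- `X` is projective over `ℂ`: it is a closed subscheme of some projective space. -/
def IsProjective (X : CSch) : Prop :=
  ∃ (n : ℕ) (i : X ⟶ projSpace n), IsClosedImmersion i.left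

/-- The standard torus `𝔾ₘ^r = Spec ℂ[ℤ^r]`. -/
abbrev stdTorus (r : ℕ) : CSch :=
  (Spec (.of (AddMonoidAlgebra ℂ (Fin r → ℤ)))).asOver (Spec (.of ℂ))

/-- `T` is isomorphic, as an algebraic group, to a product of copies of `𝔾ₘ`. -/
def IsTorus (T : CSch) [GrpObj T] : Prop :=
  ∃ (r : ℕ) (e : T ≅ stdTorus r), IsMonHom e.hom

/-- The complement of the open subset `W` of the locally Noetherian scheme `X`, with its reduced
structure, is a simple (also called strict) normal crossing divisor: at each point `x` of the
complement there is a regular system of parameters `u₁, …, u_d` of `𝒪_{X,x}` such that the ideal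
of germs of functions vanishing on the complement is generated by the product of some of the
`u_i`. (A function `f` vanishes on the complement of `W` iff the set `X.basicOpen f` where it is
invertible lies in `W`. The set `S` below is never empty, since `x ∉ W`.) -/
def IsSNCComplement {X : Scheme.{0}} (W : X.Opens) : Prop :=
  ∀ x : X, x ∉ W → ∃ (d : ℕ) (u : Fin d → X.presheaf.stalk x) (S : Finset (Fin d)),
    Ideal.span (Set.range u) = IsLocalRing.maximalIdeal (X.presheaf.stalk x) ∧
    ringKrullDim (X.presheaf.stalk x) = d ∧
    ∀ s : X.presheaf.stalk x,
      (∃ (V : X.Opens) (hx : x ∈ V) (f : Γ(X, V)),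
        X.basicOpen f ≤ W ∧ X.presheaf.germ V x hx f = s) ↔ (∏ i ∈ S, u i) ∣ s

/-- `M` is a smooth irreducible complex projective variety with an action of the torus `T`, and
`j : M⁰ ⟶ M` is (the inclusion of) a `T`-stable dense open subvariety on which `T` acts freely
and transitively, such that `D = M ∖ M⁰` is a simple normal crossing divisor. -/
structure IsSmoothToric (T : CSch) [GrpObj T] {M M₀ : CSch} [ModObj T M] [ModObj T M₀]
    (j : M₀ ⟶ M) : Prop where
  isTorus : IsTorus T
  smooth : Smooth M.hom
  integral : IsIntegral M.left
  projective : IsProjective M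
  isOpenImmersion : IsOpenImmersion j.left
  equivariant : IsModHom T j
  dense : DenseRange j.left
  /-- `T` acts freely and transitively: `T × M⁰ ⟶ M⁰ × M⁰`, `(t, x) ↦ (t x, x)` is an
  isomorphism. -/
  simplyTransitive : IsIso (lift γ[T, M₀] (snd T M₀))
  snc : ∀ W : M.left.Opens, (W : Set M.left) = Set.range j.left → IsSNCComplement W

/-- The orbit map `T ⟶ X`, `t ↦ t x` of a `ℂ`-point `x`. -/
def orbitMap (T : CSch) [GrpObj T] {X : CSch} [ModObj T X] (x : Pt X) : T ⟶ X :=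
  lift (𝟙 T) (toUnit T ≫ x) ≫ γ[T, X]

/-! ### Equivariant principal bundles -/

/-- An algebraic principal `H`-bundle on `M`: a faithfully flat morphism of finite type
`p : E ⟶ M` with a right action of `H` on `E` preserving the fibres of `p`, such that
`E × H ⟶ E ×_M E`, `(z, h) ↦ (z h, z)` is an isomorphism. -/
structure PrincipalBundle (H : CSch) [GrpObj H] (M : CSch) where
  /-- The total space. -/
  E : CSch
  /-- The projection. -/
  p : E ⟶ M
  /-- The right action of `H`. -/
  act : E ⊗ H ⟶ E
  act_one : E ◁ η[H] ≫ act = (ρ_ E).hom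
  act_mul : E ◁ μ[H] ≫ act = (α_ E H H).inv ≫ act ▷ H ≫ act
  flat : Flat p.left
  surjective : Surjective p.left
  locallyOfFiniteType : LocallyOfFiniteType p.left
  quasiCompact : QuasiCompact p.left
  isPullback : IsPullback act (fst E H) p p

/-- A `T`-equivariant principal `H`-bundle on `M`: the action of `T` on `M` is lifted to an
action on the total space that commutes with the action of `H`. -/
structure EquivariantBundle (T H : CSch) [GrpObj T] [GrpObj H] (M : CSch) [ModObj T M]
    extends PrincipalBundle H M where
  /-- The action of `T` on the total space. -/
  modObj : ModObj T E
  equivariant : IsModHom T p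
  commute : T ◁ act ≫ γ[T, E] = (α_ T E H).inv ≫ γ[T, E] ▷ H ≫ act

attribute [instance] EquivariantBundle.modObj

namespace PrincipalBundle

variable {H : CSch} [GrpObj H] {M : CSch} (P : PrincipalBundle H M)

/-- Right translation `z ↦ z h` of the total space by a `ℂ`-point `h` of `H`. -/
def translate (h : Pt H) : P.E ⟶ P.E := lift (𝟙 P.E) (toUnit P.E ≫ h) ≫ P.act

end PrincipalBundle

/-! ### Logarithmic vector fields and the Atiyah sheaf -/

/-- The sections over `U` of `TM(-log D)`, where `D` is the complement of the open set `W`: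
the vector fields preserving the ideal sheaf `𝒪_M(-D)` of functions vanishing on `D`. -/
def logTangent (M : CSch) (W : M.left.Opens) (U : M.left.Opens) :
    Submodule Γ(M.left, U) (VF M U) where
  carrier := {v | ∀ (V : M.left.Opens) (hV : V ≤ U) (f : Γ(M.left, V)),
    M.left.basicOpen f ≤ W → M.left.basicOpen (v.app V hV f) ≤ W}
  zero_mem' V hV f _ := by simp
  add_mem' hv hw V hV f hf :=
    (M.left.basicOpen_add_le _ _).trans (sup_le (hv V hV f hf) (hw V hV f hf))
  smul_mem' g v hv V hV f hf := by
    rw [VF.smul_app, Scheme.basicOpen_mul]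
    exact inf_le_right.trans (hv V hV f hf)

lemma bracket_mem_logTangent {M : CSch} {W U : M.left.Opens} {v w : VF M U}
    (hv : v ∈ logTangent M W U) (hw : w ∈ logTangent M W U) : ⁅v, w⁆ ∈ logTangent M W U := by
  intro V hV f hf
  rw [VF.bracket_app, sub_eq_add_neg]
  refine (M.left.basicOpen_add_le _ _).trans (sup_le (hv V hV _ (hw V hV f hf)) ?_)
  rw [← neg_one_mul, Scheme.basicOpen_mul]
  exact inf_le_right.trans (hw V hV _ (hv V hV f hf))

/-- The Lie bracket on the sections of `TM(-log D)`. -/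
instance {M : CSch} {W U : M.left.Opens} :
    Bracket (logTangent M W U) (logTangent M W U) where
  bracket v w := ⟨⁅v.1, w.1⁆, bracket_mem_logTangent v.2 w.2⟩

/-- Restriction of sections of `TM(-log D)`. -/
def logTangentRes {M : CSch} {W U U' : M.left.Opens} (h : U' ≤ U) (v : logTangent M W U) :
    logTangent M W U' :=
  ⟨v.1.res h, fun V hV f hf => v.2 V (hV.trans h) f hf⟩

variable {H : CSch} [GrpObj H] {M : CSch}

/-- The sections over `U` of the Atiyah sheaf `At(E) = (p_* TE)^H`: the vector fields on `p⁻¹ U`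
invariant under right translation by the elements of `H`. -/
def atiyah (P : PrincipalBundle H M) (U : M.left.Opens) :
    AddSubgroup (VF P.E (P.p.left ⁻¹ᵁ U)) where
  carrier := {w | ∀ h : Pt H, VF.Related (P.translate h) w w}
  zero_mem' h V hV V' hV' hh s := by simp
  add_mem' {v w} hv hw h V hV V' hV' hh s := by
    simp [hv h V hV V' hV' hh s, hw h V hV V' hV' hh s]
  neg_mem' {v} hv h V hV V' hV' hh s := by
    simp [hv h V hV V' hV' hh s]

/-- The sections over `U` of `At(E)(-log D) = φ⁻¹ (TM(-log D))`. The projection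
`φ : At(E) ⟶ TM` is given by `dp`, so that `φ (w) = v` says that `w` is `p`-related to `v`
(such a `v` is unique because `p` is faithfully flat). -/
def atiyahLog (P : PrincipalBundle H M) (W U : M.left.Opens) :
    AddSubgroup (VF P.E (P.p.left ⁻¹ᵁ U)) where
  carrier := {w | w ∈ atiyah P U ∧ ∃ v ∈ logTangent M W U, VF.Related P.p w v}
  zero_mem' := ⟨zero_mem _, 0, zero_mem _, fun V hV V' hV' hh s => by simp⟩
  add_mem' := by
    rintro a b ⟨ha, v, hv, hav⟩ ⟨hb, w, hw, hbw⟩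
    exact ⟨add_mem ha hb, v + w, add_mem hv hw, fun V hV V' hV' hh s => by
      simp [hav V hV V' hV' hh s, hbw V hV V' hV' hh s]⟩
  neg_mem' := by
    rintro a ⟨ha, v, hv, hav⟩
    exact ⟨neg_mem ha, -v, neg_mem hv, fun V hV V' hV' hh s => by
      simp [hav V hV V' hV' hh s]⟩

/-- A logarithmic connection on the principal bundle `P`, singular along the complement `D` of
`W`: a homomorphism of sheaves of `𝒪_M`-modules `δ : TM(-log D) ⟶ At(E)(-log D)` with
`φ ∘ δ = id`. -/
@[ext]
structure LogConnection (P : PrincipalBundle H M) (W : M.left.Opens) where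
  /-- The homomorphism on sections over `U`. -/
  app (U : M.left.Opens) : logTangent M W U →+ atiyahLog P W U
  app_smul (U : M.left.Opens) (f : Γ(M.left, U)) (v : logTangent M W U) :
    (app U (f • v)).1 = P.p.left.app U f • (app U v).1
  app_res (U U' : M.left.Opens) (h : U' ≤ U) (v : logTangent M W U) :
    (app U' (logTangentRes h v)).1 = (app U v).1.res (P.p.left.preimage_mono h)
  split (U : M.left.Opens) (v : logTangent M W U) : VF.Related P.p (app U v).1 v.1

namespace LogConnection

variable {P : PrincipalBundle H M} {W : M.left.Opens}

/-- The connection is integrable (flat): it preserves Lie brackets. -/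
def IsIntegrable (δ : LogConnection P W) : Prop :=
  ∀ (U : M.left.Opens) (v w : logTangent M W U),
    (δ.app U ⁅v, w⁆).1 = ⁅(δ.app U v).1, (δ.app U w).1⁆

/-- Let `i : U ⟶ M` be an open immersion. A section `σ : U ⟶ E` of the bundle over `U` is flat
if the connection is tangent to it: for each `v` with restriction `v₀` to `U`, one has
`dσ (v₀) = δ(v) ∘ σ`. -/
def IsFlatSection (δ : LogConnection P W) {U : CSch} (i : U ⟶ M) (σ : U ⟶ P.E) : Prop :=
  ∀ (V : M.left.Opens) (v : logTangent M W V),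
    ∃ v₀ : VF U (i.left ⁻¹ᵁ V), VF.Related i v₀ v.1 ∧ VF.Related σ v₀ (δ.app V v).1

end LogConnection

/-! ### The tautological connection over the open orbit -/

section Tautological

variable {T : CSch} [GrpObj T] {M₀ : CSch} [ModObj T M] [ModObj T M₀]

/-- `Φ` is the isomorphism of principal `H`-bundles `M⁰ × H ≅ E|_{M⁰}` which is `T`-equivariant
(`T` acting on `M⁰ × H` through `M⁰`) and takes `(x₀, e)` to `z₀`. -/
structure IsOrbitTrivialization (P : EquivariantBundle T H M) (j : M₀ ⟶ M)
    (x₀ : Pt M₀) (z₀ : Pt P.E) (Φ : M₀ ⊗ H ⟶ P.E) : Prop where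
  /-- `Φ` identifies `M⁰ × H` with the restriction of `E` to `M⁰`. -/
  isPullback : IsPullback Φ (fst M₀ H) P.p j
  act : Φ ▷ H ≫ P.act = (α_ M₀ H H).hom ≫ M₀ ◁ μ[H] ≫ Φ
  equivariant : T ◁ Φ ≫ γ[T, P.E] = (α_ T M₀ H).inv ≫ γ[T, M₀] ▷ H ≫ Φ
  base : lift x₀ η[H] ≫ Φ = z₀

/-- The logarithmic connection `δ` restricts over `M⁰` to the connection `𝒟⁰` that is obtained
from the tautological connection of the trivial bundle `M⁰ × H` through the trivialization `Φ`
given by base points `x₀` and `z₀`, for every choice of these base points. That is: for each `v`,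
with `w₀ = (v|_{M⁰}, 0)` the tautological lift of `v|_{M⁰}` to `M⁰ × H`, one has
`dΦ (w₀) = δ(v)`. -/
def RestrictsToTautological (P : EquivariantBundle T H M) (j : M₀ ⟶ M) {W : M.left.Opens}
    (δ : LogConnection P.toPrincipalBundle W) : Prop :=
  ∀ (x₀ : Pt M₀) (z₀ : Pt P.E), z₀ ≫ P.p = x₀ ≫ j →
    ∃ Φ : M₀ ⊗ H ⟶ P.E, IsOrbitTrivialization P j x₀ z₀ Φ ∧
      ∀ (V : M.left.Opens) (v : logTangent M W V),
        ∃ w₀ : VF (M₀ ⊗ H) ((fst M₀ H ≫ j).left ⁻¹ᵁ V),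
          VF.Related (fst M₀ H ≫ j) w₀ v.1 ∧ VF.Related (snd M₀ H) w₀ (0 : VF H ⊤) ∧
          VF.Related Φ w₀ (δ.app V v).1

/-- The section `s : M⁰ ⟶ E` over `M⁰` has the `T`-orbit of `z₀` as its image: it is
`t x₀ ↦ t z₀`, where `x₀` is the point of `M⁰` below `z₀`. -/
def IsOrbitSection (P : EquivariantBundle T H M) (j : M₀ ⟶ M) (z₀ : Pt P.E)
    (s : M₀ ⟶ P.E) : Prop :=
  s ≫ P.p = j ∧ ∃ x₀ : Pt M₀, z₀ ≫ P.p = x₀ ≫ j ∧ orbitMap T x₀ ≫ s = orbitMap T z₀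

/-- The flat sections of `δ` over `M⁰` are precisely the orbits of `T` in `E|_{M⁰}`: the orbit of
each point over `M⁰` is a section over `M⁰`, and a section over a non-empty open subset `U` of
`M⁰` is flat if and only if it is the restriction to `U` of such an orbit. -/
def FlatSectionsAreOrbits (P : EquivariantBundle T H M) (j : M₀ ⟶ M) {W : M.left.Opens}
    (δ : LogConnection P.toPrincipalBundle W) : Prop :=
  (∀ (x₀ : Pt M₀) (z₀ : Pt P.E), z₀ ≫ P.p = x₀ ≫ j → ∃ s : M₀ ⟶ P.E, IsOrbitSection P j z₀ s) ∧
  ∀ (U : CSch) (i : U ⟶ M₀) (σ : U ⟶ P.E), IsOpenImmersion i.left → Nonempty U.left →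
    σ ≫ P.p = i ≫ j →
    (δ.IsFlatSection (i ≫ j) σ ↔
      ∃ (z₀ : Pt P.E) (s : M₀ ⟶ P.E), IsOrbitSection P j z₀ s ∧ σ = i ≫ s)

end Tautological

end LogConn

end

noncomputable section

namespace LogConn

/-! ### Pulling back and restricting functions -/

section Functions

variable {X Y Z : Scheme.{0}}

/-! Each tangent vector of `T` at the unit generates a fundamental vector field on every scheme with
a `T`-action, and equivariant morphisms relate these fields. Let `ξ_i` be the fields of the
coordinate directions of the torus. The whole theorem rests on one fact: a logarithmic vector field
on `M` is, in a unique way, a combination `∑ f_i ξ_i` with regular coefficients. The connection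
sends it to `∑ p^* f_i ξ_i^E`. It is invariant under `H` because the two actions commute, and it is
integrable because the `ξ_i` commute, so that brackets on `M` and on `E` follow the same formula in
the coefficients (`VF.bracket_sum_smul`).

The coefficients are found as follows. An orbit map identifies the open orbit `W` with the torus,
and the Laurent monomials satisfy `ξ_i χ^m = m_i χ^m`. For a logarithmic `v` the quotient
`v(χ^m)/χ^m` is regular even along `D` (`exists_log_derivative`): near a boundary point `χ^m` is `A
/ g^n`, where `g` is the local equation of `D` and `A` divides a power of `g`. Normal crossings make
`g` a product of non-associated primes, so `g ∣ v(g)` passes to each prime factor and then to `A`.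
The quotient is additive in `m`, so its values on the standard basis of `ℤ^r` are the coefficients
(`TorusChart.exists_eq_sum_smul_ξ`). That the `ξ_i` are themselves logarithmic along `D` is not
needed.

Over `M⁰` an equivariant trivialization `Φ` relates `(ξ_i, 0)` to `ξ_i^E`, so the connection
restricts to the tautological one. Uniqueness holds because a vector field on `M⁰ × H` is determined
by its images on the two factors, and because functions on `E` inject into functions on `M⁰ × H`:
`M⁰` is dense and `p` is flat. An orbit is the image of an equivariant section, which carries `ξ_i`
to `ξ_i^E` and is therefore flat. Conversely, a flat section is given in the trivialization by a map
`h : U ⟶ H` whose pulled back functions are killed by all `ξ_i`. Such functions are constant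
(`TorusChart.eq_const_of_ξ_eq_zero`), so `h` is constant.

Vector fields are produced from infinitesimal flows `𝔻 × X ⟶ X` over the dual numbers, as
`ε`-coefficients of pulled back functions. Relatedness and commutation then become identities
between morphisms. -/

lemma appLE_appLE (f : X ⟶ Y) (g : Y ⟶ Z) {U : Z.Opens} {V : Y.Opens} {W : X.Opens}
    (h : V ≤ g ⁻¹ᵁ U) (h' : W ≤ f ⁻¹ᵁ V) (a : Γ(Z, U)) :
    f.appLE V W h' (g.appLE U V h a) =
      (f ≫ g).appLE U W (h'.trans (f.preimage_mono h)) a := by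
  rw [← CommRingCat.comp_apply, Scheme.Hom.appLE_comp_appLE]

lemma res_appLE (f : X ⟶ Y) {U : Y.Opens} {V V' : X.Opens} (h : V ≤ f ⁻¹ᵁ U) (i : V' ≤ V)
    (a : Γ(Y, U)) :
    X.presheaf.map (homOfLE i).op (f.appLE U V h a) = f.appLE U V' (i.trans h) a := by
  rw [← CommRingCat.comp_apply, Scheme.Hom.appLE_map]

lemma appLE_res (f : X ⟶ Y) {U U' : Y.Opens} {V : X.Opens} (h : V ≤ f ⁻¹ᵁ U') (i : U' ≤ U)
    (a : Γ(Y, U)) :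
    f.appLE U' V h (Y.presheaf.map (homOfLE i).op a) =
      f.appLE U V (h.trans (f.preimage_mono i)) a := by
  rw [← CommRingCat.comp_apply, Scheme.Hom.map_appLE]

lemma res_res {U V W : X.Opens} (h : V ≤ U) (h' : W ≤ V) (a : Γ(X, U)) :
    X.presheaf.map (homOfLE h').op (X.presheaf.map (homOfLE h).op a) =
      X.presheaf.map (homOfLE (h'.trans h)).op a := by
  rw [← CommRingCat.comp_apply, ← Functor.map_comp]
  rfl

lemma res_self {U : X.Opens} (h : U ≤ U) (a : Γ(X, U)) :
    X.presheaf.map (homOfLE h).op a = a := by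
  have : (homOfLE h).op = 𝟙 (op U) := rfl
  rw [this, X.presheaf.map_id]
  rfl

lemma id_appLE {U V : X.Opens} (h : V ≤ (𝟙 X) ⁻¹ᵁ U) (a : Γ(X, U)) :
    (𝟙 X : X ⟶ X).appLE U V h a = X.presheaf.map (homOfLE (show V ≤ U from h)).op a := by
  simp only [Scheme.Hom.appLE, Scheme.Hom.id_app]
  rfl

lemma section_ext_of_cover {U : X.Opens} {a b : Γ(X, U)}
    (h : ∀ x ∈ U, ∃ (V : X.Opens) (hV : V ≤ U), x ∈ V ∧
      X.presheaf.map (homOfLE hV).op a = X.presheaf.map (homOfLE hV).op b) : a = b := by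
  choose! V hV hx e using h
  refine X.sheaf.eq_of_locally_eq' (fun x : U => V x) U (fun x => homOfLE (hV x x.2)) ?_ a b ?_
  · intro x hxU
    simp only [TopologicalSpace.Opens.mem_iSup]
    exact ⟨⟨x, hxU⟩, hx x hxU⟩
  · exact fun x => e x x.2

/-- Gluing for sections that a property pins down: uniqueness makes the local choices agree on
overlaps. The property survives only locally in the conclusion, since `P` is not assumed to be a
local condition. -/
lemma exists_section_of_cover {U : X.Opens} (P : ∀ V : X.Opens, Γ(X, V) → Prop)
    (hP : ∀ (V V' : X.Opens) (h : V' ≤ V) (a : Γ(X, V)), P V a →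
      P V' (X.presheaf.map (homOfLE h).op a))
    (huniq : ∀ (V : X.Opens), V ≤ U → ∀ (a b : Γ(X, V)), P V a → P V b → a = b)
    (h : ∀ x ∈ U, ∃ (V : X.Opens), V ≤ U ∧ x ∈ V ∧ ∃ a : Γ(X, V), P V a) :
    ∃ a : Γ(X, U), ∀ x ∈ U, ∃ (V : X.Opens) (hV : V ≤ U), x ∈ V ∧
      P V (X.presheaf.map (homOfLE hV).op a) := by
  choose! V hV hx s hs using h
  obtain ⟨a, ha, -⟩ := X.sheaf.existsUnique_gluing' (fun x : U => V x) U
    (fun x => homOfLE (hV x x.2)) (fun x hxU => by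
      simp only [TopologicalSpace.Opens.mem_iSup]
      exact ⟨⟨x, hxU⟩, hx x hxU⟩) (fun x => s x) (fun x y => by
      exact huniq _ (inf_le_left.trans (hV x x.2)) _ _ (hP _ _ inf_le_left _ (hs x x.2))
        (hP _ _ inf_le_right _ (hs y y.2)))
  refine ⟨a, fun x hxU => ⟨V x, hV x hxU, hx x hxU, ?_⟩⟩
  have := ha ⟨x, hxU⟩
  erw [this]
  exact hs x hxU

end Functions

namespace VF

variable {X Y : CSch} {U : X.left.Opens}

lemma app_zero (v : VF X U) (V : X.left.Opens) (hV : V ≤ U) : v.app V hV 0 = 0 := by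
  simpa using v.app_add V hV 0 0

lemma app_one (v : VF X U) (V : X.left.Opens) (hV : V ≤ U) : v.app V hV 1 = 0 := by
  simpa using v.app_mul V hV 1 1

lemma app_neg (v : VF X U) (V : X.left.Opens) (hV : V ≤ U) (a : Γ(X.left, V)) :
    v.app V hV (-a) = -v.app V hV a := by
  rw [eq_neg_iff_add_eq_zero, ← v.app_add, neg_add_cancel, v.app_zero]

/-- The derivation of `Γ(X, V)` given by a vector field. -/
def toDerivation (v : VF X U) (V : X.left.Opens) (hV : V ≤ U) :
    Derivation ℤ Γ(X.left, V) Γ(X.left, V) :=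
  Derivation.mk' (AddMonoidHom.mk' (v.app V hV) (v.app_add V hV)).toIntLinearMap
    (v.app_mul V hV)

@[simp] lemma toDerivation_apply (v : VF X U) (V : X.left.Opens) (hV : V ≤ U)
    (a : Γ(X.left, V)) : v.toDerivation V hV a = v.app V hV a := rfl

lemma app_sum {I : Type*} (v : VF X U) (V : X.left.Opens) (hV : V ≤ U) (s : Finset I)
    (a : I → Γ(X.left, V)) : v.app V hV (∑ i ∈ s, a i) = ∑ i ∈ s, v.app V hV (a i) :=
  map_sum (v.toDerivation V hV) a s

lemma sum_app {I : Type*} (s : Finset I) (v : I → VF X U) (V : X.left.Opens) (hV : V ≤ U)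
    (a : Γ(X.left, V)) : (∑ i ∈ s, v i).app V hV a = ∑ i ∈ s, (v i).app V hV a := by
  classical
  induction s using Finset.induction_on with
  | empty => simp
  | insert i s hi ih => simp [Finset.sum_insert hi, ih]

@[simp] lemma sub_app (v w : VF X U) (V : X.left.Opens) (hV : V ≤ U) (a : Γ(X.left, V)) :
    (v - w).app V hV a = v.app V hV a - w.app V hV a := by
  rw [sub_eq_add_neg, sub_eq_add_neg]
  rfl

@[simp] lemma res_app (v : VF X U) {U' : X.left.Opens} (h : U' ≤ U) (V : X.left.Opens)
    (hV : V ≤ U') (a : Γ(X.left, V)) : (v.res h).app V hV a = v.app V (hV.trans h) a := rfl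

/-- Vector fields on an open subset of an affine open set agree if they agree on generators of its
ring of functions. -/
lemma ext_of_generators {v w : VF X U} {V : X.left.Opens} (hV : IsAffineOpen V) (hUV : U ≤ V)
    (s : Set Γ(X.left, V)) (hs : Subring.closure s = ⊤)
    (h : ∀ a ∈ s, v.app U le_rfl (X.left.presheaf.map (homOfLE hUV).op a) =
      w.app U le_rfl (X.left.presheaf.map (homOfLE hUV).op a)) : v = w := by
  have key (a : Γ(X.left, V)) : (v - w).app U le_rfl (X.left.presheaf.map (homOfLE hUV).op a) =
      0 := by
    have ha : a ∈ Subring.closure s := hs ▸ Subring.mem_top a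
    induction ha using Subring.closure_induction with
    | mem a ha => simp [h a ha]
    | zero => rw [map_zero, app_zero]
    | one => rw [map_one, app_one]
    | add a b _ _ ha hb => rw [map_add, app_add, ha, hb, add_zero]
    | neg a _ ha => rw [map_neg, app_neg, ha, neg_zero]
    | mul a b _ _ ha hb => rw [map_mul, app_mul, ha, hb, mul_zero, mul_zero, add_zero]
  suffices v - w = 0 from sub_eq_zero.1 this
  generalize v - w = d at key ⊢
  ext V' hV' a
  rw [zero_app]
  refine section_ext_of_cover fun x hx => ?_
  obtain ⟨f, hf, hxf⟩ := hV.exists_basicOpen_le (V := V') ⟨x, hx⟩ (hUV (hV' hx))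
  refine ⟨X.left.basicOpen f, hf, hxf, ?_⟩
  rw [← d.app_res, map_zero]
  have := hV.isLocalization_basicOpen f
  generalize X.left.presheaf.map (homOfLE hf).op a = b
  -- On the basic open set `b` is a fraction `c / f ^ n` with `c` and `f` coming from `V`. The
  -- derivation kills both, and `f ^ n` is a unit.
  obtain ⟨n, c, hc⟩ := IsLocalization.Away.surj f b
  have hcomp (c : Γ(X.left, V)) : d.app (X.left.basicOpen f) (hf.trans hV')
      (algebraMap Γ(X.left, V) Γ(X.left, X.left.basicOpen f) c) = 0 := by
    have := d.app_res U (X.left.basicOpen f) le_rfl (hf.trans hV')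
      (X.left.presheaf.map (homOfLE hUV).op c)
    rw [key, map_zero, res_res] at this
    exact this
  have hu : IsUnit (algebraMap Γ(X.left, V) Γ(X.left, X.left.basicOpen f) f ^ n) :=
    (IsLocalization.Away.algebraMap_isUnit f).pow n
  have h1 := hcomp c
  rw [← hc, d.app_mul, ← map_pow, hcomp, mul_zero, zero_add, map_pow] at h1
  exact hu.mul_right_eq_zero.1 h1

end VF

/-! ### Dual numbers -/

/-- The universal property maps `P` into the subring generated by the two images, and the composite
with the inclusion back into `P` is the identity. -/
lemma closure_range_union_of_isPushout {R A B P : CommRingCat.{0}} {f : R ⟶ A} {g : R ⟶ B}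
    {i : A ⟶ P} {k : B ⟶ P} (h : IsPushout f g i k) :
    Subring.closure (Set.range i ∪ Set.range k) = ⊤ := by
  set S : Subring P := Subring.closure (Set.range i ∪ Set.range k) with hS
  let i' : A ⟶ CommRingCat.of S := CommRingCat.ofHom
    (i.hom.codRestrict S fun a => Subring.subset_closure (.inl ⟨a, rfl⟩))
  let k' : B ⟶ CommRingCat.of S := CommRingCat.ofHom
    (k.hom.codRestrict S fun a => Subring.subset_closure (.inr ⟨a, rfl⟩))
  have hw : f ≫ i' = g ≫ k' := by
    ext r
    exact congr($(h.w) r)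
  have hd : h.desc i' k' hw ≫ CommRingCat.ofHom S.subtype = 𝟙 P := by
    apply h.hom_ext
    · rw [h.inl_desc_assoc, Category.comp_id]; rfl
    · rw [h.inr_desc_assoc, Category.comp_id]; rfl
  refine eq_top_iff.2 fun x _ => ?_
  have : (h.desc i' k' hw ≫ CommRingCat.ofHom S.subtype) x = x := by rw [hd]; rfl
  rw [← this]
  exact (h.desc i' k' hw x).2

-- This is `A ⊗ R[ε] = A[ε]`. Injectivity is seen after mapping `P` to `DualNumber A`. Surjectivity
-- holds because the elements `a + ε b` form a subring containing both images.
open DualNumber in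
lemma bijective_of_isPushout_dualNumber {R : Type} [CommRing R] {A P : CommRingCat.{0}}
    {f : CommRingCat.of R ⟶ A} {i : A ⟶ P} {k : CommRingCat.of (DualNumber R) ⟶ P}
    (h : IsPushout f (CommRingCat.ofHom (algebraMap R (DualNumber R))) i k) :
    Function.Bijective fun x : A × A => i x.1 + k (ε : DualNumber R) * i x.2 := by
  let _ : Algebra R A := f.hom.toAlgebra
  let i' : A ⟶ CommRingCat.of (DualNumber A) := CommRingCat.ofHom (TrivSqZeroExt.inlHom A A)
  let k' : CommRingCat.of (DualNumber R) ⟶ CommRingCat.of (DualNumber A) :=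
    CommRingCat.ofHom (DualNumber.lift
      ⟨(Algebra.ofId R (DualNumber A), (ε : DualNumber A)), by simp,
        fun r => mul_comm _ _⟩).toRingHom
  have hk' : k' (ε : DualNumber R) = (ε : DualNumber A) := by
    simp [k']
  have hw : f ≫ i' = CommRingCat.ofHom (algebraMap R (DualNumber R)) ≫ k' := by
    refine CommRingCat.hom_ext (RingHom.ext fun r => ?_)
    exact (AlgHom.commutes (DualNumber.lift (A := R) (B := DualNumber A)
      ⟨(Algebra.ofId R (DualNumber A), (ε : DualNumber A)), by simp, fun r => mul_comm _ _⟩)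
      r).symm
  let φ := h.desc i' k' hw
  have hφi (a : A) : φ (i a) = TrivSqZeroExt.inl a := congr($(h.inl_desc i' k' hw) a)
  have hφk (a : DualNumber R) : φ (k a) = k' a := congr($(h.inr_desc i' k' hw) a)
  have hE : k (ε : DualNumber R) * k (ε : DualNumber R) = 0 := by
    rw [← map_mul, DualNumber.eps_mul_eps, map_zero]
  constructor
  · rintro ⟨a, b⟩ ⟨a', b'⟩ hab
    have := congr(φ $hab)
    simp only [map_add, map_mul, hφi, hφk, hk'] at this
    have h1 := congr(TrivSqZeroExt.fst $this)
    have h2 := congr(TrivSqZeroExt.snd $this)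
    simp at h1 h2
    simp [h1, h2]
  · intro x
    have hx : x ∈ Subring.closure (Set.range i ∪ Set.range k) := by
      rw [closure_range_union_of_isPushout h]; trivial
    induction hx using Subring.closure_induction with
    | mem x hx =>
      rcases hx with ⟨a, rfl⟩ | ⟨a, rfl⟩
      · exact ⟨(a, 0), by simp⟩
      · refine ⟨(f a.fst, f a.snd), ?_⟩
        have hr (r : R) : i (f r) = k (algebraMap R (DualNumber R) r) := congr($(h.w) r)
        simp only [hr, ← map_mul, ← map_add]
        congr 1
        ext <;> simp [TrivSqZeroExt.algebraMap_eq_inl]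
    | zero => exact ⟨(0, 0), by simp⟩
    | one => exact ⟨(1, 0), by simp⟩
    | add x y _ _ hx hy =>
      obtain ⟨⟨a, b⟩, rfl⟩ := hx
      obtain ⟨⟨a', b'⟩, rfl⟩ := hy
      exact ⟨(a + a', b + b'), by simp; ring⟩
    | neg x _ hx =>
      obtain ⟨⟨a, b⟩, rfl⟩ := hx
      exact ⟨(-a, -b), by simp; ring⟩
    | mul x y _ _ hx hy =>
      obtain ⟨⟨a, b⟩, rfl⟩ := hx
      obtain ⟨⟨a', b'⟩, rfl⟩ := hy
      refine ⟨(a * a', a * b' + b * a'), ?_⟩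
      simp only [map_add, map_mul]
      linear_combination (-(i b * i b')) * hE

/-- The spectrum `𝔻` of the dual numbers. -/
def dualSpec : CSch :=
  Over.mk (Spec.map (CommRingCat.ofHom (algebraMap ℂ (DualNumber ℂ))))

/-- The closed point of `𝔻`. -/
def dualPt : 𝟙_ CSch ⟶ dualSpec :=
  Over.homMk (Spec.map (CommRingCat.ofHom
    ((TrivSqZeroExt.fstHom ℂ ℂ ℂ : DualNumber ℂ →ₐ[ℂ] ℂ) : DualNumber ℂ →+* ℂ))) (by
    simp only [dualSpec, Over.mk_hom, Over.tensorUnit_hom, ← Spec.map_comp]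
    erw [← Spec.map_id]
    congr 1)

/-- The coordinate `ε` of `𝔻`. -/
def dualEps : Γ(dualSpec.left, ⊤) :=
  (Scheme.ΓSpecIso (.of (DualNumber ℂ))).inv (DualNumber.eps : DualNumber ℂ)

/-- The function `ε` on an open subset of `𝔻 × X`. -/
def epsOn (X : CSch) (V : (dualSpec ⊗ X).left.Opens) : Γ((dualSpec ⊗ X).left, V) :=
  (fst dualSpec X).left.appLE ⊤ V le_top dualEps

lemma dualEps_mul_self : dualEps * dualEps = 0 := by
  exact ((map_mul (Scheme.ΓSpecIso (.of (DualNumber ℂ))).inv.hom _ _).symm.trans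
    (congrArg _ DualNumber.eps_mul_eps)).trans (map_zero _)

lemma epsOn_mul_self (X : CSch) (V : (dualSpec ⊗ X).left.Opens) :
    epsOn X V * epsOn X V = 0 := by
  rw [epsOn, ← map_mul, dualEps_mul_self, map_zero]

lemma res_epsOn (X : CSch) {V V' : (dualSpec ⊗ X).left.Opens} (h : V' ≤ V) :
    (dualSpec ⊗ X).left.presheaf.map (homOfLE h).op (epsOn X V) = epsOn X V' :=
  res_appLE _ _ h _

lemma exists_affine_le {X : Scheme.{0}} {V : X.Opens} {x : X} (hx : x ∈ V) :
    ∃ V' : X.Opens, IsAffineOpen V' ∧ V' ≤ V ∧ x ∈ V' := by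
  obtain ⟨_, ⟨V', hV', rfl⟩, hxV', hle⟩ := X.isBasis_affineOpens.exists_subset_of_mem_open hx V.2
  exact ⟨V', hV', hle, hxV'⟩

lemma isPullback_fst_snd (X Y : CSch) :
    IsPullback (fst X Y).left (snd X Y).left X.hom Y.hom :=
  IsPullback.of_hasPullback X.hom Y.hom

lemma bijective_dual_of_isAffineOpen (X : CSch) {V : X.left.Opens} (hV : IsAffineOpen V) :
    Function.Bijective fun x : Γ(X.left, V) × Γ(X.left, V) =>
      (snd dualSpec X).left.app V x.1 + epsOn X _ * (snd dualSpec X).left.app V x.2 := by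
  have h := isPullback_fst_snd dualSpec X
  have haff : IsAffine dualSpec.left := by dsimp [dualSpec]; infer_instance
  have := isIso_pushoutSection_of_isAffineOpen h (US := ⊤) (UX := ⊤) (UT := V) le_top le_top
    (UY := (snd dualSpec X).left ⁻¹ᵁ V) (by simp) (isAffineOpen_top _) hV (isAffineOpen_top _)
  have h1 := (isIso_pushoutSection_iff ..).mp this
  have h2 : IsPushout ((Scheme.ΓSpecIso (.of ℂ)).inv ≫ X.hom.appLE ⊤ V le_top)
      (CommRingCat.ofHom (algebraMap ℂ (DualNumber ℂ)))
      ((snd dualSpec X).left.app V)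
      ((Scheme.ΓSpecIso (.of (DualNumber ℂ))).inv ≫
        (fst dualSpec X).left.appLE ⊤ _ le_top) := by
    refine IsPushout.of_iso h1.flip (Scheme.ΓSpecIso (.of ℂ)) (Iso.refl _)
      (Scheme.ΓSpecIso (.of (DualNumber ℂ))) (Iso.refl _) ?_ ?_ ?_ ?_
    · simp
    · have := Scheme.ΓSpecIso_naturality (CommRingCat.ofHom (algebraMap ℂ (DualNumber ℂ)))
      rw [Scheme.Hom.appTop, Scheme.Hom.app_eq_appLE] at this
      exact this
    · rw [Iso.refl_hom, Iso.refl_hom, Category.id_comp, Category.comp_id,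
        Scheme.Hom.app_eq_appLE]
    · rw [Iso.refl_hom, Category.comp_id]
      exact (Iso.hom_inv_id_assoc (Scheme.ΓSpecIso (.of (DualNumber ℂ))) _).symm
  exact bijective_of_isPushout_dualNumber h2

/-- Functions on `𝔻 × V` are `Γ(V)[ε]`. The affine case is base change, and uniqueness of the two
coefficients lets them be glued over an arbitrary open set. -/
lemma bijective_dual (X : CSch) (V : X.left.Opens) :
    Function.Bijective fun x : Γ(X.left, V) × Γ(X.left, V) =>
      (snd dualSpec X).left.app V x.1 + epsOn X _ * (snd dualSpec X).left.app V x.2 := by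
  set q := (snd dualSpec X).left with hq
  have hres {V V' : X.left.Opens} (h : V' ≤ V) (x : Γ(X.left, V) × Γ(X.left, V)) :
      (dualSpec ⊗ X).left.presheaf.map (homOfLE (q.preimage_mono h)).op
        (q.app V x.1 + epsOn X _ * q.app V x.2) =
      q.app V' (X.left.presheaf.map (homOfLE h).op x.1) +
        epsOn X _ * q.app V' (X.left.presheaf.map (homOfLE h).op x.2) := by
    simp only [Scheme.Hom.app_eq_appLE, map_add, map_mul, res_appLE, appLE_res, res_epsOn]
  have hinj (V : X.left.Opens) : Function.Injective fun x : Γ(X.left, V) × Γ(X.left, V) =>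
      q.app V x.1 + epsOn X _ * q.app V x.2 := by
    intro x y hxy
    have (z : X.left) (hz : z ∈ V) : ∃ (V' : X.left.Opens) (hV : V' ≤ V), z ∈ V' ∧
        X.left.presheaf.map (homOfLE hV).op x.1 = X.left.presheaf.map (homOfLE hV).op y.1 ∧
        X.left.presheaf.map (homOfLE hV).op x.2 = X.left.presheaf.map (homOfLE hV).op y.2 := by
      obtain ⟨V', hV', hle, hzV'⟩ := exists_affine_le hz
      refine ⟨V', hle, hzV', ?_⟩
      have := congr((dualSpec ⊗ X).left.presheaf.map (homOfLE (q.preimage_mono hle)).op $hxy)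
      rw [hres, hres] at this
      exact Prod.ext_iff.1 (@(bijective_dual_of_isAffineOpen X hV').1 (_, _) (_, _) this)
    refine Prod.ext (section_ext_of_cover fun z hz => ?_) (section_ext_of_cover fun z hz => ?_)
    · obtain ⟨V', hV, hz, h1, h2⟩ := this z hz
      exact ⟨V', hV, hz, h1⟩
    · obtain ⟨V', hV, hz, h1, h2⟩ := this z hz
      exact ⟨V', hV, hz, h2⟩
  refine ⟨hinj V, fun y => ?_⟩
  let y' (V' : X.left.Opens) (h : V' ≤ V) : Γ((dualSpec ⊗ X).left, q ⁻¹ᵁ V') :=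
    (dualSpec ⊗ X).left.presheaf.map (homOfLE (q.preimage_mono h)).op y
  have hy' {V' V'' : X.left.Opens} (h : V' ≤ V) (h' : V'' ≤ V') {a b : Γ(X.left, V')}
      (e : y' V' h = q.app V' a + epsOn X _ * q.app V' b) : y' V'' (h'.trans h) =
        q.app V'' (X.left.presheaf.map (homOfLE h').op a) +
          epsOn X _ * q.app V'' (X.left.presheaf.map (homOfLE h').op b) := by
    rw [← hres h' (a, b), ← e]
    exact (res_res _ _ _).symm
  have hloc (x : X.left) (hx : x ∈ V) : ∃ (V' : X.left.Opens) (h : V' ≤ V), x ∈ V' ∧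
      ∃ a b, y' V' h = q.app V' a + epsOn X _ * q.app V' b := by
    obtain ⟨V', hV', hle, hzV'⟩ := exists_affine_le hx
    obtain ⟨⟨a, b⟩, e⟩ := (bijective_dual_of_isAffineOpen X hV').2 (y' V' hle)
    exact ⟨V', hle, hzV', a, b, e.symm⟩
  obtain ⟨a, ha⟩ := exists_section_of_cover (U := V)
    (fun V' a => ∃ (h : V' ≤ V) (b : Γ(X.left, V')), y' V' h = q.app V' a + epsOn X _ * q.app V' b)
    (fun V' V'' h a ⟨h', b, e⟩ => ⟨h.trans h', _, hy' h' h e⟩)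
    (fun V' hV' a a' ⟨_, b, e⟩ ⟨_, b', e'⟩ =>
      (Prod.ext_iff.1 (@hinj V' (a, b) (a', b') (e.symm.trans e'))).1)
    (fun x hx => by
      obtain ⟨V', h, hx, a, b, e⟩ := hloc x hx
      exact ⟨V', h, hx, a, h, b, e⟩)
  obtain ⟨b, hb⟩ := exists_section_of_cover (U := V)
    (fun V' b => ∃ (h : V' ≤ V) (a : Γ(X.left, V')), y' V' h = q.app V' a + epsOn X _ * q.app V' b)
    (fun V' V'' h a ⟨h', b, e⟩ => ⟨h.trans h', _, hy' h' h e⟩)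
    (fun V' hV' b b' ⟨_, a, e⟩ ⟨_, a', e'⟩ =>
      (Prod.ext_iff.1 (@hinj V' (a, b) (a', b') (e.symm.trans e'))).2)
    (fun x hx => by
      obtain ⟨V', h, hx, a, b, e⟩ := hloc x hx
      exact ⟨V', h, hx, b, h, a, e⟩)
  refine ⟨(a, b), section_ext_of_cover fun z hz => ?_⟩
  obtain ⟨V₁, h₁, hz₁, _, b', e₁⟩ := ha (q z) hz
  obtain ⟨V₂, h₂, hz₂, _, a', e₂⟩ := hb (q z) hz
  refine ⟨q ⁻¹ᵁ (V₁ ⊓ V₂), q.preimage_mono (inf_le_left.trans h₁), ⟨hz₁, hz₂⟩, ?_⟩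
  have e₁' := hy' h₁ (inf_le_left : V₁ ⊓ V₂ ≤ V₁) e₁
  have e₂' := hy' h₂ (inf_le_right : V₁ ⊓ V₂ ≤ V₂) e₂
  -- The coefficients `a` and `b` were glued independently, each with its own local partner.
  -- Uniqueness on `V₁ ⊓ V₂` shows that they are partners of each other.
  have e := Prod.ext_iff.1 (@hinj _ (_, _) (_, _) (e₁'.symm.trans e₂'))
  simp only [res_res] at e e₁' e₂'
  rw [hres, ← e.2]
  exact e₁'.symm

/-! ### Infinitesimal flows -/

section

lemma isPullback_left {X Y Z W : CSch} {f : X ⟶ Y} {g : X ⟶ Z} {h : Y ⟶ W} {k : Z ⟶ W}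
    (H : IsPullback f g h k) : IsPullback f.left g.left h.left k.left :=
  H.map (Over.forget _)

/-- The kernel of `ℂ[ε] → ℂ` squares to zero, so it lies in every prime. By base change `zeroSec X`
is surjective, which is why flows do nothing on points. -/
instance : Surjective dualPt.left := by
  constructor
  have h : Function.Surjective (PrimeSpectrum.comap
      ((TrivSqZeroExt.fstHom ℂ ℂ ℂ : DualNumber ℂ →ₐ[ℂ] ℂ) : DualNumber ℂ →+* ℂ)) := by
    rw [← Set.range_eq_univ, range_comap_of_surjective _ _
      TrivSqZeroExt.fst_surjective, PrimeSpectrum.zeroLocus_eq_univ_iff]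
    intro x hx
    have hx0 : x.fst = 0 := hx
    refine ⟨2, ?_⟩
    rw [sq]
    ext <;> simp [hx0]
  exact h

/-- The section `x ↦ (0, x)` of the projection `𝔻 × X ⟶ X`. -/
def zeroSec (X : CSch) : X ⟶ dualSpec ⊗ X := lift (toUnit X ≫ dualPt) (𝟙 X)

@[simp]
lemma zeroSec_snd (X : CSch) : zeroSec X ≫ snd _ _ = 𝟙 X := lift_snd _ _

@[simp]
lemma zeroSec_fst (X : CSch) : zeroSec X ≫ fst _ _ = toUnit X ≫ dualPt := lift_fst _ _

@[simp]
lemma zeroSec_snd_assoc {X Y : CSch} (f : X ⟶ Y) : zeroSec X ≫ snd _ _ ≫ f = f := by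
  rw [← Category.assoc, zeroSec_snd, Category.id_comp]

lemma isPullback_zeroSec (X : CSch) :
    IsPullback (zeroSec X) (toUnit X) (fst dualSpec X) dualPt := by
  refine ⟨⟨zeroSec_fst X⟩, ⟨Limits.PullbackCone.IsLimit.mk _ (fun s => s.fst ≫ snd _ _) ?_ ?_ ?_⟩⟩
  · intro s
    ext1
    · simp [s.condition, toUnit_unique (toUnit s.pt) s.snd]
    · simp
  · intro s
    exact toUnit_unique _ _
  · intro s m h1 _
    rw [← h1, Category.assoc, zeroSec_snd, Category.comp_id]

instance (X : CSch) : Surjective (zeroSec X).left :=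
  MorphismProperty.of_isPullback (P := @Surjective) (isPullback_left (isPullback_zeroSec X)).flip
    inferInstance

/-- An infinitesimal flow on `X`: a morphism `𝔻 × X ⟶ X` that is the identity over the closed
point of `𝔻`. -/
def IsFlow {X : CSch} (θ : dualSpec ⊗ X ⟶ X) : Prop := zeroSec X ≫ θ = 𝟙 X

lemma isFlow_snd (X : CSch) : IsFlow (snd dualSpec X) := zeroSec_snd X

/-- The flow and the projection agree after composing with the surjection `zeroSec X`, hence on
points. Pullbacks along the flow of functions on `V` therefore live on `𝔻 × V` and can be expanded
in `ε`. -/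
lemma IsFlow.preimage_eq {X : CSch} {θ : dualSpec ⊗ X ⟶ X} (hθ : IsFlow θ) (V : X.left.Opens) :
    θ.left ⁻¹ᵁ V = (snd dualSpec X).left ⁻¹ᵁ V := by
  ext z
  obtain ⟨x, rfl⟩ := (zeroSec X).left.surjective z
  have h1 := congr($(congrArg CommaMorphism.left hθ) x)
  have h2 := congr($(congrArg CommaMorphism.left (zeroSec_snd X)) x)
  simp only [Over.comp_left, Scheme.Hom.comp_apply] at h1 h2
  change θ.left _ ∈ V ↔ (snd dualSpec X).left _ ∈ V
  rw [h1, h2]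

lemma left_comp_eq {X Y Z : CSch} {f : X ⟶ Y} {g : Y ⟶ Z} {h : X ⟶ Z} (e : f ≫ g = h) :
    f.left ≫ g.left = h.left := by rw [← e]; rfl

lemma appLE_congr_left {X Y : Scheme.{0}} {f g : X ⟶ Y} (e : f = g) {U : Y.Opens} {V : X.Opens}
    (h : V ≤ f ⁻¹ᵁ U) (a : Γ(Y, U)) :
    f.appLE U V h a = g.appLE U V (e ▸ h) a := by subst e; rfl

lemma dualPt_dualEps (V : (𝟙_ CSch).left.Opens) (h) : dualPt.left.appLE ⊤ V h dualEps = 0 := by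
  have := Scheme.ΓSpecIso_inv_naturality (CommRingCat.ofHom
    ((TrivSqZeroExt.fstHom ℂ ℂ ℂ : DualNumber ℂ →ₐ[ℂ] ℂ) : DualNumber ℂ →+* ℂ))
  have h2 := congr($this (DualNumber.eps : DualNumber ℂ))
  have h3 : dualPt.left.appLE ⊤ ⊤ le_top dualEps = 0 := by
    rw [Scheme.Hom.appTop, Scheme.Hom.app_eq_appLE] at h2
    refine h2.symm.trans ?_
    refine (congrArg (Scheme.ΓSpecIso (.of ℂ)).inv
      (show (TrivSqZeroExt.fst (DualNumber.eps : DualNumber ℂ)) = 0 by simp)).trans (map_zero _)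
  rw [← res_appLE dualPt.left le_top le_top, h3, map_zero]

lemma appLE_epsOn {X Y : CSch} (f : dualSpec ⊗ X ⟶ dualSpec ⊗ Y) (hf : f ≫ fst _ _ = fst _ _)
    {V : (dualSpec ⊗ Y).left.Opens} {V' : (dualSpec ⊗ X).left.Opens} (h : V' ≤ f.left ⁻¹ᵁ V) :
    f.left.appLE V V' h (epsOn Y V) = epsOn X V' :=
  (appLE_appLE _ _ _ _ _).trans (appLE_congr_left (left_comp_eq hf) _ _)

lemma zeroSec_epsOn {X : CSch} {V : (dualSpec ⊗ X).left.Opens} {V' : X.left.Opens}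
    (h : V' ≤ (zeroSec X).left ⁻¹ᵁ V) : (zeroSec X).left.appLE V V' h (epsOn X V) = 0 := by
  refine (appLE_appLE _ _ _ _ _).trans ((appLE_congr_left (left_comp_eq (zeroSec_fst X)) _ _).trans
    ((appLE_appLE (toUnit X).left dualPt.left (V := ⊤) le_top le_top _).symm.trans ?_))
  exact (congrArg _ (dualPt_dualEps _ _)).trans (map_zero _)

/-- The constant term of the expansion is found by pulling back along `zeroSec X`, which kills `ε`
and turns the flow into the identity. -/
lemma exists_eps_coeff {X : CSch} {θ : dualSpec ⊗ X ⟶ X} (hθ : IsFlow θ) (V : X.left.Opens)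
    (a : Γ(X.left, V)) : ∃ b : Γ(X.left, V),
      θ.left.appLE V ((snd dualSpec X).left ⁻¹ᵁ V) (hθ.preimage_eq V).ge a =
        (snd dualSpec X).left.app V a + epsOn X _ * (snd dualSpec X).left.app V b := by
  obtain ⟨⟨c, b⟩, h⟩ := (bijective_dual X V).2
    (θ.left.appLE V ((snd dualSpec X).left ⁻¹ᵁ V) (hθ.preimage_eq V).ge a)
  have hV : V ≤ (zeroSec X).left ⁻¹ᵁ ((snd dualSpec X).left ⁻¹ᵁ V) := by
    rw [← Scheme.Hom.comp_preimage, left_comp_eq (zeroSec_snd X)]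
    exact le_rfl
  have h2 := congr((zeroSec X).left.appLE _ V hV $h)
  simp only [Scheme.Hom.app_eq_appLE, map_add, map_mul, zeroSec_epsOn, zero_mul, add_zero,
    appLE_appLE] at h2
  rw [appLE_congr_left (left_comp_eq (zeroSec_snd X)), appLE_congr_left (left_comp_eq hθ)] at h2
  have h3 (a : Γ(X.left, V)) : (𝟙 X : X ⟶ X).left.appLE V V le_rfl a = a := by
    exact (id_appLE _ _).trans (res_self _ _)
  rw [h3, h3] at h2
  subst h2
  exact ⟨b, h.symm⟩

lemma dual_eps_unique {X : CSch} {V : X.left.Opens} {a b b' : Γ(X.left, V)}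
    (h : (snd dualSpec X).left.app V a + epsOn X _ * (snd dualSpec X).left.app V b =
      (snd dualSpec X).left.app V a + epsOn X _ * (snd dualSpec X).left.app V b') : b = b' :=
  (Prod.ext_iff.1 (@(bijective_dual X V).1 (a, b) (a, b') h)).2

/-- The `ε`-coefficient of the pullback of a function along an infinitesimal flow. -/
def IsFlow.coeff {X : CSch} {θ : dualSpec ⊗ X ⟶ X} (hθ : IsFlow θ) (V : X.left.Opens)
    (a : Γ(X.left, V)) : Γ(X.left, V) := (exists_eps_coeff hθ V a).choose

lemma IsFlow.coeff_spec {X : CSch} {θ : dualSpec ⊗ X ⟶ X} (hθ : IsFlow θ) (V : X.left.Opens)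
    (a : Γ(X.left, V)) :
    θ.left.appLE V ((snd dualSpec X).left ⁻¹ᵁ V) (hθ.preimage_eq V).ge a =
      (snd dualSpec X).left.app V a + epsOn X _ * (snd dualSpec X).left.app V (hθ.coeff V a) :=
  (exists_eps_coeff hθ V a).choose_spec

/-- The vector field generating an infinitesimal flow. -/
def IsFlow.vf {X : CSch} {θ : dualSpec ⊗ X ⟶ X} (hθ : IsFlow θ) : VF X ⊤ where
  app V _ a := hθ.coeff V a
  app_add V _ a b := by
    refine dual_eps_unique (a := a + b) ?_
    rw [← hθ.coeff_spec, map_add, hθ.coeff_spec, hθ.coeff_spec]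
    simp only [map_add]
    ring
  app_mul V _ a b := by
    refine dual_eps_unique (a := a * b) ?_
    rw [← hθ.coeff_spec, map_mul, hθ.coeff_spec, hθ.coeff_spec]
    simp only [map_add, map_mul]
    -- The Leibniz rule is multiplicativity of the pullback; the cross term of the two `ε`-parts
    -- vanishes since `ε² = 0`.
    linear_combination ((snd dualSpec X).left.app V (hθ.coeff V a) *
      (snd dualSpec X).left.app V (hθ.coeff V b)) *
      epsOn_mul_self X ((snd dualSpec X).left ⁻¹ᵁ V)
  app_const V _ c := by
    refine dual_eps_unique (a := X.hom.appLE ⊤ V le_top c) ?_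
    rw [← hθ.coeff_spec, map_zero, mul_zero, add_zero, Scheme.Hom.app_eq_appLE]
    refine (appLE_appLE _ _ _ _ _).trans (Eq.trans ?_ (appLE_appLE _ _ _ _ _).symm)
    exact appLE_congr_left ((Over.w θ).trans (Over.w (snd dualSpec X)).symm) _ _
  app_res V V' _ h a := by
    refine dual_eps_unique (a := X.left.presheaf.map (homOfLE h).op a) ?_
    rw [← hθ.coeff_spec, appLE_res,
      ← res_appLE θ.left (hθ.preimage_eq V).ge ((snd dualSpec X).left.preimage_mono h),
      hθ.coeff_spec]
    simp only [Scheme.Hom.app_eq_appLE, map_add, map_mul, res_appLE, appLE_res, res_epsOn]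

lemma IsFlow.vf_spec {X : CSch} {θ : dualSpec ⊗ X ⟶ X} (hθ : IsFlow θ) {V : X.left.Opens}
    {V' : (dualSpec ⊗ X).left.Opens} (h : V' ≤ (snd dualSpec X).left ⁻¹ᵁ V) (a : Γ(X.left, V)) :
    θ.left.appLE V V' (h.trans (hθ.preimage_eq V).ge) a =
      (snd dualSpec X).left.appLE V V' h a +
        epsOn X _ * (snd dualSpec X).left.appLE V V' h (hθ.vf.app V le_top a) := by
  have := congr((dualSpec ⊗ X).left.presheaf.map (homOfLE h).op $(hθ.coeff_spec V a))
  simp only [Scheme.Hom.app_eq_appLE, map_add, map_mul, res_appLE, res_epsOn] at this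
  exact this

lemma IsFlow.vf_eq {X : CSch} {θ : dualSpec ⊗ X ⟶ X} (hθ : IsFlow θ) {V : X.left.Opens}
    {a b : Γ(X.left, V)}
    (h : θ.left.appLE V ((snd dualSpec X).left ⁻¹ᵁ V) (hθ.preimage_eq V).ge a =
        (snd dualSpec X).left.appLE V _ le_rfl a +
          epsOn X _ * (snd dualSpec X).left.appLE V _ le_rfl b) :
    hθ.vf.app V le_top a = b := by
  refine dual_eps_unique (a := a) ?_
  simp only [Scheme.Hom.app_eq_appLE]
  rw [← h, ← hθ.vf_spec]

/-- A morphism that is compatible with flows relates their vector fields. -/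
lemma related_vf {X Y : CSch} {θ : dualSpec ⊗ X ⟶ X} (hθ : IsFlow θ) {θ' : dualSpec ⊗ Y ⟶ Y}
    (hθ' : IsFlow θ') {f : X ⟶ Y} (hf : θ ≫ f = dualSpec ◁ f ≫ θ') :
    VF.Related f hθ.vf hθ'.vf := by
  intro V _ V' _ h s
  refine hθ.vf_eq ?_
  have hfs : dualSpec ◁ f ≫ snd _ _ = snd _ _ ≫ f := by simp
  have hV : (snd dualSpec X).left ⁻¹ᵁ V ≤
      (dualSpec ◁ f).left ⁻¹ᵁ ((snd dualSpec Y).left ⁻¹ᵁ V') := by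
    rw [← Scheme.Hom.comp_preimage, left_comp_eq hfs, Over.comp_left, Scheme.Hom.comp_preimage]
    exact Scheme.Hom.preimage_mono _ h
  have h1 := congr((dualSpec ◁ f).left.appLE _ _ hV $(hθ'.vf_spec le_rfl s))
  simp only [map_add, map_mul, appLE_epsOn (dualSpec ◁ f) (by simp)] at h1
  simp only [appLE_appLE] at h1 ⊢
  rw [appLE_congr_left (left_comp_eq hf.symm), appLE_congr_left (left_comp_eq hfs),
    appLE_congr_left (left_comp_eq hfs)] at h1
  exact h1

lemma vf_isFlow_snd (X : CSch) : (isFlow_snd X).vf = 0 := by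
  ext V hV a
  refine (isFlow_snd X).vf_eq ?_
  rw [VF.zero_app, map_zero, mul_zero, add_zero]

/-- The vector fields of commuting flows commute. -/
lemma bracket_vf_eq_zero {X : CSch} {θ θ' : dualSpec ⊗ X ⟶ X} (hθ : IsFlow θ) (hθ' : IsFlow θ')
    (h : lift (snd _ _ ≫ fst _ _) (dualSpec ◁ snd _ _ ≫ θ) ≫ θ' = dualSpec ◁ θ' ≫ θ) :
    ⁅hθ.vf, hθ'.vf⁆ = 0 := by
  -- `Θ` is the flow `θ` on `𝔻 × X`, with the inner `𝔻` as a fixed parameter, and `h` says that `θ'`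
  -- intertwines `Θ` with `θ`. The field of `Θ` kills `ε` and acts as that of `θ` on functions from
  -- `X`. Applying it to `θ'^* a = a + ε θ'(a)` and comparing `ε`-coefficients gives commutation.
  set Θ : dualSpec ⊗ (dualSpec ⊗ X) ⟶ dualSpec ⊗ X :=
    lift (snd _ _ ≫ fst _ _) (dualSpec ◁ snd _ _ ≫ θ) with hΘ
  have hzs : zeroSec (dualSpec ⊗ X) ≫ dualSpec ◁ snd dualSpec X = snd _ _ ≫ zeroSec X := by
    ext1
    · simp only [Category.assoc, whiskerLeft_fst, zeroSec_fst, comp_toUnit_assoc]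
    · simp
  have hflow : IsFlow Θ := by
    unfold IsFlow at hθ ⊢
    ext1
    · simp [hΘ]
    · rw [hΘ, Category.assoc, lift_snd, reassoc_of% hzs, hθ, Category.comp_id, Category.id_comp]
  have h1 : VF.Related (fst dualSpec X) hflow.vf (0 : VF dualSpec ⊤) := by
    rw [← vf_isFlow_snd]
    exact related_vf hflow _ (by simp [hΘ])
  have h2 : VF.Related (snd dualSpec X) hflow.vf hθ.vf := related_vf hflow _ (by simp [hΘ])
  have h3 : VF.Related θ' hflow.vf hθ.vf := related_vf hflow _ h
  ext V hV a
  rw [VF.bracket_app, VF.zero_app, sub_eq_zero]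
  have e := h3 ((snd dualSpec X).left ⁻¹ᵁ V) le_top V le_top (hθ'.preimage_eq V).ge a
  have e1 := hθ'.vf_spec (le_refl ((snd dualSpec X).left ⁻¹ᵁ V)) a
  have e2 := hθ'.vf_spec (le_refl ((snd dualSpec X).left ⁻¹ᵁ V)) (hθ.vf.app V le_top a)
  have e3 : hflow.vf.app ((snd dualSpec X).left ⁻¹ᵁ V) le_top (epsOn X _) = 0 :=
    (h1 ((snd dualSpec X).left ⁻¹ᵁ V) le_top ⊤ le_top le_top dualEps).trans (map_zero _)
  rw [e1, e2, VF.app_add, VF.app_mul, e3, mul_zero, add_zero,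
    h2 _ le_top V le_top le_rfl, h2 _ le_top V le_top le_rfl] at e
  simp only [← Scheme.Hom.app_eq_appLE] at e
  exact dual_eps_unique e

/-! ### Fundamental vector fields of an action -/

variable {T : CSch} [GrpObj T]

/-- The infinitesimal flow on `X` generated by the tangent vector `τ` of `T` at the unit. -/
def actFlow (τ : dualSpec ⟶ T) (X : CSch) [ModObj T X] : dualSpec ⊗ X ⟶ X := τ ▷ X ≫ γ[T, X]

lemma lift_lift_smul {X Z : CSch} [ModObj T X] (t t' : Z ⟶ T) (x : Z ⟶ X) :
    lift t (lift t' x ≫ γ[T, X]) ≫ γ[T, X] = lift (lift t t' ≫ μ) x ≫ γ[T, X] := by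
  have h0 : μ[T] ▷ X ≫ γ[T, X] = (α_ T T X).hom ≫ T ◁ γ[T, X] ≫ γ[T, X] := ModObj.mul_smul X
  have h1 : lift (lift t t') x ≫ μ[T] ▷ X = lift (lift t t' ≫ μ) x := by simp
  have h2 : lift (lift t t') x ≫ (α_ T T X).hom ≫ T ◁ γ[T, X] =
    lift t (lift t' x ≫ γ[T, X]) := by simp
  rw [← h1, ← h2, Category.assoc, Category.assoc, Category.assoc, h0]

lemma lift_one_smul {X Z : CSch} [ModObj T X] (x : Z ⟶ X) :
    lift (toUnit Z ≫ η[T]) x ≫ γ[T, X] = x := by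
  have h0 : η[T] ▷ X ≫ γ[T, X] = (λ_ X).hom := ModObj.one_smul X
  have h1 : lift (toUnit Z) x ≫ η[T] ▷ X = lift (toUnit Z ≫ η[T]) x := by simp
  rw [← h1, Category.assoc, h0]
  simp

lemma smul_comp_hom {X Y : CSch} [ModObj T X] [ModObj T Y] (f : X ⟶ Y) [IsModHom T f] :
    γ[T, X] ≫ f = T ◁ f ≫ γ[T, Y] := IsModHom.smul_hom

lemma isFlow_actFlow {τ : dualSpec ⟶ T} (hτ : dualPt ≫ τ = η[T]) (X : CSch) [ModObj T X] :
    IsFlow (actFlow τ X) := by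
  simp [IsFlow, actFlow, zeroSec, hτ, lift_one_smul]

lemma actFlow_comp (τ : dualSpec ⟶ T) {X Y : CSch} [ModObj T X] [ModObj T Y] (f : X ⟶ Y)
    [IsModHom T f] : actFlow τ X ≫ f = dualSpec ◁ f ≫ actFlow τ Y := by
  rw [actFlow, actFlow, Category.assoc, smul_comp_hom, whisker_exchange_assoc]

lemma actFlow_comm [IsCommMonObj T] (τ τ' : dualSpec ⟶ T) (X : CSch)
    [ModObj T X] :
    lift (snd _ _ ≫ fst _ _) (dualSpec ◁ snd _ _ ≫ actFlow τ X) ≫ actFlow τ' X =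
      dualSpec ◁ actFlow τ' X ≫ actFlow τ X := by
  have e (ρ : dualSpec ⟶ T) {Z : CSch} (d : Z ⟶ dualSpec) (x : Z ⟶ X) :
      lift d x ≫ actFlow ρ X = lift (d ≫ ρ) x ≫ γ[T, X] := by simp [actFlow]
  have h1 : (dualSpec ◁ snd dualSpec X) ≫ actFlow τ X =
      lift (fst _ _ ≫ τ) (snd _ _ ≫ snd _ _) ≫ γ[T, X] := by
    rw [← e]; congr 1
  have h2 : dualSpec ◁ actFlow τ' X ≫ actFlow τ X =
      lift (fst _ _ ≫ τ) (lift (snd _ _ ≫ fst _ _ ≫ τ') (snd _ _ ≫ snd _ _) ≫ γ[T, X]) ≫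
        γ[T, X] := by
    have : lift (snd dualSpec (dualSpec ⊗ X) ≫ fst _ _ ≫ τ') (snd _ _ ≫ snd _ _) ≫ γ[T, X] =
        snd _ _ ≫ actFlow τ' X := by
      rw [← Category.assoc, ← e, ← comp_lift_assoc, lift_fst_snd, Category.id_comp]
    rw [this, ← e]; congr 1
  rw [h1, e, h2, lift_lift_smul, lift_lift_smul]
  congr 2
  have hb {Z : CSch} (a b : Z ⟶ T) : lift a b ≫ μ[T] = lift b a ≫ μ[T] := by
    calc lift a b ≫ μ[T] = lift a b ≫ (β_ T T).hom ≫ μ[T] := by rw [IsCommMonObj.mul_comm]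
      _ = lift b a ≫ μ[T] := by
        rw [← Category.assoc]
        congr 1
        ext1 <;> simp
  rw [hb, Category.assoc]

end

/-! ### Regular systems of parameters -/

section

open IsLocalRing

lemma ringKrullDim_le_card {R : Type*} [CommRing R] [IsLocalRing R] [IsNoetherianRing R]
    (s : Finset R) (hs : Ideal.span (s : Set R) = maximalIdeal R) : ringKrullDim R ≤ s.card := by
  refine (ringKrullDim_le_spanFinrank_maximalIdeal (R := R)).trans ?_
  rw [← hs]
  have := Submodule.spanFinrank_span_le_encard (R := R) (s : Set R)
  rw [Set.encard_coe_eq_coe_finsetCard] at this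
  exact_mod_cast this

/-- Modulo `x` the generator `y` becomes redundant, which saves one generator of the maximal ideal.
It serves both for an `x` exchanged against `y` and for `x = y`. -/
lemma span_image_quotient {R : Type*} [CommRing R] [IsLocalRing R] [DecidableEq R] {x y : R}
    {s : Finset R} (hs : Ideal.span (s : Set R) = maximalIdeal R)
    (hy : y ∈ Ideal.span (insert x (s.erase y : Finset R) : Set R))
    [IsLocalRing (R ⧸ Ideal.span {x})] [DecidableEq (R ⧸ Ideal.span {x})] :
    Ideal.span (((s.erase y).image (Ideal.Quotient.mk (Ideal.span {x})) :
      Finset (R ⧸ Ideal.span {x})) : Set (R ⧸ Ideal.span {x})) = maximalIdeal _ := by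
  have hloc := IsLocalHom.of_surjective (Ideal.Quotient.mk (Ideal.span {x}))
    Ideal.Quotient.mk_surjective
  have hmap : maximalIdeal (R ⧸ Ideal.span {x}) =
      (maximalIdeal R).map (Ideal.Quotient.mk (Ideal.span {x})) :=
    (IsLocalRing.map_maximalIdeal_of_surjective _ Ideal.Quotient.mk_surjective).symm
  rw [hmap, Finset.coe_image, ← Ideal.map_span]
  refine le_antisymm (Ideal.map_mono ?_) ?_
  · rw [← hs]
    exact Ideal.span_mono (by simp)
  · rw [← hs, Ideal.map_span, Ideal.span_le]
    rintro _ ⟨z, hz, rfl⟩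
    have hins : z ∈ Ideal.span (insert x (s.erase y : Finset R) : Set R) := by
      by_cases hzy : z = y
      · rwa [hzy]
      · exact Ideal.subset_span (.inr (by simpa [hzy] using hz))
    have := Ideal.mem_map_of_mem (Ideal.Quotient.mk (Ideal.span {x})) hins
    rwa [Ideal.span_insert, Ideal.map_sup, Ideal.map_quotient_self, bot_sup_eq] at this

lemma le_ringKrullDim_quotient {R : Type*} [CommRing R] [IsLocalRing R] [IsNoetherianRing R]
    {x : R} (hx : x ∈ maximalIdeal R) {d : ℕ} (hd : (d + 1 : ℕ) ≤ ringKrullDim R) :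
    d ≤ ringKrullDim (R ⧸ Ideal.span {x}) := by
  have := ringKrullDim_le_ringKrullDim_quotient_add_encard {x} (R := R) (by
    rw [IsLocalRing.ringJacobson_eq_maximalIdeal]; simpa using hx)
  have h := hd.trans this
  rw [Set.encard_singleton] at h
  generalize ringKrullDim (R ⧸ Ideal.span {x}) = k at h ⊢
  induction k with
  | bot =>
    rw [WithBot.bot_add, le_bot_iff] at h
    exact absurd h (WithBot.coe_ne_bot (a := ((d + 1 : ℕ) : ℕ∞)))
  | coe k =>
    have h' : ((d + 1 : ℕ) : ℕ∞) ≤ k + 1 := by exact_mod_cast h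
    push_cast at h'
    exact_mod_cast (WithTop.add_le_add_iff_right (ENat.natCast_ne_top 1)).1 h'

/-- This is the theorem that regular local rings are domains, by induction on the dimension. Prime
avoidance gives `x` in `𝔪`, outside `𝔪²` and outside all minimal primes. The quotient by `x`
satisfies the same hypotheses for `d - 1`, so `(x)` is prime. A minimal prime `P ⊆ (x)` then
satisfies `P ⊆ 𝔪 P`, so `P = 0` by Nakayama. -/
theorem isDomain_of_card_le_ringKrullDim (d : ℕ) (R : Type*) [CommRing R] [IsLocalRing R]
    [IsNoetherianRing R] (s : Finset R) (hs : Ideal.span (s : Set R) = maximalIdeal R)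
    (hd : s.card ≤ d) (hdim : d ≤ ringKrullDim R) : IsDomain R := by
  classical
  induction d generalizing R with
  | zero =>
    obtain rfl : s = ∅ := by simpa using hd
    have hf : IsField R := by
      rw [IsLocalRing.isField_iff_maximalIdeal_eq, ← hs]
      simp
    exact hf.isDomain
  | succ d ih =>
    have hfin := minimalPrimes.finite_of_isNoetherianRing R
    have hm0 : ¬ maximalIdeal R ≤ maximalIdeal R ^ 2 := by
      refine (maximalIdeal_sq_lt_of_ringKrullDim_ne_zero fun h0 => ?_).not_ge
      rw [h0] at hdim
      exact absurd (show d + 1 ≤ 0 by exact_mod_cast hdim) (by omega)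
    have hmin (P : Ideal R) (hP : P ∈ minimalPrimes R) : ¬ maximalIdeal R ≤ P := by
      intro hle
      have hPp : P.IsPrime := hP.1.1
      have hPm : P = maximalIdeal R := le_antisymm (le_maximalIdeal hPp.ne_top) hle
      rw [hPm, ← Ideal.height_eq_zero_iff] at hP
      rw [← IsLocalRing.maximalIdeal_height_eq_ringKrullDim, hP] at hdim
      exact absurd (show d + 1 ≤ 0 by exact_mod_cast hdim) (by omega)
    obtain ⟨x, hxm, hx2, hxP⟩ : ∃ x ∈ maximalIdeal R, x ∉ maximalIdeal R ^ 2 ∧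
        ∀ P ∈ minimalPrimes R, x ∉ P := by
      by_contra! hcon
      -- Prime avoidance tolerates two ideals that are not prime; `𝔪²` is the only one here and
      -- fills both slots.
      have := (Ideal.subset_union_prime (s := insert (maximalIdeal R ^ 2) hfin.toFinset)
        (f := id) (maximalIdeal R ^ 2) (maximalIdeal R ^ 2) (I := maximalIdeal R)
        (fun P hP h1 _ => by
          have : P ∈ minimalPrimes R := by simpa [h1] using hP
          exact this.1.1)).1 (fun x hx => by
            by_cases h2 : x ∈ maximalIdeal R ^ 2
            · simp [h2]
            · obtain ⟨P, hP, hxP⟩ := hcon x hx h2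
              simp only [Set.mem_iUnion]
              exact ⟨P, by simp [hP], hxP⟩)
      obtain ⟨P, hP, hle⟩ := this
      simp only [Finset.mem_insert, Set.Finite.mem_toFinset] at hP
      rcases hP with rfl | hP
      · exact hm0 hle
      · exact hmin P hP hle
    -- Since `x ∉ 𝔪²`, some coefficient of `x` in terms of `s` is a unit, and the corresponding
    -- generator can be exchanged for `x`.
    obtain ⟨y, hys, hy⟩ : ∃ y ∈ s, y ∈ Ideal.span (insert x (s.erase y : Finset R) : Set R) := by
      rw [← hs] at hxm
      obtain ⟨c, -, hc⟩ := Submodule.mem_span_finset.1 hxm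
      obtain ⟨y, hys, hy⟩ : ∃ y ∈ s, IsUnit (c y) := by
        by_contra! hcon
        refine hx2 (hc ▸ Ideal.sum_mem _ fun y hy => ?_)
        rw [sq]
        exact Ideal.mul_mem_mul ((mem_maximalIdeal _).2 (hcon y hy))
          (hs ▸ Ideal.subset_span hy)
      refine ⟨y, hys, ?_⟩
      rw [← Ideal.unit_mul_mem_iff_mem _ hy]
      rw [← Finset.add_sum_erase _ _ hys] at hc
      have : c y * y = x - ∑ z ∈ s.erase y, c z • z := by
        rw [← hc]
        simp
      rw [this]
      refine Ideal.sub_mem _ (Ideal.subset_span (.inl rfl)) (Ideal.sum_mem _ fun z hz => ?_)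
      exact Ideal.mul_mem_left _ _ (Ideal.subset_span (.inr hz))
    have hxt : Ideal.span {x} ≠ ⊤ := fun h =>
      (maximalIdeal.isMaximal R).ne_top (top_le_iff.1 (h ▸ by simpa [Ideal.span_le] using hxm))
    have : Nontrivial (R ⧸ Ideal.span {x}) := Ideal.Quotient.nontrivial_iff.2 hxt
    have : IsLocalRing (R ⧸ Ideal.span {x}) :=
      .of_surjective' (Ideal.Quotient.mk _) Ideal.Quotient.mk_surjective
    have hdom := ih (R ⧸ Ideal.span {x}) _ (span_image_quotient hs hy)
      (Finset.card_image_le.trans (by rw [Finset.card_erase_of_mem hys]; omega))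
      (le_ringKrullDim_quotient hxm hdim)
    have hprime : (Ideal.span {x}).IsPrime := (Ideal.Quotient.isDomain_iff_prime _).1 hdom
    obtain ⟨P, hP, hPx⟩ := Ideal.exists_minimalPrimes_le (I := ⊥) (J := Ideal.span {x}) bot_le
    have hPp : P.IsPrime := hP.1.1
    have hPbot : P = ⊥ := by
      refine Submodule.eq_bot_of_le_smul_of_le_jacobson_bot (maximalIdeal R) P
        (IsNoetherian.noetherian P) (fun z hz => ?_) (maximalIdeal_le_jacobson _)
      obtain ⟨r, rfl⟩ := Ideal.mem_span_singleton'.1 (hPx hz)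
      rcases hPp.mem_or_mem hz with h | h
      · rw [mul_comm]
        exact Submodule.smul_mem_smul hxm h
      · exact (hxP P hP h).elim
    rw [hPbot] at hPp
    exact IsDomain.of_bot_isPrime R

section RegularParameters

variable {R : Type*} [CommRing R] [IsLocalRing R] [IsNoetherianRing R] {d : ℕ} {u : Fin d → R}

/-- Otherwise `d - 1` elements would generate the maximal ideal of a ring of dimension `d`. -/
lemma parameter_notMem_span (hu : Ideal.span (Set.range u) = maximalIdeal R)
    (hd : ringKrullDim R = d) (i : Fin d) : u i ∉ Ideal.span (u '' {i}ᶜ) := by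
  classical
  intro h
  have hs : Ideal.span (((Finset.univ.erase i).image u : Finset R) : Set R) = maximalIdeal R := by
    rw [← hu]
    refine le_antisymm (Ideal.span_mono (by simp)) (Ideal.span_le.2 ?_)
    rintro _ ⟨k, rfl⟩
    have he : (((Finset.univ.erase i).image u : Finset R) : Set R) = u '' {i}ᶜ := by
      ext; simp
    rw [he]
    by_cases hk : k = i
    · exact hk ▸ h
    · exact Ideal.subset_span ⟨k, hk, rfl⟩
  have h1 := ringKrullDim_le_card _ hs
  rw [hd] at h1
  have h2 := (Nat.cast_le.1 h1).trans Finset.card_image_le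
  rw [Finset.card_erase_of_mem (Finset.mem_univ _), Finset.card_univ, Fintype.card_fin] at h2
  have := i.pos
  omega

lemma not_parameter_dvd (hu : Ideal.span (Set.range u) = maximalIdeal R)
    (hd : ringKrullDim R = d) {i j : Fin d} (hij : i ≠ j) : ¬ u j ∣ u i := fun h =>
  parameter_notMem_span hu hd i
    (Ideal.mem_of_dvd _ h (Ideal.subset_span ⟨j, hij.symm, rfl⟩))

/-- The members of a regular system of parameters are prime elements. -/
lemma prime_parameter (hu : Ideal.span (Set.range u) = maximalIdeal R)
    (hd : ringKrullDim R = d) (i : Fin d) : Prime (u i) := by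
  classical
  have h0 : u i ≠ 0 := fun h => parameter_notMem_span hu hd i (h ▸ Ideal.zero_mem _)
  rw [← Ideal.span_singleton_prime h0]
  have hm : u i ∈ maximalIdeal R := hu ▸ Ideal.subset_span ⟨i, rfl⟩
  have hxt : Ideal.span {u i} ≠ ⊤ := fun h =>
    (maximalIdeal.isMaximal R).ne_top (top_le_iff.1 (h ▸ by simpa [Ideal.span_le] using hm))
  have : Nontrivial (R ⧸ Ideal.span {u i}) := Ideal.Quotient.nontrivial_iff.2 hxt
  have : IsLocalRing (R ⧸ Ideal.span {u i}) :=
    .of_surjective' (Ideal.Quotient.mk _) Ideal.Quotient.mk_surjective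
  rw [← Ideal.Quotient.isDomain_iff_prime]
  obtain ⟨e, rfl⟩ : ∃ e, d = e + 1 := ⟨d - 1, by have := i.pos; omega⟩
  -- The other parameters generate the maximal ideal of the quotient by `u i`, whose dimension is at
  -- least their number `e`, so the quotient is a domain.
  refine isDomain_of_card_le_ringKrullDim e _ _
    (span_image_quotient (s := Finset.univ.image u) (x := u i) (y := u i) ?_ ?_) ?_
    (le_ringKrullDim_quotient hm hd.ge)
  · simpa using hu
  · exact Ideal.subset_span (.inl rfl)
  · refine Finset.card_image_le.trans ?_
    rw [Finset.card_erase_of_mem (by simp)]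
    have := Finset.card_image_le (s := (Finset.univ : Finset (Fin (e + 1)))) (f := u)
    simp only [Finset.card_univ, Fintype.card_fin] at this
    omega

end RegularParameters

/-! ### Derivations preserving the ideal of a product of primes. -/

section LogDerivation

variable {R : Type*} [CommRing R] (D : Derivation ℤ R R)

lemma mul_dvd_derivation {a b : R} (ha : a ∣ D a) (hb : b ∣ D b) : a * b ∣ D (a * b) := by
  rw [D.leibniz, smul_eq_mul, smul_eq_mul]
  refine dvd_add (mul_dvd_mul_left _ hb) ?_
  rw [mul_comm a b]
  exact mul_dvd_mul_left _ ha

lemma prod_dvd_derivation {I : Type*} (s : Finset I) (f : I → R) (h : ∀ i ∈ s, f i ∣ D (f i)) :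
    ∏ i ∈ s, f i ∣ D (∏ i ∈ s, f i) := by
  classical
  induction s using Finset.induction_on with
  | empty => simp
  | insert i s hi ih =>
    rw [Finset.prod_insert hi]
    exact mul_dvd_derivation D (h i (by simp)) (ih fun k hk => h k (by simp [hk]))

/-- If a derivation preserves the ideal of a product `g` of non-associated primes, it preserves
the ideals of the divisors of powers of `g`. -/
lemma dvd_derivation_of_mul_eq_pow [IsDomain R] {I : Type*} (S : Finset I) (u : I → R)
    (hu : ∀ i ∈ S, Prime (u i)) (hne : ∀ i ∈ S, ∀ k ∈ S, i ≠ k → ¬ u i ∣ u k)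
    (hD : ∏ i ∈ S, u i ∣ D (∏ i ∈ S, u i)) {a b : R} {n : ℕ} (hab : a * b = (∏ i ∈ S, u i) ^ n) :
    a ∣ D a := by
  classical
  -- With `g = u_i g'`, the Leibniz rule gives `u_i ∣ g' D(u_i)`, and the prime `u_i` divides no
  -- factor of `g'`.
  have hui (i : I) (hi : i ∈ S) : u i ∣ D (u i) := by
    rw [← Finset.mul_prod_erase S u hi, D.leibniz, smul_eq_mul, smul_eq_mul] at hD
    have h1 := (dvd_add_right (Dvd.intro _ rfl)).1 ((Dvd.intro _ rfl).trans hD)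
    refine ((hu i hi).dvd_or_dvd h1).resolve_left fun h2 => ?_
    obtain ⟨k, hk, h3⟩ := (hu i hi).exists_mem_finset_dvd h2
    rw [Finset.mem_erase] at hk
    exact hne i hi k hk.2 hk.1.symm h3
  -- Writing `g ^ n` as one product of primes with repetition shows that its divisor `a` is a unit
  -- times a subproduct.
  have hab' : a * b = 1 * ∏ p ∈ S ×ˢ Finset.range n, u p.1 := by
    rw [hab, one_mul, Finset.prod_product, ← Finset.prod_pow]
    simp
  obtain ⟨t, _, c, c', ht, -, hc, ha, -⟩ := mul_eq_mul_prime_prod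
    (fun p hp => hu p.1 (Finset.mem_product.1 hp).1) hab'
  rw [ha]
  refine mul_dvd_derivation D ((IsUnit.of_mul_eq_one _ hc.symm).dvd)
    (prod_dvd_derivation D _ _ fun p hp => hui _ ?_)
  exact (Finset.mem_product.1 (ht ▸ Finset.mem_union_left _ hp)).1

end LogDerivation

end

/-! ### Logarithmic derivatives extend over a normal crossing divisor -/

section

lemma germ_res {X : Scheme.{0}} {V V' : X.Opens} (h : V' ≤ V) {x : X} (hx : x ∈ V')
    (a : Γ(X, V)) : X.presheaf.germ V' x hx (X.presheaf.map (homOfLE h).op a) =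
      X.presheaf.germ V x (h hx) a :=
  X.presheaf.germ_res_apply (homOfLE h) x hx a

/-- The derivation of the local ring at `x` induced by a vector field. -/
lemma VF.exists_stalk_derivation {X : CSch} {U : X.left.Opens} (v : VF X U) {x : X.left}
    (hxU : x ∈ U) : ∃ D : Derivation ℤ (X.left.presheaf.stalk x) (X.left.presheaf.stalk x),
      ∀ (V : X.left.Opens) (hV : V ≤ U) (hx : x ∈ V) (a : Γ(X.left, V)),
        D (X.left.presheaf.germ V x hx a) = X.left.presheaf.germ V x hx (v.app V hV a) := by
  have hrep (s : X.left.presheaf.stalk x) : ∃ (V : X.left.Opens) (_ : V ≤ U) (hx : x ∈ V)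
      (a : Γ(X.left, V)), X.left.presheaf.germ V x hx a = s := by
    obtain ⟨V, hx, a, rfl⟩ := X.left.presheaf.exists_germ_eq s
    exact ⟨V ⊓ U, inf_le_right, ⟨hx, hxU⟩, X.left.presheaf.map (homOfLE inf_le_left).op a,
      germ_res _ _ _⟩
  choose V hV hx a ha using hrep
  have hwd {V V' : X.left.Opens} (hV : V ≤ U) (hV' : V' ≤ U) (hx : x ∈ V) (hx' : x ∈ V')
      (a : Γ(X.left, V)) (b : Γ(X.left, V'))
      (h : X.left.presheaf.germ V x hx a = X.left.presheaf.germ V' x hx' b) :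
      X.left.presheaf.germ V x hx (v.app V hV a) =
        X.left.presheaf.germ V' x hx' (v.app V' hV' b) := by
    obtain ⟨V'', hx'', i, i', e⟩ := X.left.presheaf.germ_eq x hx hx' a b h
    have e1 := v.app_res V V'' hV i.le a
    have e2 := v.app_res V' V'' hV' i'.le b
    have e' : X.left.presheaf.map (homOfLE i.le).op a = X.left.presheaf.map (homOfLE i'.le).op b :=
      e
    rw [e'] at e1
    rw [← germ_res i.le hx'', ← e1, e2, germ_res]
  have key (s : X.left.presheaf.stalk x) {V' : X.left.Opens} (hV' : V' ≤ U) (hx' : x ∈ V')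
      (b : Γ(X.left, V')) (h : X.left.presheaf.germ V' x hx' b = s) :
      X.left.presheaf.germ (V s) x (hx s) (v.app (V s) (hV s) (a s)) =
        X.left.presheaf.germ V' x hx' (v.app V' hV' b) :=
    hwd _ _ _ _ _ _ ((ha s).trans h.symm)
  have hrep2 (s t : X.left.presheaf.stalk x) : ∃ (V : X.left.Opens) (_ : V ≤ U) (hx : x ∈ V)
      (a b : Γ(X.left, V)), X.left.presheaf.germ V x hx a = s ∧
        X.left.presheaf.germ V x hx b = t :=
    ⟨V s ⊓ V t, inf_le_left.trans (hV s), ⟨hx s, hx t⟩,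
      X.left.presheaf.map (homOfLE inf_le_left).op (a s),
      X.left.presheaf.map (homOfLE inf_le_right).op (a t),
      (germ_res _ _ _).trans (ha s), (germ_res _ _ _).trans (ha t)⟩
  let D₀ : X.left.presheaf.stalk x →+ X.left.presheaf.stalk x := AddMonoidHom.mk'
    (fun s => X.left.presheaf.germ (V s) x (hx s) (v.app (V s) (hV s) (a s))) (by
      intro s t
      obtain ⟨V', hV', hx', b, c, rfl, rfl⟩ := hrep2 s t
      beta_reduce
      rw [key _ hV' hx' b rfl, key _ hV' hx' c rfl, key _ hV' hx' (b + c) (map_add _ _ _),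
        v.app_add, map_add])
  refine ⟨Derivation.mk' D₀.toIntLinearMap ?_, fun V' hV' hx' b => key _ hV' hx' b rfl⟩
  intro s t
  obtain ⟨V', hV', hx', b, c, rfl, rfl⟩ := hrep2 s t
  change X.left.presheaf.germ _ x _ _ = _ * X.left.presheaf.germ _ x _ _ +
    _ * X.left.presheaf.germ _ x _ _
  rw [key _ hV' hx' b rfl, key _ hV' hx' c rfl, key _ hV' hx' (b * c) (map_mul _ _ _),
    v.app_mul, map_add, map_mul, map_mul]

lemma res_injective {X : Scheme.{0}} [IsIntegral X] {V V' : X.Opens} (h : V' ≤ V)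
    (hne : (V : Set X).Nonempty → (V' : Set X).Nonempty) :
    Function.Injective (X.presheaf.map (homOfLE h).op) := by
  by_cases hV : (V : Set X).Nonempty
  · have : Nonempty V' := (hne hV).to_subtype
    exact map_injective_of_isIntegral X (homOfLE h)
  · intro a b _
    exact section_ext_of_cover fun x hx => (hV ⟨x, hx⟩).elim

lemma res_inf_injective {X : Scheme.{0}} [IsIntegral X] {W : X.Opens}
    (hW : (W : Set X).Nonempty) (V : X.Opens) :
    Function.Injective (X.presheaf.map (homOfLE (inf_le_left : V ⊓ W ≤ V)).op) :=
  res_injective _ fun hV => nonempty_preirreducible_inter V.2 W.2 hV hW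

lemma isUnit_res_basicOpen {X : Scheme.{0}} {V V' : X.Opens} (f : Γ(X, V)) (hV : V' ≤ V)
    (h : V' ≤ X.basicOpen f) : IsUnit (X.presheaf.map (homOfLE hV).op f) := by
  have := (RingedSpace.isUnit_res_basicOpen X.toRingedSpace f).map
    (X.presheaf.map (homOfLE h).op).hom
  have e := res_res (X.basicOpen_le f) h f
  exact e ▸ this

lemma derivation_pow_of_eq_mul {A : Type*} [CommRing A] (D : Derivation ℤ A A) {g c : A}
    (h : D g = g * c) (n : ℕ) : D (g ^ n) = n * g ^ n * c := by
  induction n with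
  | zero => simp
  | succ n ih =>
    rw [pow_succ, D.leibniz, ih, h]
    simp only [smul_eq_mul]
    push_cast
    ring

variable {M : CSch} {W : M.left.Opens}

/-- Near a point of the divisor, the logarithmic derivative of a unit on the complement `W` along a
logarithmic vector field is regular. -/
lemma exists_local_log_derivative [IsIntegral M.left] [IsLocallyNoetherian M.left]
    (hD : IsSNCComplement W) {U : M.left.Opens} {v : VF M U} (hv : v ∈ logTangent M W U)
    {χ : Γ(M.left, W)} (hχ : IsUnit χ) {x : M.left} (hxU : x ∈ U) (hxW : x ∉ W) :
    ∃ (V : M.left.Opens) (h : V ≤ U), x ∈ V ∧ ∃ f : Γ(M.left, V),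
      v.app (V ⊓ W) (inf_le_left.trans h) (M.left.presheaf.map (homOfLE inf_le_right).op χ) =
        M.left.presheaf.map (homOfLE inf_le_left).op f *
          M.left.presheaf.map (homOfLE inf_le_right).op χ := by
  obtain ⟨d, u, S, hu, hd, hS⟩ := hD x hxW
  obtain ⟨D, hDv⟩ := v.exists_stalk_derivation hxU
  set g := ∏ i ∈ S, u i with hg
  have hprime := prime_parameter hu hd
  have hg0 : g ≠ 0 := Finset.prod_ne_zero_iff.2 fun i _ => (hprime i).ne_zero
  obtain ⟨V₀, hx₀, G₀, hG₀, hGg₀⟩ := (hS g).2 dvd_rfl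
  obtain ⟨V, hV, hVle, hxV⟩ := exists_affine_le (V := V₀ ⊓ U) ⟨hx₀, hxU⟩
  have hVU : V ≤ U := hVle.trans inf_le_right
  obtain ⟨G, hG⟩ : ∃ G, G = M.left.presheaf.map (homOfLE (hVle.trans inf_le_left)).op G₀ :=
    ⟨_, rfl⟩
  have hGg : M.left.presheaf.germ V x hxV G = g := by
    rw [hG]; exact (germ_res _ _ _).trans hGg₀
  have hGW : M.left.basicOpen G ≤ W := by
    rw [hG, Scheme.basicOpen_res]
    exact inf_le_right.trans hG₀
  have hne {V' : M.left.Opens} (h : V' ≤ V) (hx : x ∈ V') :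
      (M.left.basicOpen (M.left.presheaf.map (homOfLE h).op G) : Set M.left).Nonempty := by
    rw [Set.nonempty_iff_ne_empty]
    intro he
    have hb : M.left.basicOpen (M.left.presheaf.map (homOfLE h).op G) = ⊥ := by
      exact TopologicalSpace.Opens.ext he
    rw [basicOpen_eq_bot_iff] at hb
    apply hg0
    rw [← hGg, ← germ_res h hx, hb, map_zero]
  have hne' : (M.left.basicOpen G : Set M.left).Nonempty := by
    simpa only [res_self] using hne le_rfl hxV
  have hloc := hV.isLocalization_basicOpen G
  obtain ⟨ψ, hψ⟩ := hχ.exists_right_inv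
  -- Where `G` is invertible, `χ = A / G ^ n` and `χ⁻¹ = B / G ^ m`. Hence `A * B` is a power of
  -- `G`, and the germ of `A` divides a power of the local equation `g` of `D`.
  obtain ⟨n, A, hA⟩ := IsLocalization.Away.surj G (M.left.presheaf.map (homOfLE hGW).op χ)
  obtain ⟨m, B, hB⟩ := IsLocalization.Away.surj G (M.left.presheaf.map (homOfLE hGW).op ψ)
  have halg (a : Γ(M.left, V)) : algebraMap Γ(M.left, V) Γ(M.left, M.left.basicOpen G) a =
      M.left.presheaf.map (homOfLE (M.left.basicOpen_le G)).op a := rfl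
  rw [halg, halg] at hA hB
  have hAB : A * B = G ^ (n + m) := by
    refine res_injective (M.left.basicOpen_le G) (fun _ => hne') ?_
    have : M.left.presheaf.map (homOfLE hGW).op χ * M.left.presheaf.map (homOfLE hGW).op ψ = 1 := by
      rw [← map_mul, hψ, map_one]
    rw [map_mul, ← hA, ← hB, map_pow, pow_add]
    linear_combination (M.left.presheaf.map (homOfLE (M.left.basicOpen_le G)).op G ^ n *
      M.left.presheaf.map (homOfLE (M.left.basicOpen_le G)).op G ^ m) * this
  have hgD : g ∣ D g := by
    rw [← hGg, hDv V hVU hxV, hGg, ← hS]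
    exact ⟨V, hxV, _, hv V hVU G hGW, rfl⟩
  have haD : M.left.presheaf.germ V x hxV A ∣ D (M.left.presheaf.germ V x hxV A) :=
    dvd_derivation_of_mul_eq_pow D S u (fun i _ => hprime i)
      (fun i _ k _ hik => not_parameter_dvd hu hd hik.symm) hgD
      (b := M.left.presheaf.germ V x hxV B) (n := n + m) (by
        rw [← map_mul, hAB, map_pow, hGg])
  obtain ⟨c, hc⟩ := haD
  obtain ⟨c', hc'⟩ := hgD
  obtain ⟨V₁, hx₁, C₁, rfl⟩ := M.left.presheaf.exists_germ_eq c
  obtain ⟨V₂, hx₂, C₂, rfl⟩ := M.left.presheaf.exists_germ_eq c'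
  set V' := V ⊓ (V₁ ⊓ V₂) with hV'
  have hxV' : x ∈ V' := ⟨hxV, hx₁, hx₂⟩
  have hV'V : V' ≤ V := inf_le_left
  set C := M.left.presheaf.map (homOfLE (inf_le_right.trans inf_le_left : V' ≤ V₁)).op C₁ with hC
  set C' := M.left.presheaf.map (homOfLE (inf_le_right.trans inf_le_right : V' ≤ V₂)).op C₂ with hC'
  have hvA : v.app V' (hV'V.trans hVU) (M.left.presheaf.map (homOfLE hV'V).op A) =
      M.left.presheaf.map (homOfLE hV'V).op A * C := by
    apply germ_injective_of_isIntegral M.left x hxV'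
    rw [v.app_res V V' hVU, germ_res, ← hDv V hVU hxV, hc, map_mul, germ_res, hC, germ_res]
  have hvG : v.app V' (hV'V.trans hVU) (M.left.presheaf.map (homOfLE hV'V).op G) =
      M.left.presheaf.map (homOfLE hV'V).op G * C' := by
    apply germ_injective_of_isIntegral M.left x hxV'
    rw [v.app_res V V' hVU, germ_res, ← hDv V hVU hxV, hGg, hc', map_mul, germ_res, hC', germ_res,
      hGg]
  -- Here `C` and `C'` are the logarithmic derivatives of `A` and `G`, and `χ = A / G ^ n`. By
  -- integrality the identity need only be checked on the nonempty open set where `G` is invertible.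
  refine ⟨V', hV'V.trans hVU, hxV', C - n * C', ?_⟩
  obtain ⟨G', hG'⟩ : ∃ G', G' = M.left.presheaf.map (homOfLE hV'V).op G := ⟨_, rfl⟩
  have hBV' : M.left.basicOpen G' ≤ V' := M.left.basicOpen_le G'
  have hBG : M.left.basicOpen G' ≤ M.left.basicOpen G := by
    rw [hG', Scheme.basicOpen_res]; exact inf_le_right
  have hBW : M.left.basicOpen G' ≤ V' ⊓ W := le_inf hBV' (hBG.trans hGW)
  refine res_injective hBW (fun _ => hG' ▸ hne hV'V hxV') ?_
  have hBU := hBV'.trans (hV'V.trans hVU)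
  rw [← v.app_res, map_mul]
  simp only [res_res, map_sub, map_mul, map_natCast]
  have hu' : IsUnit (M.left.presheaf.map (homOfLE hBV').op G' ^ n) :=
    (isUnit_res_basicOpen _ _ le_rfl).pow n
  have e1 : M.left.presheaf.map (homOfLE (hBG.trans hGW)).op χ *
      M.left.presheaf.map (homOfLE hBV').op G' ^ n =
      M.left.presheaf.map (homOfLE (hBV'.trans hV'V)).op A := by
    have := congr(M.left.presheaf.map (homOfLE hBG).op $hA)
    rw [map_mul, map_pow, res_res, res_res, res_res] at this
    have h2 : M.left.presheaf.map (homOfLE hBV').op G' =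
        M.left.presheaf.map (homOfLE (hBV'.trans hV'V)).op G :=
      (congrArg _ hG').trans (res_res _ _ _)
    rw [h2]
    exact this
  have e2 := congr(v.toDerivation _ hBU $e1)
  have e3 : v.toDerivation _ hBU (M.left.presheaf.map (homOfLE hBV').op G') =
      M.left.presheaf.map (homOfLE hBV').op G' * M.left.presheaf.map (homOfLE hBV').op C' := by
    rw [VF.toDerivation_apply, v.app_res V' _ (hV'V.trans hVU), ← map_mul]
    refine congrArg _ ?_
    rw [hG']
    exact hvG
  have e4 : v.toDerivation _ hBU (M.left.presheaf.map (homOfLE (hBV'.trans hV'V)).op A) =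
      M.left.presheaf.map (homOfLE (hBV'.trans hV'V)).op A *
        M.left.presheaf.map (homOfLE hBV').op C := by
    rw [← res_res hV'V hBV', VF.toDerivation_apply, v.app_res V' _ (hV'V.trans hVU), hvA, map_mul]
  rw [e4, ← e1, Derivation.leibniz, derivation_pow_of_eq_mul _ e3, VF.toDerivation_apply] at e2
  simp only [smul_eq_mul] at e2
  refine hu'.mul_left_cancel ?_
  linear_combination e2

/-- The logarithmic derivative of a unit on the complement `W` along a logarithmic vector field is
regular. -/
theorem exists_log_derivative [IsIntegral M.left] [IsLocallyNoetherian M.left]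
    (hW : (W : Set M.left).Nonempty) (hD : IsSNCComplement W) {U : M.left.Opens} {v : VF M U}
    (hv : v ∈ logTangent M W U) {χ : Γ(M.left, W)} (hχ : IsUnit χ) :
    ∃ f : Γ(M.left, U),
      v.app (U ⊓ W) inf_le_left (M.left.presheaf.map (homOfLE inf_le_right).op χ) =
        M.left.presheaf.map (homOfLE inf_le_left).op f *
          M.left.presheaf.map (homOfLE inf_le_right).op χ := by
  let P (V : M.left.Opens) (f : Γ(M.left, V)) : Prop := ∃ h : V ≤ U,
    v.app (V ⊓ W) (inf_le_left.trans h) (M.left.presheaf.map (homOfLE inf_le_right).op χ) =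
        M.left.presheaf.map (homOfLE inf_le_left).op f *
          M.left.presheaf.map (homOfLE inf_le_right).op χ
  have hres (V V' : M.left.Opens) (h : V' ≤ V) (f : Γ(M.left, V)) (hf : P V f) :
      P V' (M.left.presheaf.map (homOfLE h).op f) := by
    obtain ⟨hV, e⟩ := hf
    refine ⟨h.trans hV, ?_⟩
    have := congr(M.left.presheaf.map (homOfLE (inf_le_inf_right W h)).op $e)
    rw [← v.app_res, map_mul] at this
    simpa only [res_res] using this
  have huniq (V : M.left.Opens) (_ : V ≤ U) (f f' : Γ(M.left, V)) (hf : P V f) (hf' : P V f') :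
      f = f' := by
    obtain ⟨_, e⟩ := hf
    obtain ⟨_, e'⟩ := hf'
    refine res_inf_injective hW V ?_
    exact (hχ.map (M.left.presheaf.map (homOfLE (inf_le_right : V ⊓ W ≤ W)).op).hom).mul_right_cancel
      (e.symm.trans e')
  have hex : ∀ x ∈ U, ∃ V : M.left.Opens, V ≤ U ∧ x ∈ V ∧ ∃ f, P V f := by
    intro x hx
    by_cases hxW : x ∈ W
    -- Over `W` the unit `χ` can simply be divided out; only points of the divisor need the local
    -- lemma.
    · refine ⟨U ⊓ W, inf_le_left, ⟨hx, hxW⟩, ?_⟩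
      obtain ⟨ψ, hψ⟩ := hχ.exists_right_inv
      refine ⟨v.app (U ⊓ W) inf_le_left (M.left.presheaf.map (homOfLE inf_le_right).op χ) *
        M.left.presheaf.map (homOfLE inf_le_right).op ψ, inf_le_left, ?_⟩
      have h1 := congr(M.left.presheaf.map (homOfLE (inf_le_right : (U ⊓ W) ⊓ W ≤ W)).op $hψ)
      rw [map_mul, map_one] at h1
      rw [map_mul, ← v.app_res]
      simp only [res_res]
      linear_combination -v.app (U ⊓ W ⊓ W) (inf_le_left.trans inf_le_left)
        (M.left.presheaf.map (homOfLE (inf_le_right : (U ⊓ W) ⊓ W ≤ W)).op χ) * h1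
    · obtain ⟨V, h, hxV, f, e⟩ := exists_local_log_derivative hD hv hχ hx hxW
      exact ⟨V, h, hxV, f, h, e⟩
  obtain ⟨f, hf⟩ := exists_section_of_cover (U := U) P hres huniq hex
  refine ⟨f, section_ext_of_cover fun x hx => ?_⟩
  obtain ⟨V, hV, hxV, _, h⟩ := hf x hx.1
  refine ⟨V ⊓ W, inf_le_inf_right W hV, ⟨hxV, hx.2⟩, ?_⟩
  rw [← v.app_res, map_mul]
  simpa only [res_res] using h

end

/-! ### Calculus of vector fields -/

namespace VF

variable {X Y Z : CSch} {U : X.left.Opens} {U' : Y.left.Opens} {U'' : Z.left.Opens}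
  {f : X ⟶ Y} {g : Y ⟶ Z}

lemma Related.sum {I : Type*} {s : Finset I} {w : I → VF X U} {v : I → VF Y U'}
    (h : ∀ i ∈ s, Related f (w i) (v i)) : Related f (∑ i ∈ s, w i) (∑ i ∈ s, v i) := by
  intro V hV V' hV' hh a
  rw [sum_app, sum_app, map_sum]
  exact Finset.sum_congr rfl fun i hi => h i hi V hV V' hV' hh a

lemma Related.smul {w : VF X U} {v : VF Y U'} (h : Related f w v) (hU : U ≤ f.left ⁻¹ᵁ U')
    (a : Γ(Y.left, U')) : Related f (f.left.appLE U' U hU a • w) (a • v) := by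
  intro V hV V' hV' hh s
  rw [smul_app, smul_app, h V hV V' hV' hh, res_appLE, map_mul, appLE_res]

lemma Related.res {w : VF X U} {v : VF Y U'} (h : Related f w v) {V : X.left.Opens}
    {V' : Y.left.Opens} (hV : V ≤ U) (hV' : V' ≤ U') : Related f (w.res hV) (v.res hV') :=
  fun V₁ h₁ V₂ h₂ hh s => h V₁ (h₁.trans hV) V₂ (h₂.trans hV') hh s

lemma Related.comp {w : VF X U} {v : VF Y U'} {u : VF Z U''} (h : Related f w v)
    (h' : Related g v u) (hU : U ≤ f.left ⁻¹ᵁ U') : Related (f ≫ g) w u := by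
  intro V hV V'' hV'' hh s
  have hle : V ≤ f.left ⁻¹ᵁ (U' ⊓ g.left ⁻¹ᵁ V'') := fun x hx => ⟨hU (hV hx), hh hx⟩
  have e1 := h V hV (U' ⊓ g.left ⁻¹ᵁ V'') inf_le_left hle
    (g.left.appLE V'' (U' ⊓ g.left ⁻¹ᵁ V'') inf_le_right s)
  have e2 := h' (U' ⊓ g.left ⁻¹ᵁ V'') inf_le_left V'' hV'' inf_le_right s
  rw [e2] at e1
  have e3 (b : Γ(Z.left, V'')) : f.left.appLE _ V hle
      (g.left.appLE V'' (U' ⊓ g.left ⁻¹ᵁ V'') inf_le_right b) = (f ≫ g).left.appLE V'' V hh b :=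
    appLE_appLE _ _ _ _ _
  rw [e3, e3] at e1
  exact e1

lemma Related.unique {w : VF X U} {v v' : VF Y U'}
    (hf : ∀ V : Y.left.Opens, Function.Injective (f.left.app V)) (hU : f.left ⁻¹ᵁ U' ≤ U)
    (h : Related f w v) (h' : Related f w v') : v = v' := by
  ext V hV a
  apply hf V
  rw [Scheme.Hom.app_eq_appLE]
  have hle : f.left ⁻¹ᵁ V ≤ U := (f.left.preimage_mono hV).trans hU
  rw [← h _ hle V hV le_rfl, ← h' _ hle V hV le_rfl]

/-- A vector field that is a combination of vector fields on the target pulls back to the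
combination of the pulled back vector fields. -/
lemma related_sum_smul {I : Type*} {s : Finset I} {w : I → VF X U} {v : I → VF Y U'}
    (h : ∀ i ∈ s, Related f (w i) (v i)) (hU : U ≤ f.left ⁻¹ᵁ U') (a : I → Γ(Y.left, U')) :
    Related f (∑ i ∈ s, f.left.appLE U' U hU (a i) • w i) (∑ i ∈ s, a i • v i) :=
  Related.sum fun i hi => (h i hi).smul hU (a i)

/-- The second order terms `F_i G_k ξ_i ξ_k` cancel by symmetry, leaving only derivatives of
coefficients. Applied to the base and to the total space, the formula yields integrability. -/
lemma bracket_sum_smul {I : Type*} [Fintype I] {ξ : I → VF X U} (hξ : ∀ i j, ⁅ξ i, ξ j⁆ = 0)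
    (F G : I → Γ(X.left, U)) :
    ⁅∑ i, F i • ξ i, ∑ i, G i • ξ i⁆ = ∑ k, ((∑ i, F i • ξ i).app U le_rfl (G k) -
      (∑ i, G i • ξ i).app U le_rfl (F k)) • ξ k := by
  have hcomm (i j : I) (V : X.left.Opens) (hV : V ≤ U) (a : Γ(X.left, V)) :
      (ξ i).app V hV ((ξ j).app V hV a) = (ξ j).app V hV ((ξ i).app V hV a) := by
    have := congr(VF.app $(hξ i j) V hV a)
    rwa [bracket_app, zero_app, sub_eq_zero] at this
  have hexp (v : VF X U) (G : I → Γ(X.left, U)) (V : X.left.Opens) (hV : V ≤ U)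
      (a : Γ(X.left, V)) : v.app V hV ((∑ i, G i • ξ i).app V hV a) =
      ∑ k, (X.left.presheaf.map (homOfLE hV).op (G k) * v.app V hV ((ξ k).app V hV a) +
        (ξ k).app V hV a * X.left.presheaf.map (homOfLE hV).op (v.app U le_rfl (G k))) := by
    rw [sum_app, app_sum]
    refine Finset.sum_congr rfl fun k _ => ?_
    rw [smul_app, v.app_mul, v.app_res U V le_rfl hV]
  ext V hV a
  rw [bracket_app, hexp, hexp, sum_app, Finset.sum_add_distrib, Finset.sum_add_distrib]
  have hsym : ∑ k, X.left.presheaf.map (homOfLE hV).op (G k) *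
        (∑ i, F i • ξ i).app V hV ((ξ k).app V hV a) =
      ∑ k, X.left.presheaf.map (homOfLE hV).op (F k) *
        (∑ i, G i • ξ i).app V hV ((ξ k).app V hV a) := by
    simp only [sum_app, smul_app, Finset.mul_sum]
    rw [Finset.sum_comm]
    refine Finset.sum_congr rfl fun k _ => Finset.sum_congr rfl fun i _ => ?_
    rw [hcomm]
    ring
  rw [hsym, add_sub_add_left_eq_sub, ← Finset.sum_sub_distrib]
  refine Finset.sum_congr rfl fun k _ => ?_
  rw [smul_app, map_sub]
  ring

end VF

/-! ### The standard torus -/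

/-- The character of the standard torus with exponent `m`. -/
def character (r : ℕ) (a : AddMonoidAlgebra ℂ (Fin r → ℤ)) : Γ((stdTorus r).left, ⊤) :=
  (Scheme.ΓSpecIso (.of (AddMonoidAlgebra ℂ (Fin r → ℤ)))).inv a

lemma specMap_appLE {R S : CommRingCat.{0}} (f : R ⟶ S) (V : (Spec S).Opens) (a : R) :
    (Spec.map f).appLE ⊤ V le_top ((Scheme.ΓSpecIso R).inv a) =
      (Spec S).presheaf.map (homOfLE (le_top : V ≤ ⊤)).op ((Scheme.ΓSpecIso S).inv (f a)) := by
  rw [← res_appLE (Spec.map f) (V := ⊤) le_top le_top]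
  refine congrArg _ ?_
  have := Scheme.ΓSpecIso_inv_naturality f
  have h2 := congr($this a)
  rw [Scheme.Hom.appTop, Scheme.Hom.app_eq_appLE] at h2
  exact h2.symm

-- Laurent monomials are group-like: their comultiplication in the Hopf algebra of the torus is `χ ⊗
-- χ`.
open TensorProduct in
lemma mul_appLE_character (r : ℕ) (m : Fin r → ℤ) :
    (μ[stdTorus r]).left.appLE ⊤ ⊤ le_top (character r (.single m 1)) =
      (fst (stdTorus r) (stdTorus r)).left.appLE ⊤ ⊤ le_top (character r (.single m 1)) *
      (snd (stdTorus r) (stdTorus r)).left.appLE ⊤ ⊤ le_top (character r (.single m 1)) := by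
  let A := AddMonoidAlgebra ℂ (Fin r → ℤ)
  have hμ : (μ[stdTorus r]).left = (pullbackSpecIso ℂ A A).hom ≫
      Spec.map (CommRingCat.ofHom (Bialgebra.comulAlgHom ℂ A)) := mul_spec_asOver_spec_left
  have hf : (fst (stdTorus r) (stdTorus r)).left = (pullbackSpecIso ℂ A A).hom ≫
      Spec.map (CommRingCat.ofHom Algebra.TensorProduct.includeLeftRingHom) :=
    (pullbackSpecIso_hom_fst ℂ A A).symm
  have hs : (snd (stdTorus r) (stdTorus r)).left = (pullbackSpecIso ℂ A A).hom ≫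
      Spec.map (CommRingCat.ofHom
        (Algebra.TensorProduct.includeRight : A →ₐ[ℂ] A ⊗[ℂ] A).toRingHom) :=
    (pullbackSpecIso_hom_snd ℂ A A).symm
  have key (f : A →+* A ⊗[ℂ] A) (a : A) :
      ((pullbackSpecIso ℂ A A).hom ≫ Spec.map (CommRingCat.ofHom f)).appLE ⊤ ⊤ le_top
        (character r a) = (pullbackSpecIso ℂ A A).hom.appLE ⊤ ⊤ le_top
          ((Scheme.ΓSpecIso (.of (A ⊗[ℂ] A))).inv (f a)) := by
    refine (appLE_appLE (pullbackSpecIso ℂ A A).hom (Spec.map (CommRingCat.ofHom f)) (V := ⊤)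
      le_top le_top _).symm.trans (congrArg _ ?_)
    refine (specMap_appLE (CommRingCat.ofHom f) ⊤ a).trans (res_self _ _)
  refine (appLE_congr_left hμ _ _).trans ?_
  refine Eq.trans ?_ (congrArg₂ (· * ·) (appLE_congr_left hf _ _)
    (appLE_congr_left hs _ _)).symm
  refine (key (Bialgebra.comulAlgHom ℂ A) _).trans ?_
  refine Eq.trans ?_ (congrArg₂ (· * ·) (key _ _) (key _ _)).symm
  beta_reduce
  rw [← map_mul, ← map_mul]
  refine congrArg _ (congrArg _ ?_)
  simp [A]

/-- The tangent vector of the standard torus at the unit in the direction of the `i`-th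
coordinate, as a homomorphism to the dual numbers. -/
def coordTangentAlgHom (r : ℕ) (i : Fin r) :
    AddMonoidAlgebra ℂ (Fin r → ℤ) →ₐ[ℂ] DualNumber ℂ :=
  AddMonoidAlgebra.lift ℂ (DualNumber ℂ) (Fin r → ℤ)
    { toFun m := 1 + (m.toAdd i : ℂ) • DualNumber.eps
      map_one' := by simp
      map_mul' m n := by ext <;> simp [mul_add, add_mul] }

lemma coordTangentAlgHom_single (r : ℕ) (i : Fin r) (m : Fin r → ℤ) :
    coordTangentAlgHom r i (.single m 1) = 1 + (m i : DualNumber ℂ) * DualNumber.eps := by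
  ext <;> simp [coordTangentAlgHom]

/-- The tangent vector of the standard torus at the unit in the direction of the `i`-th
coordinate. -/
def coordTangent (r : ℕ) (i : Fin r) : dualSpec ⟶ stdTorus r :=
  Over.homMk (Spec.map (CommRingCat.ofHom (coordTangentAlgHom r i).toRingHom)) (by
    refine (Spec.map_comp _ _).symm.trans ?_
    refine congrArg Spec.map ?_
    exact CommRingCat.hom_ext (coordTangentAlgHom r i).comp_algebraMap)

lemma dualPt_coordTangent (r : ℕ) (i : Fin r) : dualPt ≫ coordTangent r i = η[stdTorus r] := by
  refine Over.OverMorphism.ext ?_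
  refine (Spec.map_comp _ _).symm.trans ?_
  refine Eq.trans ?_ (one_spec_asOver_spec_left (R := .of ℂ)
    (A := .of (AddMonoidAlgebra ℂ (Fin r → ℤ)))).symm
  refine congrArg Spec.map (CommRingCat.hom_ext ?_)
  have : (TrivSqZeroExt.fstHom ℂ ℂ ℂ).comp (coordTangentAlgHom r i) =
      Bialgebra.counitAlgHom ℂ (AddMonoidAlgebra ℂ (Fin r → ℤ)) := by
    refine AddMonoidAlgebra.algHom_ext (R := ℂ) (A := ℂ) (M := Fin r → ℤ) (fun m => ?_) (by ext)
    rw [AlgHom.comp_apply, coordTangentAlgHom_single]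
    simp
  exact congrArg (fun f : AddMonoidAlgebra ℂ (Fin r → ℤ) →ₐ[ℂ] ℂ => f.toRingHom) this

lemma coordTangent_character (r : ℕ) (i : Fin r) (m : Fin r → ℤ) :
    (coordTangent r i).left.appLE ⊤ ⊤ le_top (character r (.single m 1)) =
      1 + (m i : Γ(dualSpec.left, ⊤)) * dualEps := by
  refine (specMap_appLE _ ⊤ _).trans ((res_self _ _).trans ?_)
  refine (congrArg _ (coordTangentAlgHom_single r i m)).trans ?_
  refine (map_add _ _ _).trans (congrArg₂ _ (map_one _) ((map_mul _ _ _).trans ?_))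
  exact congrArg (· * dualEps) (map_intCast _ _)

/-! ### Translation flows and their action on characters. -/

section TranslationFlow

variable {G : CSch} [MonObj G]

/-- The infinitesimal flow on a monoid scheme generated by translations in the direction of a
tangent vector at the unit. -/
def translationFlow (τ : dualSpec ⟶ G) : dualSpec ⊗ G ⟶ G := τ ▷ G ≫ μ[G]

lemma isFlow_translationFlow {τ : dualSpec ⟶ G} (hτ : dualPt ≫ τ = η[G]) :
    IsFlow (translationFlow τ) := by
  have h1 : zeroSec G ≫ τ ▷ G = lift (toUnit _) (𝟙 _) ≫ η[G] ▷ G := by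
    ext1 <;> simp [zeroSec, hτ]
  rw [IsFlow, translationFlow, ← Category.assoc, h1, Category.assoc, MonObj.one_mul]
  simp

/-- From `χ(t x) = χ(t) χ(x)` and `χ(τ) = 1 + n ε`, the pullback of `χ` along the flow is `χ + ε n
χ`. -/
lemma translationFlow_vf {τ : dualSpec ⟶ G} (hτ : dualPt ≫ τ = η[G]) {χ : Γ(G.left, ⊤)}
    (hχ : μ[G].left.appLE ⊤ ⊤ le_top χ =
      (fst G G).left.appLE ⊤ ⊤ le_top χ * (snd G G).left.appLE ⊤ ⊤ le_top χ) {n : ℤ}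
    (hn : τ.left.appLE ⊤ ⊤ le_top χ = 1 + (n : Γ(dualSpec.left, ⊤)) * dualEps) :
    (isFlow_translationFlow hτ).vf.app ⊤ le_top χ = n * χ := by
  refine (isFlow_translationFlow hτ).vf_eq ?_
  have e1 : τ ▷ G ≫ fst _ _ = fst _ _ ≫ τ := by simp
  have e2 : τ ▷ G ≫ snd _ _ = snd _ _ := by simp
  refine (appLE_appLE (τ ▷ G).left μ[G].left (V := ⊤) le_top le_top χ).symm.trans ?_
  rw [hχ, map_mul]
  have h1 : (τ ▷ G).left.appLE ⊤ ((snd dualSpec G).left ⁻¹ᵁ ⊤) le_top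
      ((fst G G).left.appLE ⊤ ⊤ le_top χ) =
        (fst dualSpec G).left.appLE ⊤ _ le_top (τ.left.appLE ⊤ ⊤ le_top χ) :=
    (appLE_appLE _ _ _ _ _).trans ((appLE_congr_left (left_comp_eq e1) _ _).trans
      (appLE_appLE (fst dualSpec G).left τ.left _ _ _).symm)
  have h2 : (τ ▷ G).left.appLE ⊤ ((snd dualSpec G).left ⁻¹ᵁ ⊤) le_top
      ((snd G G).left.appLE ⊤ ⊤ le_top χ) = (snd dualSpec G).left.appLE ⊤ _ le_rfl χ :=
    (appLE_appLE _ _ _ _ _).trans (appLE_congr_left (left_comp_eq e2) _ _)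
  rw [h1, h2, hn, map_add, map_one, map_mul, map_intCast, map_mul, map_intCast]
  change (1 + _ * epsOn _ _) * _ = _
  ring

end TranslationFlow

/-! ### Orbit maps -/

section Orbit

variable {T : CSch} [GrpObj T] {X : CSch} [ModObj T X]

lemma comp_orbitMap {Z : CSch} (t : Z ⟶ T) (x : Pt X) :
    t ≫ orbitMap T x = lift t (toUnit Z ≫ x) ≫ γ[T, X] := by
  rw [orbitMap, ← Category.assoc, comp_lift]
  simp

lemma mul_comp_orbitMap (x : Pt X) : μ[T] ≫ orbitMap T x = T ◁ orbitMap T x ≫ γ[T, X] := by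
  have h1 : T ◁ orbitMap T x = lift (fst T T) (snd T T ≫ orbitMap T x) := by ext1 <;> simp
  rw [h1, comp_orbitMap, comp_orbitMap, lift_lift_smul, lift_fst_snd, Category.id_comp]

/-- The orbit map is the isomorphism `(t, y) ↦ (t y, y)` restricted to `y = x`. Its inverse takes
`z` to the `T`-component of the preimage of `(z, x)`. -/
lemma isIso_orbitMap [IsIso (lift γ[T, X] (snd T X))] (x : Pt X) : IsIso (orbitMap T x) := by
  set a := lift γ[T, X] (snd T X)
  have ha1 : a ≫ fst _ _ = γ[T, X] := lift_fst _ _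
  have ha2 : a ≫ snd _ _ = snd _ _ := lift_snd _ _
  let s : X ⟶ T ⊗ X := lift (𝟙 X) (toUnit X ≫ x) ≫ inv a
  have hs : s ≫ a = lift (𝟙 X) (toUnit X ≫ x) := by simp [s]
  have hs1 : s ≫ γ[T, X] = 𝟙 X := by rw [← ha1, ← Category.assoc, hs, lift_fst]
  have hs2 : s ≫ snd _ _ = toUnit X ≫ x := by rw [← ha2, ← Category.assoc, hs, lift_snd]
  have hos : orbitMap T x ≫ s = lift (𝟙 T) (toUnit T ≫ x) := by
    rw [← cancel_mono a, Category.assoc, hs]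
    ext1 <;> simp [a, orbitMap]
  refine ⟨s ≫ fst _ _, ?_, ?_⟩
  · rw [← Category.assoc, hos, lift_fst]
  · rw [comp_orbitMap, ← hs1, ← hs2]
    congr 1
    ext1 <;> simp

lemma translationFlow_comp_hom {G G' : CSch} [MonObj G] [MonObj G'] (f : G ⟶ G') [IsMonHom f]
    (τ : dualSpec ⟶ G) :
    translationFlow τ ≫ f = dualSpec ◁ f ≫ translationFlow (τ ≫ f) := by
  have h1 : τ ▷ G ≫ (f ⊗ₘ f) = dualSpec ◁ f ≫ (τ ≫ f) ▷ G' := by ext1 <;> simp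
  rw [translationFlow, translationFlow, Category.assoc, IsMonHom.mul_hom, reassoc_of% h1]

lemma translationFlow_comp_orbitMap (τ : dualSpec ⟶ T) (x : Pt X) :
    translationFlow τ ≫ orbitMap T x = dualSpec ◁ orbitMap T x ≫ actFlow τ X := by
  rw [translationFlow, actFlow, Category.assoc, mul_comp_orbitMap, whisker_exchange_assoc]

end Orbit

/-! ### The torus chart -/

/-- A constant function. -/
def constFn (X : CSch) (V : X.left.Opens) (c : ℂ) : Γ(X.left, V) :=
  X.hom.appLE ⊤ V le_top ((Scheme.ΓSpecIso (.of ℂ)).inv c)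

lemma res_constFn {X : CSch} {V V' : X.left.Opens} (h : V' ≤ V) (c : ℂ) :
    X.left.presheaf.map (homOfLE h).op (constFn X V c) = constFn X V' c :=
  res_appLE _ _ h _

lemma appLE_constFn {X Y : CSch} (f : X ⟶ Y) {V : Y.left.Opens} {V' : X.left.Opens}
    (h : V' ≤ f.left ⁻¹ᵁ V) (c : ℂ) : f.left.appLE V V' h (constFn Y V c) = constFn X V' c :=
  (appLE_appLE _ _ _ _ _).trans (appLE_congr_left (Over.w f) _ _)

lemma VF.app_constFn {X : CSch} {U : X.left.Opens} (v : VF X U) (V : X.left.Opens) (hV : V ≤ U)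
    (c : ℂ) : v.app V hV (constFn X V c) = 0 := v.app_const V hV _

lemma bijective_appLE_of_isOpenImmersion {X Y : Scheme.{0}} (f : X ⟶ Y) [IsOpenImmersion f]
    {W : Y.Opens} (hW : W = f.opensRange) (h : ⊤ ≤ f ⁻¹ᵁ W) :
    Function.Bijective (f.appLE W ⊤ h) := by
  rw [← f.image_top_eq_opensRange] at hW
  subst hW
  have : IsIso (f.appLE (f ''ᵁ ⊤) ⊤ h) := by
    rw [← f.appIso_hom']
    infer_instance
  exact ConcreteCategory.bijective_of_isIso _

/-- A torus chart on a scheme `M` with an action of `T`: an open affine subset `W` with an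
identification of its ring of functions with a Laurent polynomial ring, and tangent vectors of `T`
whose fundamental vector fields act on Laurent monomials through their exponents. -/
structure TorusChart (T : CSch) [GrpObj T] (M : CSch) [ModObj T M] (W : M.left.Opens) where
  /-- The number of coordinates. -/
  rank : ℕ
  /-- The tangent vectors of `T` at the unit. -/
  τ : Fin rank → (dualSpec ⟶ T)
  dualPt_τ (i : Fin rank) : dualPt ≫ τ i = η[T]
  /-- The functions on the chart. -/
  κ : AddMonoidAlgebra ℂ (Fin rank → ℤ) ≃+* Γ(M.left, W)
  κ_const (c : ℂ) : κ (algebraMap ℂ _ c) = constFn M W c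
  vf_κ (i : Fin rank) (m : Fin rank → ℤ) :
    (isFlow_actFlow (dualPt_τ i) M).vf.app W le_top (κ (.single m 1)) =
      m i * κ (.single m 1)
  isAffineOpen : IsAffineOpen W

lemma isCommMonObj_of_isTorus {T : CSch} [GrpObj T] (h : IsTorus T) : IsCommMonObj T := by
  obtain ⟨r, e, he⟩ := h
  constructor
  have : IsCommMonObj (stdTorus r) := inferInstance
  have h1 : (β_ T T).hom ≫ (e.hom ⊗ₘ e.hom) = (e.hom ⊗ₘ e.hom) ≫ (β_ _ _).hom := by
    ext1 <;> simp
  rw [← cancel_mono e.hom, Category.assoc, IsMonHom.mul_hom, reassoc_of% h1, IsCommMonObj.mul_comm]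

/-- The map `t ↦ t x₀` identifies the standard torus with `W` and intertwines translation with the
action on `M`. The fundamental fields therefore act on Laurent monomials as the translation fields
do. -/
lemma exists_torusChart {T : CSch} [GrpObj T] {M M₀ : CSch} [ModObj T M] [ModObj T M₀]
    {j : M₀ ⟶ M} (hM : IsSmoothToric T j) {W : M.left.Opens}
    (hW : (W : Set M.left) = Set.range j.left) (x₀ : Pt M₀) : Nonempty (TorusChart T M W) := by
  obtain ⟨r, e, he⟩ := hM.isTorus
  have := hM.equivariant
  have := hM.simplyTransitive
  have := isIso_orbitMap (T := T) x₀
  have hj := hM.isOpenImmersion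
  let k₀ : stdTorus r ⟶ M₀ := e.inv ≫ orbitMap T x₀
  let k : stdTorus r ⟶ M := k₀ ≫ j
  have hk₀ : IsIso k₀.left := inferInstanceAs (IsIso ((Over.forget _).map k₀))
  have hk : k.left = k₀.left ≫ j.left := rfl
  have hki : IsOpenImmersion k.left := by rw [hk]; infer_instance
  have hWk : W = k.left.opensRange := by
    apply TopologicalSpace.Opens.ext
    rw [hW, Scheme.Hom.coe_opensRange, hk, Scheme.Hom.comp_base, TopCat.coe_comp,
      Set.range_comp, k₀.left.surjective.range_eq, Set.image_univ]
  have hle : (⊤ : (stdTorus r).left.Opens) ≤ k.left ⁻¹ᵁ W := by rw [hWk]; simp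
  let κ₁ : Γ(M.left, W) ≃+* Γ((stdTorus r).left, ⊤) := RingEquiv.ofBijective
    (k.left.appLE W ⊤ hle).hom (bijective_appLE_of_isOpenImmersion k.left hWk hle)
  let κ₂ : Γ((stdTorus r).left, ⊤) ≃+* AddMonoidAlgebra ℂ (Fin r → ℤ) :=
    (Scheme.ΓSpecIso (.of (AddMonoidAlgebra ℂ (Fin r → ℤ)))).commRingCatIsoToRingEquiv
  have hκ (a) : k.left.appLE W ⊤ hle ((κ₁.trans κ₂).symm a) = character r a :=
    κ₁.apply_symm_apply _
  have hτ (i : Fin r) : dualPt ≫ coordTangent r i ≫ e.inv = η[T] := by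
    rw [← Category.assoc, dualPt_coordTangent, IsMonHom.one_hom]
  have hrel (i : Fin r) : VF.Related k (isFlow_translationFlow (dualPt_coordTangent r i)).vf
      (isFlow_actFlow (hτ i) M).vf := by
    refine related_vf _ _ ?_
    simp only [k, k₀, Category.assoc, MonoidalCategory.whiskerLeft_comp]
    rw [← Category.assoc, translationFlow_comp_hom, Category.assoc, ← Category.assoc _ _ j,
      translationFlow_comp_orbitMap, Category.assoc, actFlow_comp]
  refine ⟨⟨r, fun i => coordTangent r i ≫ e.inv, hτ, (κ₁.trans κ₂).symm, fun c => ?_,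
    fun i m => ?_, ?_⟩⟩
  · apply κ₁.injective
    refine (hκ _).trans (Eq.symm ?_)
    refine (appLE_constFn k _ c).trans ?_
    exact (specMap_appLE (CommRingCat.ofHom (algebraMap ℂ _)) ⊤ c).trans (res_self _ _)
  · apply κ₁.injective
    refine (hrel i ⊤ le_top W le_top hle _).symm.trans ?_
    rw [hκ, translationFlow_vf (dualPt_coordTangent r i) (mul_appLE_character r m)
      (coordTangent_character r i m), ← hκ]
    exact ((map_mul κ₁ _ _).trans (congrArg (· * _) (map_intCast κ₁ _))).symm
  · have : IsAffine (stdTorus r).left := inferInstanceAs (IsAffine (Spec _))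
    rw [hWk]
    exact isAffineOpen_opensRange k.left

/-! ### Constants of the Euler derivations of a Laurent polynomial ring -/

section Euler

variable {G : Type*}

/-- Multiply the coefficients of an element of a monoid algebra by weights. -/
def scaleCoeff (w : G → ℂ) (a : AddMonoidAlgebra ℂ G) : AddMonoidAlgebra ℂ G :=
  .ofCoeff (Finsupp.onFinset a.coeff.support (fun m => w m * a.coeff m) fun m hm => by
    rw [Finsupp.mem_support_iff]
    exact right_ne_zero_of_mul hm)

@[simp] lemma scaleCoeff_coeff (w : G → ℂ) (a : AddMonoidAlgebra ℂ G) (m : G) :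
    (scaleCoeff w a).coeff m = w m * a.coeff m := rfl

lemma map_scaleCoeff {B : Type*} [AddCommGroup B] (w : G → ℂ) (f g : AddMonoidAlgebra ℂ G →+ B)
    (h : ∀ m c, f (.single m c) = g (.single m (w m * c))) (a : AddMonoidAlgebra ℂ G) :
    f a = g (scaleCoeff w a) := by
  induction a using AddMonoidAlgebra.induction_linear with
  | zero =>
    rw [map_zero, show scaleCoeff w (0 : AddMonoidAlgebra ℂ G) = 0 by ext; simp, map_zero]
  | add a b ha hb =>
    rw [map_add, ha, hb, ← map_add]
    congr 1
    ext m
    simp [mul_add]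
  | single m c =>
    rw [h]
    congr 1
    classical
    ext m'
    by_cases hm : m = m'
    · subst hm; simp
    · simp [hm]

variable {r : ℕ} {B : Type*} [CommRing B] (φ : AddMonoidAlgebra ℂ (Fin r → ℤ) →+* B)
  (D : Fin r → Derivation ℤ B B)

/-- The operator `D_i - n` multiplies the coefficient of exponent `m` by `m_i - n`, so it removes
the monomials with `m_i = n` and creates none. -/
lemma derivation_sub_eq_map_scaleCoeff
    (hD : ∀ i m c, D i (φ (.single m c)) = m i * φ (.single m c))
    (i : Fin r) (n : ℤ) (a : AddMonoidAlgebra ℂ (Fin r → ℤ)) :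
    D i (φ a) - n * φ a = φ (scaleCoeff (fun m => (m i - n : ℂ)) a) := by
  refine map_scaleCoeff (fun m => (m i - n : ℂ))
    ((D i : B →+ B).comp (φ : _ →+ B) - (AddMonoidHom.mulLeft (n : B)).comp (φ : _ →+ B))
    (φ : _ →+ B) (fun m c => ?_) a
  change D i (φ (.single m c)) - n * φ (.single m c) = φ _
  rw [hD, ← sub_mul, ← map_intCast φ, ← map_intCast φ, ← map_sub, ← map_mul]
  congr 1
  rw [← Int.cast_sub, ← zsmul_eq_mul, AddMonoidAlgebra.smul_single, zsmul_eq_mul, Int.cast_sub]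

/-- A fraction killed by all Euler derivations is constant. -/
lemma eq_algebraMap_of_derivation_eq_zero (hφ : Function.Injective φ)
    (hD : ∀ i m c, D i (φ (.single m c)) = m i * φ (.single m c)) {f : B}
    (hf : ∀ i, D i f = 0) {s a : AddMonoidAlgebra ℂ (Fin r → ℤ)} (hs : s ≠ 0)
    (hfs : f * φ s = φ a) : ∃ c : ℂ, f = φ (algebraMap ℂ _ c) := by
  -- Induction on the number of monomials in the denominator. If `s` contains `m` and some other
  -- exponent differing from `m` in coordinate `i`, then `D_i - m_i` applied to `f s = a` preserves
  -- the shape of the equation because `D_i f = 0`. It kills the term at `m` and leaves the other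
  -- one.
  have hmono : ∃ m a', f * φ (.single m 1) = φ a' := by
    induction hk : s.coeff.support.card using Nat.strong_induction_on generalizing s a with
    | _ k ih =>
      subst hk
      have hne : s.coeff.support.Nonempty := by
        rw [Finset.nonempty_iff_ne_empty, Ne, Finsupp.support_eq_empty]
        exact fun h => hs (AddMonoidAlgebra.coeff_eq_zero.1 h)
      obtain ⟨m, hm⟩ := hne
      by_cases hall : ∀ m' ∈ s.coeff.support, m' = m
      · have hs' : s = .single m (s.coeff m) := by
          ext m'
          rw [AddMonoidAlgebra.coeff_single, Finsupp.single_apply]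
          split_ifs with h
          · rw [h]
          · by_contra h'
            exact h (hall m' (Finsupp.mem_support_iff.2 h')).symm
        refine ⟨m, .single 0 (s.coeff m)⁻¹ * a, ?_⟩
        rw [map_mul, ← hfs, mul_left_comm, ← map_mul]
        congr 2
        refine Eq.trans ?_ (congrArg (AddMonoidAlgebra.single 0 (s.coeff m)⁻¹ * ·) hs').symm
        rw [AddMonoidAlgebra.single_mul_single, zero_add,
          inv_mul_cancel₀ (Finsupp.mem_support_iff.1 hm)]
      · push Not at hall
        obtain ⟨m', hm', hne⟩ := hall
        obtain ⟨i, hi⟩ := Function.ne_iff.1 hne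
        refine ih (scaleCoeff (fun p => (p i - m i : ℂ)) s).coeff.support.card ?_
          (s := scaleCoeff (fun p => (p i - m i : ℂ)) s)
          (a := scaleCoeff (fun p => (p i - m i : ℂ)) a) ?_ ?_ rfl
        · refine Finset.card_lt_card ⟨fun p hp => ?_, fun h => ?_⟩
          · rw [Finsupp.mem_support_iff, scaleCoeff_coeff] at hp
            exact Finsupp.mem_support_iff.2 (right_ne_zero_of_mul hp)
          · have := Finsupp.mem_support_iff.1 (h hm)
            simp at this
        · intro h0
          have := congr(AddMonoidAlgebra.coeff $h0 m')
          rw [scaleCoeff_coeff, AddMonoidAlgebra.coeff_zero, Finsupp.zero_apply, mul_eq_zero,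
            sub_eq_zero, Int.cast_inj] at this
          exact this.elim hi (Finsupp.mem_support_iff.1 hm')
        · rw [← derivation_sub_eq_map_scaleCoeff φ D hD, ← derivation_sub_eq_map_scaleCoeff φ D hD,
            ← hfs, Derivation.leibniz, hf]
          simp only [smul_eq_mul]
          ring
  obtain ⟨m, a', ha'⟩ := hmono
  obtain ⟨b, rfl⟩ : ∃ b, f = φ b := by
    refine ⟨a' * .single (-m) 1, ?_⟩
    rw [map_mul, ← ha', mul_assoc, ← map_mul, AddMonoidAlgebra.single_mul_single]
    simp [← AddMonoidAlgebra.one_def]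
  refine ⟨b.coeff 0, congrArg φ ?_⟩
  -- `f` is now a Laurent polynomial, and `D_i f = 0` says that `p_i b_p = 0` for every exponent
  -- `p`. Only `p = 0` survives.
  have hb (i : Fin r) : scaleCoeff (fun p => (p i - (0 : ℤ) : ℂ)) b = 0 := by
    apply hφ
    rw [← derivation_sub_eq_map_scaleCoeff φ D hD, hf]
    simp
  ext m
  change _ = (AddMonoidAlgebra.single (0 : Fin r → ℤ) (b.coeff 0)).coeff m
  rw [AddMonoidAlgebra.coeff_single, Finsupp.single_apply]
  split_ifs with h
  · rw [h]
  · obtain ⟨i, hi⟩ := Function.ne_iff.1 h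
    have := congr(AddMonoidAlgebra.coeff $(hb i) m)
    rw [scaleCoeff_coeff, AddMonoidAlgebra.coeff_zero, Finsupp.zero_apply, mul_eq_zero,
      sub_eq_zero, Int.cast_inj] at this
    exact this.resolve_left (Ne.symm hi)

end Euler

/-! ### Logarithmic vector fields in a torus chart -/

lemma VF.ext_of_res_inf {M : CSch} [IsIntegral M.left] {W U : M.left.Opens}
    (hW : (W : Set M.left).Nonempty) {v w : VF M U}
    (h : v.res (inf_le_left : U ⊓ W ≤ U) = w.res inf_le_left) : v = w := by
  ext V hV a
  apply res_inf_injective hW V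
  have := congr(VF.app $h (V ⊓ W) (inf_le_inf_right W hV)
    (M.left.presheaf.map (homOfLE inf_le_left).op a))
  rw [VF.res_app, VF.res_app] at this
  rwa [← v.app_res, ← w.app_res]

namespace TorusChart

variable {T : CSch} [GrpObj T] {M : CSch} [ModObj T M] {W : M.left.Opens} (C : TorusChart T M W)

/-- The `i`-th fundamental vector field on a scheme with an action of `T`. -/
def ξ (X : CSch) [ModObj T X] (i : Fin C.rank) : VF X ⊤ := (isFlow_actFlow (C.dualPt_τ i) X).vf

lemma related_ξ {X Y : CSch} [ModObj T X] [ModObj T Y] (f : X ⟶ Y) [IsModHom T f]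
    (i : Fin C.rank) : VF.Related f (C.ξ X i) (C.ξ Y i) :=
  related_vf _ _ (actFlow_comp (C.τ i) f)

lemma bracket_ξ [IsCommMonObj T] (X : CSch) [ModObj T X] (i k : Fin C.rank) :
    ⁅C.ξ X i, C.ξ X k⁆ = 0 :=
  bracket_vf_eq_zero _ _ (actFlow_comm (C.τ i) (C.τ k) X)

/-- The Laurent monomial with exponent `m`. -/
def χ (m : Fin C.rank → ℤ) : Γ(M.left, W) := C.κ (.single m 1)

lemma χ_add (m n : Fin C.rank → ℤ) : C.χ (m + n) = C.χ m * C.χ n := by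
  rw [χ, χ, χ, ← map_mul, AddMonoidAlgebra.single_mul_single, one_mul]

lemma χ_zero : C.χ (0 : Fin C.rank → ℤ) = 1 := map_one C.κ

lemma isUnit_χ (m : Fin C.rank → ℤ) : IsUnit (C.χ m) := by
  refine IsUnit.of_mul_eq_one (C.χ (-m)) ?_
  rw [← C.χ_add, add_neg_cancel, C.χ_zero]

lemma isUnit_res_χ {V : M.left.Opens} (hV : V ≤ W) (m : Fin C.rank → ℤ) :
    IsUnit (M.left.presheaf.map (homOfLE hV).op (C.χ m)) :=
  (C.isUnit_χ m).map (M.left.presheaf.map (homOfLE hV).op).hom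

lemma κ_single (m : Fin C.rank → ℤ) (c : ℂ) : C.κ (.single m c) =
    constFn M W c * C.χ m := by
  rw [← C.κ_const, χ, ← map_mul]
  change _ = C.κ (.single 0 c * .single m 1)
  rw [AddMonoidAlgebra.single_mul_single, zero_add, mul_one]

lemma closure_eq_top : Subring.closure (Set.range C.χ ∪ Set.range (constFn M W)) = ⊤ := by
  refine eq_top_iff.2 fun a _ => ?_
  obtain ⟨a, rfl⟩ := C.κ.surjective a
  induction a using AddMonoidAlgebra.induction_linear with
  | zero => rw [map_zero]; exact zero_mem _
  | add a b ha hb => rw [map_add]; exact add_mem (ha trivial) (hb trivial)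
  | single m c =>
    rw [κ_single]
    exact mul_mem (Subring.subset_closure (.inr ⟨c, rfl⟩)) (Subring.subset_closure (.inl ⟨m, rfl⟩))

lemma ξ_res_χ {V : M.left.Opens} (hV : V ≤ W) (i : Fin C.rank) (m : Fin C.rank → ℤ) :
    (C.ξ M i).app V le_top (M.left.presheaf.map (homOfLE hV).op (C.χ m)) =
      m i * M.left.presheaf.map (homOfLE hV).op (C.χ m) := by
  have h : (C.ξ M i).app W le_top (C.χ m) = m i * C.χ m := C.vf_κ i m
  rw [(C.ξ M i).app_res W V le_top hV, h, map_mul, map_intCast]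

lemma sum_smul_ξ_res_χ {U : M.left.Opens} (f : Fin C.rank → Γ(M.left, U))
    (m : Fin C.rank → ℤ) : (∑ i, f i • (C.ξ M i).res le_top).app (U ⊓ W) inf_le_left
      (M.left.presheaf.map (homOfLE inf_le_right).op (C.χ m)) =
    M.left.presheaf.map (homOfLE inf_le_left).op (∑ i, (m i : Γ(M.left, U)) * f i) *
      M.left.presheaf.map (homOfLE inf_le_right).op (C.χ m) := by
  rw [VF.sum_app, map_sum, Finset.sum_mul]
  refine Finset.sum_congr rfl fun i _ => ?_
  rw [VF.smul_app, VF.res_app, ξ_res_χ, map_mul, map_intCast]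
  ring

variable [IsIntegral M.left]

lemma res_mul_res_χ_cancel (hW : (W : Set M.left).Nonempty) {U : M.left.Opens} {f g : Γ(M.left, U)}
    {m : Fin C.rank → ℤ}
    (h : M.left.presheaf.map (homOfLE inf_le_left).op f *
        M.left.presheaf.map (homOfLE (inf_le_right : U ⊓ W ≤ W)).op (C.χ m) =
      M.left.presheaf.map (homOfLE inf_le_left).op g *
        M.left.presheaf.map (homOfLE (inf_le_right : U ⊓ W ≤ W)).op (C.χ m)) : f = g :=
  res_inf_injective hW U ((C.isUnit_res_χ inf_le_right m).mul_right_cancel h)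

/-- The `k`-th coefficient is the logarithmic derivative of the `k`-th coordinate of the torus. -/
lemma sum_smul_ξ_injective (hW : (W : Set M.left).Nonempty) {U : M.left.Opens} :
    Function.Injective fun f : Fin C.rank → Γ(M.left, U) =>
      ∑ i, f i • (C.ξ M i).res (le_top : U ≤ ⊤) := by
  intro f g h
  ext k
  have h1 := C.sum_smul_ξ_res_χ f (Pi.single k 1)
  have h2 := C.sum_smul_ξ_res_χ g (Pi.single k 1)
  beta_reduce at h
  rw [h, h2] at h1
  have h3 := C.res_mul_res_χ_cancel hW h1
  simpa [Pi.single_apply] using h3.symm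

/-- The logarithmic derivative `f m` of `χ^m` along `v` is regular on `U` and additive in `m`, so it
is determined by its values on the standard basis. With these as coefficients the combination agrees
with `v` on all monomials, hence on `U ⊓ W`, hence on `U` by density. -/
lemma exists_eq_sum_smul_ξ [IsLocallyNoetherian M.left] (hW : (W : Set M.left).Nonempty)
    (hD : IsSNCComplement W) {U : M.left.Opens} {v : VF M U} (hv : v ∈ logTangent M W U) :
    ∃ f : Fin C.rank → Γ(M.left, U), v = ∑ i, f i • (C.ξ M i).res le_top := by
  choose f hf using fun m => exists_log_derivative hW hD hv (C.isUnit_χ m)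
  have hadd (m n : Fin C.rank → ℤ) : f (m + n) = f m + f n := by
    refine C.res_mul_res_χ_cancel hW (m := m + n) ?_
    rw [← hf, χ_add, map_mul, v.app_mul, hf, hf, map_add]
    ring
  let F : (Fin C.rank → ℤ) →+ Γ(M.left, U) := AddMonoidHom.mk' f hadd
  have hF (m : Fin C.rank → ℤ) : f m = ∑ i, (m i : Γ(M.left, U)) * f (Pi.single i 1) := by
    have h1 : m = ∑ i, m i • (Pi.single i 1 : Fin C.rank → ℤ) := by
      ext k
      simp [Finset.sum_apply, Pi.single_apply]
    have h2 := congrArg F h1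
    rw [map_sum] at h2
    refine h2.trans (Finset.sum_congr rfl fun i _ => ?_)
    rw [map_zsmul, zsmul_eq_mul]
    rfl
  refine ⟨fun i => f (Pi.single i 1), VF.ext_of_res_inf hW ?_⟩
  refine VF.ext_of_generators C.isAffineOpen inf_le_right _ C.closure_eq_top ?_
  rintro _ (⟨m, rfl⟩ | ⟨c, rfl⟩)
  · rw [VF.res_app, VF.res_app, hf, sum_smul_ξ_res_χ, ← hF]
  · rw [res_constFn, VF.app_constFn, VF.app_constFn]

/-- A function on a non-empty open subset of the chart that is killed by the fundamental vector
fields is constant. -/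
lemma eq_const_of_ξ_eq_zero {U : M.left.Opens} (hU : (U : Set M.left).Nonempty) (hUW : U ≤ W)
    {f : Γ(M.left, U)} (hf : ∀ i, (C.ξ M i).app U le_top f = 0) :
    ∃ c : ℂ, f = constFn M U c := by
  obtain ⟨x, hx⟩ := hU
  obtain ⟨b, hb, hxb⟩ := C.isAffineOpen.exists_basicOpen_le (V := U) ⟨x, hx⟩ (hUW hx)
  have hbne : (M.left.basicOpen b : Set M.left).Nonempty := ⟨x, hxb⟩
  have hloc := C.isAffineOpen.isLocalization_basicOpen b
  -- `U` need not be affine, but on a basic open subset of `W` inside it `f` is a fraction of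
  -- Laurent polynomials. By integrality `f * b ^ n = a` already holds on `U`.
  obtain ⟨n, a, ha⟩ := IsLocalization.Away.surj b (M.left.presheaf.map (homOfLE hb).op f)
  have hb0 : b ^ n ≠ 0 := by
    have : Nonempty W := ⟨⟨x, hUW hx⟩⟩
    refine pow_ne_zero n fun h0 => ?_
    rw [h0, Scheme.basicOpen_zero] at hxb
    exact hxb
  let φ : AddMonoidAlgebra ℂ (Fin C.rank → ℤ) →+* Γ(M.left, U) :=
    (M.left.presheaf.map (homOfLE hUW).op).hom.comp C.κ.toRingHom
  have hφ : Function.Injective φ :=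
    (res_injective hUW fun _ => ⟨x, hx⟩).comp C.κ.injective
  have hs : φ (C.κ.symm (b ^ n)) = M.left.presheaf.map (homOfLE hUW).op (b ^ n) :=
    congrArg _ (C.κ.apply_symm_apply _)
  have ha' : φ (C.κ.symm a) = M.left.presheaf.map (homOfLE hUW).op a :=
    congrArg _ (C.κ.apply_symm_apply _)
  have hφs (m : Fin C.rank → ℤ) (c : ℂ) : φ (.single m c) = constFn M U c *
        M.left.presheaf.map (homOfLE hUW).op (C.χ m) := by
    refine (congrArg (M.left.presheaf.map (homOfLE hUW).op) (C.κ_single m c)).trans ?_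
    rw [map_mul, res_constFn]
  have hD (i : Fin C.rank) (m : Fin C.rank → ℤ) (c : ℂ) :
      (C.ξ M i).toDerivation U le_top (φ (.single m c)) = m i * φ (.single m c) := by
    rw [hφs, VF.toDerivation_apply, VF.app_mul, VF.app_constFn, ξ_res_χ]
    ring
  have hfs : f * φ (C.κ.symm (b ^ n)) = φ (C.κ.symm a) := by
    rw [hs, ha']
    refine res_injective hb (fun _ => hbne) ?_
    rw [map_mul, res_res, res_res, map_pow]
    exact ha
  obtain ⟨c, hc⟩ := eq_algebraMap_of_derivation_eq_zero φ
    (fun i => (C.ξ M i).toDerivation U le_top) hφ hD hf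
    (fun h => hb0 (C.κ.symm.map_eq_zero_iff.1 h)) hfs
  refine ⟨c, hc.trans ?_⟩
  refine (congrArg (M.left.presheaf.map (homOfLE hUW).op) (C.κ_const c)).trans ?_
  rw [res_constFn]

end TorusChart

/-! ### Points -/

section

/-- A scheme locally of finite type over `ℂ` is Jacobson, so a nonempty open set contains a closed
point, and closed points are `ℂ`-points by the Nullstellensatz. -/
lemma exists_pt {X : CSch} [LocallyOfFiniteType X.hom] (U : X.left.Opens)
    (hU : (U : Set X.left).Nonempty) :
    ∃ x : Pt X, Set.range x.left ⊆ U := by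
  have : JacobsonSpace X.left := LocallyOfFiniteType.jacobsonSpace X.hom
  obtain ⟨x, hxU, hx⟩ := nonempty_inter_closedPoints hU U.2.isLocallyClosed
  refine ⟨Over.homMk (pointOfClosedPoint X.hom x hx) (pointOfClosedPoint_comp X.hom x hx), ?_⟩
  rintro _ ⟨y, rfl⟩
  exact (pointOfClosedPoint_apply X.hom x hx y).symm ▸ hxU

lemma exists_lift_of_isOpenImmersion {X Y Z : CSch} (j : X ⟶ Y) [IsOpenImmersion j.left]
    (f : Z ⟶ Y) (h : Set.range f.left ⊆ Set.range j.left) : ∃ g : Z ⟶ X, g ≫ j = f := by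
  refine ⟨Over.homMk (IsOpenImmersion.lift j.left f.left h) ?_, ?_⟩
  · rw [← Over.w j, ← Category.assoc, IsOpenImmersion.lift_fac, Over.w]
  · ext1
    exact IsOpenImmersion.lift_fac _ _ _

/-! ### Equivariant bundles over the open orbit -/

variable {T H : CSch} [GrpObj T] [GrpObj H] {M M₀ : CSch} [ModObj T M] [ModObj T M₀]
  (P : EquivariantBundle T H M)

lemma orbitMap_comp {X Y : CSch} [ModObj T X] [ModObj T Y] (f : X ⟶ Y) [IsModHom T f]
    (x : Pt X) : orbitMap T x ≫ f = orbitMap T (x ≫ f) := by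
  have h1 : lift (𝟙 T) (toUnit T ≫ x) ≫ T ◁ f = lift (𝟙 T) (toUnit T ≫ x ≫ f) := by
    ext1 <;> simp
  rw [orbitMap, orbitMap, Category.assoc, smul_comp_hom, reassoc_of% h1]

lemma one_comp_orbitMap {X : CSch} [ModObj T X] (x : Pt X) : η[T] ≫ orbitMap T x = x := by
  have : (η[T] : 𝟙_ CSch ⟶ T) = toUnit _ ≫ η[T] := by
    rw [toUnit_unique (toUnit (𝟙_ CSch)) (𝟙 _), Category.id_comp]
  rw [comp_orbitMap, this, lift_one_smul, toUnit_unique (toUnit (𝟙_ CSch)) (𝟙 _),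
    Category.id_comp]

/-- If the orbit map of `x₀` is an isomorphism, the orbit of any point is the image of an
equivariant morphism. -/
lemma exists_equivariant_of_orbitMap {X : CSch} [ModObj T X]
    [IsIso (lift γ[T, M₀] (snd T M₀))] (x₀ : Pt M₀) (z₀ : Pt X) :
    ∃ s : M₀ ⟶ X, orbitMap T x₀ ≫ s = orbitMap T z₀ ∧ x₀ ≫ s = z₀ ∧ IsModHom T s := by
  have := isIso_orbitMap (T := T) x₀
  refine ⟨inv (orbitMap T x₀) ≫ orbitMap T z₀, by simp, ?_, ⟨?_⟩⟩
  · nth_rw 1 [← one_comp_orbitMap (T := T) x₀]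
    rw [Category.assoc, IsIso.hom_inv_id_assoc, one_comp_orbitMap]
  · change γ[T, M₀] ≫ _ = T ◁ _ ≫ γ[T, X]
    rw [← cancel_epi (T ◁ orbitMap T x₀), ← Category.assoc, ← mul_comp_orbitMap, Category.assoc,
      IsIso.hom_inv_id_assoc, ← MonoidalCategory.whiskerLeft_comp_assoc, IsIso.hom_inv_id_assoc,
      mul_comp_orbitMap]

/-- The trivialization of a principal bundle given by a section. -/
def sectionTrivialization (s : M₀ ⟶ P.E) : M₀ ⊗ H ⟶ P.E := s ▷ H ≫ P.act

lemma isPullback_whiskerRight_fst (H : CSch) {X Y : CSch} (s : X ⟶ Y) :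
    IsPullback (s ▷ H) (fst X H) (fst Y H) s := by
  refine ⟨⟨by simp⟩, ⟨Limits.PullbackCone.IsLimit.mk _
    (fun c => lift c.snd (c.fst ≫ snd _ _)) ?_ ?_ ?_⟩⟩
  · intro c
    ext1
    · simpa using c.condition.symm
    · simp
  · intro c
    simp
  · intro c m h1 h2
    ext1
    · simpa using h2
    · simp [← h1]

/-- The map is `(x, h) ↦ s(x) h`. The torsor square of the bundle, pulled back along `s`, identifies
it with the restriction to `M⁰`; equivariance holds because the actions of `T` and `H` commute. -/
lemma isOrbitTrivialization_sectionTrivialization {j : M₀ ⟶ M} {x₀ : Pt M₀} {z₀ : Pt P.E}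
    {s : M₀ ⟶ P.E} [IsModHom T s] (hs : s ≫ P.p = j) (hz : x₀ ≫ s = z₀) :
    IsOrbitTrivialization P j x₀ z₀ (sectionTrivialization P s) := by
  refine ⟨?_, ?_, ?_, ?_⟩
  · rw [← hs]
    exact (isPullback_whiskerRight_fst H s).paste_horiz P.isPullback
  · have h : P.act ▷ H ≫ P.act = (α_ P.E H H).hom ≫ P.E ◁ μ[H] ≫ P.act := by
      rw [P.act_mul, Iso.hom_inv_id_assoc]
    rw [sectionTrivialization, comp_whiskerRight, Category.assoc, h,
      associator_naturality_left_assoc, whisker_exchange_assoc]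
  · rw [sectionTrivialization, MonoidalCategory.whiskerLeft_comp, Category.assoc, P.commute,
      associator_inv_naturality_middle_assoc, ← comp_whiskerRight_assoc, ← smul_comp_hom,
      comp_whiskerRight_assoc]
  · have h1 : lift x₀ η[H] ≫ s ▷ H = lift z₀ (𝟙 _) ≫ P.E ◁ η[H] := by
      ext1 <;> simp [hz]
    rw [sectionTrivialization, reassoc_of% h1, P.act_one]
    simp

variable {P}

/-- A dense open immersion into the integral scheme `M` is schematically dominant, and this property
survives base change along the flat morphism `p`. -/
lemma IsOrbitTrivialization.app_injective {j : M₀ ⟶ M} {x₀ : Pt M₀} {z₀ : Pt P.E}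
    {Φ : M₀ ⊗ H ⟶ P.E} (hΦ : IsOrbitTrivialization P j x₀ z₀ Φ) [IsIntegral M.left]
    [IsLocallyNoetherian M.left] [IsOpenImmersion j.left] (hj : DenseRange j.left)
    (V : P.E.left.Opens) : Function.Injective (Φ.left.app V) := by
  have : IsDominant j.left := ⟨hj⟩
  have := P.flat
  have h := isPullback_left hΦ.isPullback
  have : IsSchemeTheoreticallyDominant j.left := .of_isDominant _
  have : IsSchemeTheoreticallyDominant Φ.left := .of_isPullback h.flip
  have : QuasiCompact Φ.left := MorphismProperty.of_isPullback (P := @QuasiCompact) h.flip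
    inferInstance
  exact Φ.left.app_injective V

/-! ### Vector fields on the trivial bundle -/

/-- The infinitesimal flow on `X × Y` induced by a flow on `X`. -/
def prodFlow {X : CSch} (θ : dualSpec ⊗ X ⟶ X) (Y : CSch) : dualSpec ⊗ (X ⊗ Y) ⟶ X ⊗ Y :=
  (α_ dualSpec X Y).inv ≫ θ ▷ Y

lemma isFlow_prodFlow {X : CSch} {θ : dualSpec ⊗ X ⟶ X} (hθ : IsFlow θ) (Y : CSch) :
    IsFlow (prodFlow θ Y) := by
  have h1 : zeroSec (X ⊗ Y) ≫ (α_ dualSpec X Y).inv = zeroSec X ▷ Y := by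
    ext <;> simp [zeroSec]
  rw [IsFlow, prodFlow, ← Category.assoc, h1, ← comp_whiskerRight, hθ, id_whiskerRight]

lemma related_snd_prodFlow {X : CSch} {θ : dualSpec ⊗ X ⟶ X} (hθ : IsFlow θ) (Y : CSch) :
    VF.Related (snd X Y) (isFlow_prodFlow hθ Y).vf (0 : VF Y ⊤) := by
  rw [← vf_isFlow_snd]
  exact related_vf _ _ (by simp [prodFlow])

lemma IsOrbitTrivialization.related {j : M₀ ⟶ M} {x₀ : Pt M₀} {z₀ : Pt P.E}
    {Φ : M₀ ⊗ H ⟶ P.E} (hΦ : IsOrbitTrivialization P j x₀ z₀ Φ) {τ : dualSpec ⟶ T}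
    (hτ : dualPt ≫ τ = η[T]) :
    VF.Related Φ (isFlow_prodFlow (isFlow_actFlow hτ M₀) H).vf (isFlow_actFlow hτ P.E).vf := by
  refine related_vf _ _ ?_
  rw [prodFlow, actFlow, actFlow, comp_whiskerRight, Category.assoc, Category.assoc,
    whisker_exchange_assoc, hΦ.equivariant, associator_inv_naturality_left_assoc]

end

/-! ### Horizontal lifts -/

section

lemma VF.bracket_res {X : CSch} {U U' : X.left.Opens} (h : U' ≤ U) (v w : VF X U) :
    ⁅v.res h, w.res h⁆ = ⁅v, w⁆.res h := rfl

lemma VF.Related.smul_zero {X Y : CSch} {f : X ⟶ Y} {U : X.left.Opens} {U' : Y.left.Opens}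
    {w : VF X U} (h : VF.Related f w (0 : VF Y U')) (a : Γ(X.left, U)) :
    VF.Related f (a • w) (0 : VF Y U') := by
  intro V hV V' hV' hh s
  rw [smul_app, h V hV V' hV' hh, zero_app, map_zero, mul_zero]

variable {T H : CSch} [GrpObj T] [GrpObj H] {M : CSch} [ModObj T M] {W : M.left.Opens}

lemma PrincipalBundle.translate_p (P : PrincipalBundle H M) (h : Pt H) :
    P.translate h ≫ P.p = P.p := by
  rw [translate, Category.assoc, P.isPullback.w]
  simp

lemma isModHom_translate (P : EquivariantBundle T H M) (h : Pt H) :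
    IsModHom T (P.translate h) := by
  constructor
  change γ[T, P.E] ≫ _ = T ◁ _ ≫ γ[T, P.E]
  have h1 : γ[T, P.E] ≫ lift (𝟙 P.E) (toUnit P.E ≫ h) =
      T ◁ lift (𝟙 P.E) (toUnit P.E ≫ h) ≫ (α_ T P.E H).inv ≫ γ[T, P.E] ▷ H := by
    ext1
    · have h2 : T ◁ lift (𝟙 P.E) (toUnit P.E ≫ h) ≫ (α_ T P.E H).inv ≫ fst _ _ = 𝟙 _ := by
        ext <;> simp
      simp [reassoc_of% h2]
    · simp
  rw [PrincipalBundle.translate, MonoidalCategory.whiskerLeft_comp, Category.assoc, P.commute,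
    reassoc_of% h1]

namespace TorusChart

variable (C : TorusChart T M W) (P : EquivariantBundle T H M) {U : M.left.Opens}

/-- The combination of the fundamental vector fields with given coefficients. -/
def combination (f : Fin C.rank → Γ(M.left, U)) : VF M U := ∑ i, f i • (C.ξ M i).res le_top

/-- The combination of vector fields over the chart with coefficients pulled back from it. -/
def combinationOver {X : CSch} (a : X ⟶ M) (ζ : Fin C.rank → VF X ⊤)
    (f : Fin C.rank → Γ(M.left, U)) : VF X (a.left ⁻¹ᵁ U) :=
  ∑ i, a.left.appLE U (a.left ⁻¹ᵁ U) le_rfl (f i) • (ζ i).res le_top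

/-- The lift to the total space of a combination of fundamental vector fields. -/
def horizontalLift (f : Fin C.rank → Γ(M.left, U)) : VF P.E (P.p.left ⁻¹ᵁ U) :=
  C.combinationOver P.p (C.ξ P.E) f

lemma horizontalLift_add (f g : Fin C.rank → Γ(M.left, U)) :
    C.horizontalLift P (f + g) = C.horizontalLift P f + C.horizontalLift P g := by
  simp only [horizontalLift, combinationOver, Pi.add_apply, map_add, add_smul,
    Finset.sum_add_distrib]

lemma horizontalLift_smul (a : Γ(M.left, U)) (f : Fin C.rank → Γ(M.left, U)) :
    C.horizontalLift P (a • f) =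
      P.p.left.appLE U (P.p.left ⁻¹ᵁ U) le_rfl a • C.horizontalLift P f := by
  simp only [horizontalLift, combinationOver, Pi.smul_apply, smul_eq_mul, map_mul, mul_smul,
    Finset.smul_sum]

lemma combination_smul (a : Γ(M.left, U)) (f : Fin C.rank → Γ(M.left, U)) :
    C.combination (a • f) = a • C.combination f := by
  simp only [combination, Pi.smul_apply, smul_eq_mul, mul_smul, Finset.smul_sum]

lemma combination_add (f g : Fin C.rank → Γ(M.left, U)) :
    C.combination (f + g) = C.combination f + C.combination g := by
  simp only [combination, Pi.add_apply, add_smul, Finset.sum_add_distrib]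

lemma combination_res {U' : M.left.Opens} (h : U' ≤ U) (f : Fin C.rank → Γ(M.left, U)) :
    C.combination (fun i => M.left.presheaf.map (homOfLE h).op (f i)) =
      (C.combination f).res h := by
  ext V hV a
  simp only [combination, VF.res_app, VF.sum_app, VF.smul_app, res_res]

lemma horizontalLift_res {U' : M.left.Opens} (h : U' ≤ U) (f : Fin C.rank → Γ(M.left, U)) :
    C.horizontalLift P (fun i => M.left.presheaf.map (homOfLE h).op (f i)) =
      (C.horizontalLift P f).res (P.p.left.preimage_mono h) := by
  ext V hV a
  simp only [horizontalLift, combinationOver, VF.res_app, VF.sum_app, VF.smul_app, appLE_res,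
    res_appLE]

lemma related_combinationOver {X : CSch} (a : X ⟶ M) {ζ : Fin C.rank → VF X ⊤}
    (h : ∀ i, VF.Related a (ζ i) (C.ξ M i)) (f : Fin C.rank → Γ(M.left, U)) :
    VF.Related a (C.combinationOver a ζ f)
      (C.combination f) :=
  VF.related_sum_smul (fun i _ => (h i).res le_top le_top) _ f

/-- Pulling coefficients back along `p` and then `σ` is pulling them back along `a`. The statement
is used for right translations, for trivializations and for orbit sections. -/
lemma related_combinationOver_horizontalLift {X : CSch} {a : X ⟶ M} {σ : X ⟶ P.E} (hσ : σ ≫ P.p = a)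
    {ζ : Fin C.rank → VF X ⊤} (h : ∀ i, VF.Related σ (ζ i) (C.ξ P.E i))
    (f : Fin C.rank → Γ(M.left, U)) :
    VF.Related σ (C.combinationOver a ζ f)
      (C.horizontalLift P f) := by
  subst hσ
  have := VF.related_sum_smul (s := Finset.univ) (U := (σ ≫ P.p).left ⁻¹ᵁ U)
    (U' := P.p.left ⁻¹ᵁ U) (fun i _ => (h i).res le_top le_top) le_rfl
    fun i => P.p.left.appLE U (P.p.left ⁻¹ᵁ U) le_rfl (f i)
  refine Eq.mp (congrArg (fun w => VF.Related σ w _) (Finset.sum_congr rfl fun i _ => ?_)) this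
  exact congrArg (fun b : Γ(X.left, (σ ≫ P.p).left ⁻¹ᵁ U) => b • (ζ i).res le_top)
    (appLE_appLE _ _ _ _ _)

lemma related_p_horizontalLift (f : Fin C.rank → Γ(M.left, U)) :
    VF.Related P.p (C.horizontalLift P f) (C.combination f) :=
  have := P.equivariant
  C.related_combinationOver P.p (C.related_ξ P.p) f

/-- Right translations commute with `T`, so they preserve the fundamental fields; they also fix the
coefficients, which come from the base. -/
lemma horizontalLift_mem_atiyah (f : Fin C.rank → Γ(M.left, U)) :
    C.horizontalLift P f ∈ atiyah P.toPrincipalBundle U := by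
  intro h
  have := isModHom_translate P h
  exact C.related_combinationOver_horizontalLift P (P.translate_p h) (C.related_ξ _) f

variable [IsCommMonObj T]

lemma bracket_combination (f g : Fin C.rank → Γ(M.left, U)) :
    ⁅C.combination f, C.combination g⁆ = C.combination fun k =>
      (C.combination f).app U le_rfl (g k) - (C.combination g).app U le_rfl (f k) :=
  VF.bracket_sum_smul (fun i k => by rw [VF.bracket_res, C.bracket_ξ]; rfl) f g

/-- The horizontal lift acts on coefficients pulled back from the base as the combination acts on
the base, so the bracket has the same coefficients as in `bracket_combination`. -/
lemma bracket_horizontalLift (f g : Fin C.rank → Γ(M.left, U)) :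
    ⁅C.horizontalLift P f, C.horizontalLift P g⁆ = C.horizontalLift P fun k =>
      (C.combination f).app U le_rfl (g k) - (C.combination g).app U le_rfl (f k) := by
  refine (VF.bracket_sum_smul (fun i k => by rw [VF.bracket_res, C.bracket_ξ]; rfl) _ _).trans ?_
  refine Finset.sum_congr rfl fun k _ => congrArg (· • _) ?_
  refine (congrArg₂ (· - ·) (C.related_p_horizontalLift P f _ le_rfl U le_rfl le_rfl (g k))
    (C.related_p_horizontalLift P g _ le_rfl U le_rfl le_rfl (f k))).trans ?_
  exact (map_sub _ _ _).symm

end TorusChart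

end

section

variable {T H : CSch} [GrpObj T] [GrpObj H] {M : CSch} [ModObj T M] {W : M.left.Opens}

lemma res_appTop {X Y : Scheme.{0}} (f : X ⟶ Y) (V : X.Opens) (a : Γ(Y, ⊤)) :
    X.presheaf.map (homOfLE (le_top : V ≤ ⊤)).op (f.appTop a) = f.appLE ⊤ V le_top a := by
  rw [Scheme.Hom.appTop, Scheme.Hom.app_eq_appLE]
  exact res_appLE f (V := ⊤) le_top le_top a

/-! ### The canonical logarithmic connection -/

namespace TorusChart

section Connection

variable (C : TorusChart T M W) (P : EquivariantBundle T H M) {U : M.left.Opens}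
  [IsIntegral M.left]

lemma combination_injective (hW : (W : Set M.left).Nonempty) :
    Function.Injective (C.combination (U := U)) := C.sum_smul_ξ_injective hW

variable [IsLocallyNoetherian M.left] (hW : (W : Set M.left).Nonempty) (hD : IsSNCComplement W)

/-- The coefficients of a logarithmic vector field in terms of the fundamental vector fields. -/
def coeff (v : logTangent M W U) : Fin C.rank → Γ(M.left, U) :=
  (C.exists_eq_sum_smul_ξ hW hD v.2).choose

lemma combination_coeff (v : logTangent M W U) : C.combination (C.coeff hW hD v) = v.1 :=
  (C.exists_eq_sum_smul_ξ hW hD v.2).choose_spec.symm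

lemma coeff_eq {v : logTangent M W U} {f : Fin C.rank → Γ(M.left, U)}
    (h : v.1 = C.combination f) : C.coeff hW hD v = f :=
  C.combination_injective hW ((C.combination_coeff hW hD v).trans h)

lemma related_p_coeff (v : logTangent M W U) :
    VF.Related P.p (C.horizontalLift P (C.coeff hW hD v)) v.1 := by
  have h := C.related_p_horizontalLift P (C.coeff hW hD v)
  rwa [C.combination_coeff] at h

/-- The logarithmic connection that lifts the fundamental vector fields of the base to those of the
total space. -/
def connection : LogConnection P.toPrincipalBundle W where
  app U := AddMonoidHom.mk'
    (fun v => ⟨C.horizontalLift P (C.coeff hW hD v), C.horizontalLift_mem_atiyah P _, v.1, v.2,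
      C.related_p_coeff P hW hD v⟩)
    (fun v w => by
      ext1
      change C.horizontalLift P _ = C.horizontalLift P _ + C.horizontalLift P _
      rw [← C.horizontalLift_add, C.coeff_eq hW hD]
      rw [C.combination_add, C.combination_coeff, C.combination_coeff]
      rfl)
  app_smul U f v := by
    change C.horizontalLift P _ = _ • C.horizontalLift P _
    rw [Scheme.Hom.app_eq_appLE, ← C.horizontalLift_smul, C.coeff_eq hW hD]
    rw [C.combination_smul, C.combination_coeff]
    rfl
  app_res U U' h v := by
    change C.horizontalLift P _ = (C.horizontalLift P _).res _
    rw [← C.horizontalLift_res P h, C.coeff_eq hW hD]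
    rw [C.combination_res, C.combination_coeff]
    rfl
  split U v := C.related_p_coeff P hW hD v

lemma connection_app (v : logTangent M W U) :
    ((C.connection P hW hD).app U v).1 = C.horizontalLift P (C.coeff hW hD v) := rfl

lemma isIntegrable_connection [IsCommMonObj T] : (C.connection P hW hD).IsIntegrable := by
  intro U v w
  rw [connection_app, connection_app, connection_app, bracket_horizontalLift]
  congr 1
  refine C.coeff_eq hW hD ?_
  rw [← bracket_combination, combination_coeff, combination_coeff]
  rfl

/-- Vector fields related to the fundamental vector fields on the base and on the total space give
lifts of logarithmic vector fields along a section over a morphism to the base. -/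
lemma exists_related {X : CSch} {a : X ⟶ M} {σ : X ⟶ P.E} (hσ : σ ≫ P.p = a)
    {ζ : Fin C.rank → VF X ⊤} (h : ∀ i, VF.Related σ (ζ i) (C.ξ P.E i)) (v : logTangent M W U) :
    VF.Related a (C.combinationOver a ζ (C.coeff hW hD v)) v.1 ∧
      VF.Related σ (C.combinationOver a ζ (C.coeff hW hD v))
        ((C.connection P hW hD).app U v).1 := by
  have := P.equivariant
  refine ⟨?_, C.related_combinationOver_horizontalLift P hσ h _⟩
  nth_rw 1 [← C.combination_coeff hW hD v]
  refine C.related_combinationOver a (fun i => ?_) _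
  subst hσ
  exact (h i).comp (C.related_ξ P.p i) le_top

end Connection

/-! ### Vector fields on a product with the open orbit. -/

section Product

variable {U : M.left.Opens}

/-- The fundamental vector fields on `M₀ × N`, on which `T` acts through the first factor. -/
def ξProd (C : TorusChart T M W) (M₀ N : CSch) [ModObj T M₀] (i : Fin C.rank) : VF (M₀ ⊗ N) ⊤ :=
  (isFlow_prodFlow (isFlow_actFlow (C.dualPt_τ i) M₀) N).vf

lemma related_snd_combinationOver (C : TorusChart T M W) {M₀ N : CSch} [ModObj T M₀]
    (a : M₀ ⊗ N ⟶ M) (f : Fin C.rank → Γ(M.left, U)) :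
    VF.Related (snd M₀ N) (C.combinationOver a (C.ξProd M₀ N) f) (0 : VF N ⊤) := by
  have h0 : (0 : VF N ⊤) = ∑ _i : Fin C.rank, 0 := by simp
  rw [h0]
  exact VF.Related.sum fun i _ => (((related_snd_prodFlow
    (isFlow_actFlow (C.dualPt_τ i) M₀) N).res le_top le_rfl).smul_zero _)

/-- Vector fields on `M₀ × N` are determined by their images on both factors. -/
lemma ext_of_related_prod {M₀ N : CSch} {j : M₀ ⟶ M} [IsOpenImmersion j.left] [IsAffine N.left]
    [IsAffine M₀.left] (hWj : (W : Set M.left) = Set.range j.left) {U' : (M₀ ⊗ N).left.Opens}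
    (hU' : U' ≤ (fst M₀ N ≫ j).left ⁻¹ᵁ U) {w w' : VF (M₀ ⊗ N) U'}
    {v : VF M U} (h1 : VF.Related (fst M₀ N ≫ j) w v) (h1' : VF.Related (fst M₀ N ≫ j) w' v)
    (h2 : VF.Related (snd M₀ N) w (0 : VF N ⊤)) (h2' : VF.Related (snd M₀ N) w' (0 : VF N ⊤)) :
    w = w' := by
  have hpb := isPullback_fst_snd M₀ N
  have : IsAffine (M₀ ⊗ N).left := .of_isPullback hpb
  have hpo := isPushout_appTop_of_isPullback hpb
  refine VF.ext_of_generators (isAffineOpen_top _) le_top _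
    (closure_range_union_of_isPushout hpo) ?_
  have hWj' : W = j.left.opensRange := TopologicalSpace.Opens.ext hWj
  have hle : (⊤ : M₀.left.Opens) ≤ j.left ⁻¹ᵁ W := by rw [hWj']; simp
  rintro _ (⟨a, rfl⟩ | ⟨a, rfl⟩)
  -- Functions on `M₀` are functions on `W`; they are restricted to `U ⊓ W` because `v` is defined
  -- only over `U`.
  · obtain ⟨b, rfl⟩ := (bijective_appLE_of_isOpenImmersion j.left hWj' hle).2 a
    have hle' : U' ≤ (fst M₀ N ≫ j).left ⁻¹ᵁ (U ⊓ W) := fun x hx => ⟨hU' hx, hle trivial⟩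
    have e : (M₀ ⊗ N).left.presheaf.map (homOfLE (le_top : U' ≤ ⊤)).op
        ((fst M₀ N).left.appTop (j.left.appLE W ⊤ hle b)) =
        (fst M₀ N ≫ j).left.appLE (U ⊓ W) U' hle'
          (M.left.presheaf.map (homOfLE inf_le_right).op b) :=
      ((res_appTop _ _ _).trans (appLE_appLE _ _ _ _ _)).trans (appLE_res _ _ _ _).symm
    rw [e, h1 _ le_rfl _ inf_le_left, h1' _ le_rfl _ inf_le_left]
  · have e := res_appTop (snd M₀ N).left U' a
    exact (congrArg _ e).trans ((h2 U' le_rfl ⊤ le_rfl le_top a).trans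
      ((h2' U' le_rfl ⊤ le_rfl le_top a).symm.trans (congrArg _ e).symm))

end Product

/-! ### Comparison with the tautological connection, and uniqueness. -/

section Trivialization

variable {C : TorusChart T M W} {P : EquivariantBundle T H M} {U : M.left.Opens}
  {M₀ : CSch} [ModObj T M₀] {j : M₀ ⟶ M} {x₀ : Pt M₀} {z₀ : Pt P.E} {Φ : M₀ ⊗ H ⟶ P.E}

lemma related_trivialization_ξProd (hΦ : IsOrbitTrivialization P j x₀ z₀ Φ) (i : Fin C.rank) :
    VF.Related Φ (C.ξProd M₀ H i) (C.ξ P.E i) :=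
  hΦ.related (C.dualPt_τ i)

variable [IsIntegral M.left] [IsLocallyNoetherian M.left]
  {hW : (W : Set M.left).Nonempty} {hD : IsSNCComplement W}

/-- The orbit of `z₀` is an equivariant section, and the trivialization it defines relates the
fields `(ξ_i, 0)` on `M₀ × H` to those on the total space. -/
lemma restrictsToTautological_connection [IsIso (lift γ[T, M₀] (snd T M₀))] [IsModHom T j] :
    RestrictsToTautological P j (C.connection P hW hD) := by
  intro x₀ z₀ hz
  obtain ⟨s, hs, hsz, hsT⟩ := exists_equivariant_of_orbitMap (T := T) x₀ z₀
  have hsj : s ≫ P.p = j := by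
    have := isIso_orbitMap (T := T) x₀
    have := P.equivariant
    rw [← cancel_epi (orbitMap T x₀), reassoc_of% hs, orbitMap_comp, orbitMap_comp, hz]
  have hΦ := isOrbitTrivialization_sectionTrivialization P hsj hsz
  refine ⟨_, hΦ, fun V v => ⟨C.combinationOver _ (C.ξProd M₀ H) (C.coeff hW hD v), ?_,
    C.related_snd_combinationOver _ _, ?_⟩⟩
  · exact (C.exists_related P hW hD hΦ.isPullback.w (related_trivialization_ξProd hΦ) v).1
  · exact (C.exists_related P hW hD hΦ.isPullback.w (related_trivialization_ξProd hΦ) v).2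

/-- Any orbit trivialization is also adapted to the canonical connection, so the one supplied with
`δ` serves for both. Their tautological lifts on `M₀ × H` coincide, and functions on the total space
inject into functions there. -/
lemma eq_connection_of_restrictsToTautological [IsOpenImmersion j.left] [IsAffine H.left]
    [IsAffine M₀.left] (hj : DenseRange j.left) (hWj : (W : Set M.left) = Set.range j.left)
    (hz : z₀ ≫ P.p = x₀ ≫ j) {δ : LogConnection P.toPrincipalBundle W}
    (hδ : RestrictsToTautological P j δ) : δ = C.connection P hW hD := by
  obtain ⟨Φ, hΦ, h⟩ := hδ x₀ z₀ hz
  ext U v : 3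
  obtain ⟨w, hw1, hw2, hw3⟩ := h U v
  obtain ⟨h1, h3⟩ := C.exists_related P hW hD hΦ.isPullback.w (related_trivialization_ξProd hΦ) v
  have e := ext_of_related_prod hWj le_rfl hw1 h1 hw2 (C.related_snd_combinationOver _ _)
  subst e
  refine Subtype.ext (VF.Related.unique (hΦ.app_injective hj) ?_ hw3 h3)
  rw [← Scheme.Hom.comp_preimage, left_comp_eq hΦ.isPullback.w]

end Trivialization

end TorusChart

end

/-! ### Flat sections -/

section

/-- An infinitesimal flow moves no points, so it preserves every open subset, even one that is not
stable under `T`. -/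
lemma IsFlow.exists_restrict {U X : CSch} (i : U ⟶ X) [IsOpenImmersion i.left]
    {θ : dualSpec ⊗ X ⟶ X} (hθ : IsFlow θ) :
    ∃ θ' : dualSpec ⊗ U ⟶ U, IsFlow θ' ∧ θ' ≫ i = dualSpec ◁ i ≫ θ := by
  have h1 : zeroSec U ≫ dualSpec ◁ i ≫ θ = i := by
    have : zeroSec U ≫ dualSpec ◁ i = i ≫ zeroSec X := by ext1 <;> simp [zeroSec]
    rw [reassoc_of% this, hθ, Category.comp_id]
  obtain ⟨θ', hθ'⟩ := exists_lift_of_isOpenImmersion i (dualSpec ◁ i ≫ θ) (by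
    rintro _ ⟨z, rfl⟩
    obtain ⟨x, rfl⟩ := (zeroSec U).left.surjective z
    exact ⟨x, congr($(congrArg CommaMorphism.left h1) x).symm⟩)
  have : Mono i := Over.mono_of_mono_left i
  refine ⟨θ', ?_, hθ'⟩
  rw [IsFlow, ← cancel_mono i, Category.assoc, hθ', h1, Category.id_comp]

/-- Relatedness can be checked after composing with an open immersion. -/
lemma VF.Related.of_comp_isOpenImmersion {X Y Z : CSch} {l : X ⟶ Y} {Φ : Y ⟶ Z}
    [IsOpenImmersion Φ.left] {U : X.left.Opens} {U' : Y.left.Opens} {U'' : Z.left.Opens}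
    {v : VF X U} {w : VF Y U'} {u : VF Z U''} (h : VF.Related (l ≫ Φ) v u)
    (h' : VF.Related Φ w u) (hU : U' ≤ Φ.left ⁻¹ᵁ U'') : VF.Related l v w := by
  intro V hV V' hV' hh s
  have hV'' : V' ≤ Φ.left ⁻¹ᵁ (Φ.left ''ᵁ V') := (Φ.left.preimage_image_eq V').ge
  obtain ⟨s', rfl⟩ : ∃ s', Φ.left.appLE (Φ.left ''ᵁ V') V' hV'' s' = s := by
    refine ⟨(Φ.left.appIso V').inv s, ?_⟩
    rw [← Scheme.Hom.appIso_hom']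
    exact congr($((Φ.left.appIso V').inv_hom_id) s)
  have hle : Φ.left ''ᵁ V' ≤ U'' := by
    rintro _ ⟨x, hx, rfl⟩
    exact hU (hV' hx)
  have hle2 : V ≤ (l ≫ Φ).left ⁻¹ᵁ (Φ.left ''ᵁ V') := fun x hx => hV'' (hh hx)
  have e (b : Γ(Z.left, Φ.left ''ᵁ V')) : l.left.appLE V' V hh (Φ.left.appLE _ V' hV'' b) =
      (l ≫ Φ).left.appLE _ V hle2 b := appLE_appLE _ _ _ _ _
  rw [h' V' hV' _ hle, e, e]
  exact h V hV _ hle hle2 _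

variable {T H : CSch} [GrpObj T] [GrpObj H] {M M₀ : CSch} [ModObj T M] [ModObj T M₀]
  {W : M.left.Opens}

lemma TorusChart.eq_constFn_of_related (C : TorusChart T M W) [IsIntegral M.left] {X : CSch}
    {a : X ⟶ M} [IsOpenImmersion a.left] [Nonempty X.left] (ha : a.left.opensRange ≤ W)
    {v : Fin C.rank → VF X (a.left ⁻¹ᵁ W)}
    (hv : ∀ i, VF.Related a (v i) ((C.ξ M i).res (le_top : W ≤ ⊤)))
    (hle : ⊤ ≤ a.left ⁻¹ᵁ W) {g : Γ(X.left, ⊤)} (hg : ∀ i, (v i).app ⊤ hle g = 0) :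
    ∃ c : ℂ, g = constFn X ⊤ c := by
  have hR : (⊤ : X.left.Opens) ≤ a.left ⁻¹ᵁ a.left.opensRange := by simp
  have hbij := bijective_appLE_of_isOpenImmersion a.left rfl hR
  obtain ⟨g', rfl⟩ := hbij.2 g
  obtain ⟨c, rfl⟩ := C.eq_const_of_ξ_eq_zero (U := a.left.opensRange) (f := g')
    (Set.range_nonempty _) ha fun i => by
      apply hbij.1
      rw [map_zero, ← hg i]
      exact (hv i ⊤ hle _ ha hR g').symm
  exact ⟨c, appLE_constFn a hR c⟩

/-- A morphism to an affine scheme is determined by the functions it pulls back, and a constant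
function is recovered from its value at `u`. -/
lemma eq_toUnit_comp_of_const {U H : CSch} [IsAffine H.left] (h : U ⟶ H) (u : Pt U)
    (hc : ∀ s : Γ(H.left, ⊤), ∃ c : ℂ, h.left.appLE ⊤ ⊤ le_top s = constFn U ⊤ c) :
    h = toUnit U ≫ u ≫ h := by
  refine Over.OverMorphism.ext (ext_of_isAffine ?_)
  refine CommRingCat.hom_ext (RingHom.ext fun s => ?_)
  obtain ⟨c, hc⟩ := hc s
  rw [Scheme.Hom.appTop, Scheme.Hom.appTop, Scheme.Hom.app_eq_appLE, Scheme.Hom.app_eq_appLE]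
  refine hc.trans ?_
  have e : (toUnit U ≫ u).left.appLE ⊤ ⊤ le_top (h.left.appLE ⊤ ⊤ le_top s) =
      (toUnit U ≫ u ≫ h).left.appLE ⊤ ⊤ le_top s :=
    (appLE_appLE _ _ _ _ _).trans (appLE_congr_left
      (congrArg CommaMorphism.left (Category.assoc (toUnit U) u h)) _ _)
  refine Eq.trans ?_ e
  rw [hc]
  exact (appLE_constFn _ _ c).symm

variable {P : EquivariantBundle T H M} {j : M₀ ⟶ M} {x₀ : Pt M₀} {z₀ : Pt P.E}
  {Φ : M₀ ⊗ H ⟶ P.E}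

lemma IsOrbitTrivialization.isModHom_section (hΦ : IsOrbitTrivialization P j x₀ z₀ Φ)
    (h : Pt H) : IsModHom T (lift (𝟙 M₀) (toUnit M₀ ≫ h) ≫ Φ) := by
  constructor
  change γ[T, M₀] ≫ _ = T ◁ _ ≫ γ[T, P.E]
  have h1 : γ[T, M₀] ≫ lift (𝟙 M₀) (toUnit M₀ ≫ h) =
      T ◁ lift (𝟙 M₀) (toUnit M₀ ≫ h) ≫ (α_ T M₀ H).inv ≫ γ[T, M₀] ▷ H := by
    ext1
    · have h2 : T ◁ lift (𝟙 M₀) (toUnit M₀ ≫ h) ≫ (α_ T M₀ H).inv ≫ fst _ _ = 𝟙 _ := by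
        ext <;> simp
      simp [reassoc_of% h2]
    · simp
  rw [MonoidalCategory.whiskerLeft_comp, Category.assoc, hΦ.equivariant, reassoc_of% h1]

/-- The section `x ↦ Φ(x, h)` with `h` fixed is equivariant, so it carries the orbit of `x₀` to an
orbit upstairs. -/
lemma IsOrbitTrivialization.isOrbitSection (hΦ : IsOrbitTrivialization P j x₀ z₀ Φ)
    (h : Pt H) : IsOrbitSection P j (x₀ ≫ lift (𝟙 M₀) (toUnit M₀ ≫ h) ≫ Φ)
      (lift (𝟙 M₀) (toUnit M₀ ≫ h) ≫ Φ) := by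
  have := hΦ.isModHom_section h
  have hp : (lift (𝟙 M₀) (toUnit M₀ ≫ h) ≫ Φ) ≫ P.p = j := by
    rw [Category.assoc, hΦ.isPullback.w, lift_fst_assoc, Category.id_comp]
  exact ⟨hp, x₀, by rw [Category.assoc, hp], orbitMap_comp _ _⟩

lemma IsOrbitSection.isModHom [IsIso (lift γ[T, M₀] (snd T M₀))] {s : M₀ ⟶ P.E}
    (hs : IsOrbitSection P j z₀ s) : IsModHom T s := by
  obtain ⟨-, x, -, h⟩ := hs
  obtain ⟨s', hs', -, hT⟩ := exists_equivariant_of_orbitMap (T := T) x z₀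
  have := isIso_orbitMap (T := T) x
  have : s = s' := by rw [← cancel_epi (orbitMap T x), h, hs']
  rwa [this]

lemma exists_isOrbitSection [IsIso (lift γ[T, M₀] (snd T M₀))] [IsModHom T j]
    (hz : z₀ ≫ P.p = x₀ ≫ j) : ∃ s : M₀ ⟶ P.E, IsOrbitSection P j z₀ s ∧ x₀ ≫ s = z₀ := by
  obtain ⟨s, hs, hsz, hsT⟩ := exists_equivariant_of_orbitMap (T := T) x₀ z₀
  have := isIso_orbitMap (T := T) x₀
  have := P.equivariant
  refine ⟨s, ⟨?_, x₀, hz, hs⟩, hsz⟩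
  rw [← cancel_epi (orbitMap T x₀), reassoc_of% hs, orbitMap_comp, orbitMap_comp, hz]

namespace TorusChart

variable {C : TorusChart T M W} [IsIntegral M.left] [IsLocallyNoetherian M.left]
  {hW : (W : Set M.left).Nonempty} {hD : IsSNCComplement W}

/-- An orbit section is equivariant, so it carries the fundamental fields on `M₀`, restricted to
`U`, to those on the total space, which the connection lifts. -/
lemma isFlatSection_of_isOrbitSection [IsIso (lift γ[T, M₀] (snd T M₀))] {s : M₀ ⟶ P.E}
    (hs : IsOrbitSection P j z₀ s) {U : CSch} (i : U ⟶ M₀) [IsOpenImmersion i.left] :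
    (C.connection P hW hD).IsFlatSection (i ≫ j) (i ≫ s) := by
  have := hs.isModHom
  choose θ hθ hθi using fun k : Fin C.rank =>
    (isFlow_actFlow (C.dualPt_τ k) M₀).exists_restrict i
  intro V v
  have hp : (i ≫ s) ≫ P.p = i ≫ j := by rw [Category.assoc, hs.1]
  have hrel (k : Fin C.rank) : VF.Related (i ≫ s) (hθ k).vf (C.ξ P.E k) :=
    (related_vf (hθ k) _ (hθi k)).comp (C.related_ξ s k) le_top
  exact ⟨_, C.exists_related P hW hD hp hrel v⟩

/-- In the trivialization `σ` becomes a pair `(i, h)` with `h : U ⟶ H`. Flatness says that the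
fundamental fields kill all functions pulled back along `h`, so `h` is constant. -/
lemma exists_isOrbitSection_of_isFlatSection [IsOpenImmersion j.left] [IsAffine H.left]
    [LocallyOfFiniteType M.hom] (hWj : (W : Set M.left) = Set.range j.left)
    (hΦ : IsOrbitTrivialization P j x₀ z₀ Φ) {U : CSch} (i : U ⟶ M₀) [IsOpenImmersion i.left]
    [Nonempty U.left] {σ : U ⟶ P.E} (hσ : σ ≫ P.p = i ≫ j)
    (hflat : (C.connection P hW hD).IsFlatSection (i ≫ j) σ) :
    ∃ (z : Pt P.E) (s : M₀ ⟶ P.E), IsOrbitSection P j z s ∧ σ = i ≫ s := by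
  have hij : (i ≫ j).left = i.left ≫ j.left := rfl
  have hijo : IsOpenImmersion (i ≫ j).left := by rw [hij]; infer_instance
  have hΦo : IsOpenImmersion Φ.left := MorphismProperty.of_isPullback (P := @IsOpenImmersion)
    (isPullback_left hΦ.isPullback).flip inferInstance
  have hR : (i ≫ j).left.opensRange ≤ W := by
    rintro _ ⟨x, rfl⟩
    change _ ∈ (W : Set M.left)
    rw [hWj]
    exact ⟨i.left x, rfl⟩
  have htop : ⊤ ≤ (i ≫ j).left ⁻¹ᵁ W := fun x _ => hR ⟨x, rfl⟩
  let l : U ⟶ M₀ ⊗ H := hΦ.isPullback.lift σ i hσ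
  have hlΦ : l ≫ Φ = σ := hΦ.isPullback.lift_fst _ _ _
  have hli : l ≫ fst _ _ = i := hΦ.isPullback.lift_snd _ _ _
  have hlij : l ≫ fst M₀ H ≫ j = i ≫ j := by rw [← Category.assoc, hli]
  -- Over `W` the logarithmic condition is vacuous, so flatness can be tested on the fundamental
  -- fields.
  let ξW (k : Fin C.rank) : logTangent M W W :=
    ⟨(C.ξ M k).res le_top, fun V hV f _ => (M.left.basicOpen_le _).trans hV⟩
  choose v hv1 hv2 using fun k => hflat W (ξW k)
  have hvl (k : Fin C.rank) : VF.Related (l ≫ snd _ _) (v k) (0 : VF H ⊤) := by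
    have h1 := (C.exists_related P hW hD hΦ.isPullback.w (related_trivialization_ξProd hΦ)
      (ξW k)).2
    have h2 := hv2 k
    rw [← hlΦ] at h2
    -- Since `Φ` is an open immersion, tangency in the total space descends to `M₀ × H`, where the
    -- lifted field has no component along `H`.
    refine VF.Related.comp (VF.Related.of_comp_isOpenImmersion h2 h1 ?_)
      (C.related_snd_combinationOver _ _) ?_
    · rw [← Scheme.Hom.comp_preimage, left_comp_eq hΦ.isPullback.w]
    · rw [← Scheme.Hom.comp_preimage, left_comp_eq hlij]
  have hlft : LocallyOfFiniteType U.hom := by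
    rw [← Over.w (i ≫ j)]; infer_instance
  obtain ⟨u, -⟩ := exists_pt (⊤ : U.left.Opens) ⟨Classical.arbitrary _, trivial⟩
  have hconst := eq_toUnit_comp_of_const (l ≫ snd _ _) u fun s =>
    C.eq_constFn_of_related hR hv1 htop fun k =>
      (hvl k ⊤ htop ⊤ le_rfl le_top s).trans (map_zero _)
  refine ⟨_, _, hΦ.isOrbitSection (u ≫ l ≫ snd _ _), ?_⟩
  rw [← hlΦ, ← Category.assoc]
  congr 1
  ext1
  · simp [hli]
  · rw [hconst]
    simp

end TorusChart

end

end LogConn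

end

/-- Every `T`-equivariant principal `H`-bundle on a smooth projective toric variety `M` with open
orbit `M⁰` admits a canonical integrable logarithmic connection, singular along `D = M ∖ M⁰`: the
unique one which restricts over `M⁰` to the tautological connection, whose flat sections are the
`T`-orbits. -/
theorem proposition3p2
    (T : LogConn.CSch) [GrpObj T]
    (M M₀ : LogConn.CSch) [ModObj T M] [ModObj T M₀] (j : M₀ ⟶ M)
    (hM : LogConn.IsSmoothToric T j)
    (W : M.left.Opens) (hW : (W : Set M.left) = Set.range j.left)
    (H : LogConn.CSch) [GrpObj H] [IsAffine H.left] [LocallyOfFiniteType H.hom] [IsReduced H.left]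
    (P : LogConn.EquivariantBundle T H M) :
    ∃ δ : LogConn.LogConnection P.toPrincipalBundle W,
      δ.IsIntegrable ∧
      LogConn.RestrictsToTautological P j δ ∧
      LogConn.FlatSectionsAreOrbits P j δ ∧
      ∀ δ' : LogConn.LogConnection P.toPrincipalBundle W,
        LogConn.RestrictsToTautological P j δ' → δ' = δ := by
  open LogConn in
  have := hM.integral
  have := hM.smooth
  have := hM.simplyTransitive
  have := hM.equivariant
  have := hM.isOpenImmersion
  have := isCommMonObj_of_isTorus hM.isTorus
  have hWne : (W : Set M.left).Nonempty := by
    rw [hW]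
    have := hM.dense.nonempty
    exact Set.range_nonempty _
  have hD := hM.snc W hW
  have : LocallyOfFiniteType M.hom := inferInstance
  have : IsLocallyNoetherian M.left := LocallyOfFiniteType.isLocallyNoetherian M.hom
  -- The base points are chosen upstairs first: a `ℂ`-point of the total space over `W` projects to
  -- a `ℂ`-point of `M₀`.
  obtain ⟨x₀, z₀, hz⟩ : ∃ (x₀ : Pt M₀) (z₀ : Pt P.E), z₀ ≫ P.p = x₀ ≫ j := by
    have := P.locallyOfFiniteType
    have := P.surjective
    have : LocallyOfFiniteType P.E.hom := by rw [← Over.w P.p]; infer_instance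
    obtain ⟨x, hx⟩ := hWne
    obtain ⟨y, rfl⟩ := P.p.left.surjective x
    obtain ⟨z₀, hz⟩ := exists_pt (P.p.left ⁻¹ᵁ W) ⟨y, hx⟩
    obtain ⟨x₀, hx₀⟩ := exists_lift_of_isOpenImmersion j (z₀ ≫ P.p) (by
      rintro _ ⟨y, rfl⟩
      rw [← hW]
      exact hz ⟨y, rfl⟩)
    exact ⟨x₀, z₀, hx₀.symm⟩
  obtain ⟨C⟩ := exists_torusChart hM hW x₀
  have hM₀ : IsAffine M₀.left := by
    have h := C.isAffineOpen
    rw [show W = j.left.opensRange from TopologicalSpace.Opens.ext hW] at h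
    have : IsAffine j.left.opensRange := h
    exact .of_isIso j.left.isoOpensRange.hom
  obtain ⟨Φ, hΦ, -⟩ := TorusChart.restrictsToTautological_connection (C := C) (P := P) (j := j)
    (hW := hWne) (hD := hD) x₀ z₀ hz
  refine ⟨C.connection P hWne hD, C.isIntegrable_connection P hWne hD,
    TorusChart.restrictsToTautological_connection, ⟨fun x z h => ?_, ?_⟩, fun δ' hδ' =>
      TorusChart.eq_connection_of_restrictsToTautological hM.dense hW hz hδ'⟩
  · obtain ⟨s, hs, -⟩ := exists_isOrbitSection h
    exact ⟨s, hs⟩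
  · intro U i σ hi hU hσ
    refine ⟨TorusChart.exists_isOrbitSection_of_isFlatSection hW hΦ i hσ, ?_⟩
    rintro ⟨z, s, hs, rfl⟩
    exact TorusChart.isFlatSection_of_isOrbitSection hs i
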